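/- Let $k$ be a commutative ring and $n\ge 0$. Let $\mathbb A^n_{\mathbb F_1}$ be the finite topological space whose points are the subsets of $\{1,\dots,n\}$ and whose open subsets are the subsets closed upwards with respect to inclusion. Let $\mathbf 0=\emptyset$ be its closed point, $\mathbf 1=\{1,\dots,n\}$ its generic (open) point, and, for a point $p$, let $U_p=\{q : p\subseteq q\}$ be its smallest open neighbourhood and $d_p=\dim U_p$ (Krull dimension). Let $D(\mathbb A^n_{\mathbb F_1})$ be the (unbounded) derived category of sheaves of $k$-modules on $\mathbb A^n_{\mathbb F_1}$, let $\omega=k_{\{\mathbf 1\}}$ be the constant sheaf $k$ supported on $\{\mathbf 1\}$ (extension by zero), let $\mathbb R\Gamma_Z(U,-)$ be the right derived functor of the functor $\Gamma_Z(U,-)$ of sections on the open subset $U$ with support in $Z$, $H^i_Z(U,-)$ its $i$-th cohomology, and let $E^\vee=\mathbb R\mathrm{Hom}_k(E,k)$ for $E\in D(k)$, $M^*=\mathrm{Hom}_k(M,k)$ for a $k$-module $M$. All isomorphisms below are natural in $F$. (1) For $F\in D(\mathbb A^n_{\mathbb F_1})$, $$\mathbb R\mathrm{Hom}(F,\omega)\cong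 \mathbb R\Gamma_{\mathbf 0}(\mathbb A^n_{\mathbb F_1},F)^\vee[-n].$$ If $k$ is a field and $F$ is a sheaf, then for every $i\in\mathbb Z$ $$\mathrm{Ext}^i(F,\omega)=H^i\,\mathbb R\mathrm{Hom}(F,\omega)\cong H^{n-i}_{\mathbf 0}(\mathbb A^n_{\mathbb F_1},F)^*.$$ (2) For $F\in D(\mathbb A^n_{\mathbb F_1})$ and every point $p$, $$\left[\mathbb R\mathcal Hom(F,\omega)\right]_p\cong \mathbb R\Gamma_p(U_p,F)^\vee[-d_p].$$ If $k$ is a field and $F$ is a sheaf, then for every $i\in\mathbb Z$ $$\left[\mathcal Ext^i(F,\omega)\right]_p\cong H^{d_p-i}_p(U_p,F)^*,$$ where $\mathcal Ext^i(F,\omega)$ is the $i$-th cohomology sheaf of $\mathbb R\mathcal Hom(F,\omega)$. In particular, the right derived functors $\mathbb R\Gamma_{\mathbf 0}(\mathbb A^n_{\mathbb F_1},-)$ and $\mathbb R\Gamma_p(U_p,-)$ on $D(\mathbb A^n_{\mathbb F_1})$ exist. -/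

import Mathlib

universe u w₁ w₂

namespace PosetDuality

open CategoryTheory CochainComplex CochainComplex.HomComplex

noncomputable section

section

/-! ### The complex of `k`-modules `Hom(K, L)` -/

variable {C : Type*} [Category.{u} C] [Abelian C] (k : Type u) [CommRing k] [Linear k C]

/-- The complex of `k`-modules `Hom(K, L)`: in degree `n` it consists of the families of
morphisms `K.X p ⟶ L.X (p + n)`, with the usual differential. -/
@[simps]
def homCx (K L : CochainComplex C ℤ) : CochainComplex (ModuleCat.{u} k) ℤ where
  X n := ModuleCat.of k (Cochain K L n)
  d n m := ModuleCat.ofHom (δ_hom k K L n m)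
  shape n m h := ModuleCat.hom_ext (LinearMap.ext fun z => δ_shape n m h z)
  d_comp_d' n m l _ _ := ModuleCat.hom_ext (LinearMap.ext fun z => δ_δ n m l z)

/-- The contravariant functor `K ↦ Hom(K, L)`. -/
@[simps]
def homCxFunctor (L : CochainComplex C ℤ) :
    (CochainComplex C ℤ)ᵒᵖ ⥤ CochainComplex (ModuleCat.{u} k) ℤ where
  obj K := homCx k K.unop L
  map f :=
    { f n := ModuleCat.ofHom
        { toFun z := (Cochain.ofHom f.unop).comp z (zero_add n)
          map_add' _ _ := Cochain.comp_add ..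
          map_smul' _ _ := Cochain.comp_smul .. }
      comm' n m _ := ModuleCat.hom_ext (LinearMap.ext fun z => δ_ofHom_comp f.unop z m) }
  map_id K := by
    ext n : 1
    exact ModuleCat.hom_ext (LinearMap.ext fun z => Cochain.id_comp z)
  map_comp f g := by
    ext n : 1
    refine ModuleCat.hom_ext (LinearMap.ext fun z => ?_)
    refine (congrArg (fun y => Cochain.comp y z (zero_add n))
      (Cochain.ofHom_comp g.unop f.unop)).trans ?_
    exact Cochain.comp_assoc_of_first_is_zero_cochain ..

lemma precomp_bijective {K K' L : CochainComplex C ℤ} [L.IsKInjective] (f : K ⟶ K') [QuasiIso f]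
    (n : ℤ) :
    Function.Bijective (fun g : (HomotopyCategory.quotient C (ComplexShape.up ℤ)).obj K' ⟶
      (HomotopyCategory.quotient C (ComplexShape.up ℤ)).obj (L⟦n⟧) =>
        (HomotopyCategory.quotient C (ComplexShape.up ℤ)).map f ≫ g) := by
  let _ := HasDerivedCategory.standard C
  have : IsIso (DerivedCategory.Qh.map
      ((HomotopyCategory.quotient C (ComplexShape.up ℤ)).map f)) := by
    have := (NatIso.isIso_map_iff (DerivedCategory.quotientCompQhIso C) f).2 inferInstance
    exact this
  have h := CochainComplex.IsKInjective.Qh_map_bijective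
    ((HomotopyCategory.quotient C (ComplexShape.up ℤ)).obj K) (L⟦n⟧)
  have h' := CochainComplex.IsKInjective.Qh_map_bijective
    ((HomotopyCategory.quotient C (ComplexShape.up ℤ)).obj K') (L⟦n⟧)
  rw [← Function.Bijective.of_comp_iff' h]
  have e : (DerivedCategory.Qh.map ∘ fun g : (HomotopyCategory.quotient C (ComplexShape.up ℤ)).obj K' ⟶
      (HomotopyCategory.quotient C (ComplexShape.up ℤ)).obj (L⟦n⟧) =>
        (HomotopyCategory.quotient C (ComplexShape.up ℤ)).map f ≫ g) =
      (fun g => DerivedCategory.Qh.map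
      ((HomotopyCategory.quotient C (ComplexShape.up ℤ)).map f) ≫ g) ∘ DerivedCategory.Qh.map := by
    funext g
    exact Functor.map_comp _ _ _
  rw [e]
  refine Function.Bijective.comp ?_ h'
  exact ⟨fun a b hab => (cancel_epi _).1 hab, fun b => ⟨inv (DerivedCategory.Qh.map
      ((HomotopyCategory.quotient C (ComplexShape.up ℤ)).map f)) ≫ b, by simp⟩⟩

lemma precomp_class_bijective {K K' L : CochainComplex C ℤ} [L.IsKInjective] (f : K ⟶ K')
    [QuasiIso f] (n : ℤ) (φ : CohomologyClass K' L n → CohomologyClass K L n)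
    (hφ : ∀ z, φ (.mk z) = .mk (Cocycle.precomp z f)) : Function.Bijective φ := by
  rw [← Function.Bijective.of_comp_iff' (CohomologyClass.toHom_bijective K L n)]
  have e : (CohomologyClass.toHom (K := K) (L := L) (n := n)) ∘ φ =
    (fun g => (HomotopyCategory.quotient C (ComplexShape.up ℤ)).map f ≫ g) ∘
      (CohomologyClass.toHom (K := K') (L := L) (n := n)) := by
    funext x
    obtain ⟨x, rfl⟩ := x.mk_surjective
    simp only [Function.comp_apply, hφ, CohomologyClass.toHom_mk, ← Functor.map_comp,
      Cocycle.equivHomShift_symm_precomp]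
  rw [e]
  exact (precomp_bijective f n).comp (CohomologyClass.toHom_bijective K' L n)

/-- Precomposition with `f`, on the underlying complexes of abelian groups. -/
def homComplexPrecomp {K K' : CochainComplex C ℤ} (f : K ⟶ K') (L : CochainComplex C ℤ) :
    HomComplex K' L ⟶ HomComplex K L where
  f n := AddCommGrpCat.ofHom
    { toFun z := (Cochain.ofHom f).comp z (zero_add n)
      map_zero' := Cochain.comp_zero ..
      map_add' _ _ := Cochain.comp_add .. }
  comm' n m _ := by
    ext1
    exact AddMonoidHom.ext fun z => δ_ofHom_comp f z m

lemma homComplexPrecomp_quasiIso (L : CochainComplex C ℤ) [L.IsKInjective]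
    {K K' : CochainComplex C ℤ} (f : K ⟶ K') [QuasiIso f] :
    QuasiIso (homComplexPrecomp f L) := by
  rw [_root_.quasiIso_iff]
  intro n
  rw [quasiIsoAt_iff]
  let φ : CohomologyClass K' L n →+ CohomologyClass K L n :=
    CohomologyClass.descAddMonoidHom
      { toFun z := CohomologyClass.mk (Cocycle.precomp z f)
        map_zero' := by
          rw [← CohomologyClass.mk_zero]; congr 1; ext; simp [Cocycle.precomp]
        map_add' x y := by
          rw [← CohomologyClass.mk_add]; congr 1; ext; simp [Cocycle.precomp] } (by
      rintro ⟨x, hx⟩ ⟨m, hm, β, rfl⟩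
      refine (CohomologyClass.mk_eq_zero_iff _).2 ⟨m, hm, (Cochain.ofHom f).comp β (zero_add m), ?_⟩
      simp [Cocycle.precomp])
  have hφ : Function.Bijective φ := precomp_class_bijective f n φ (fun z => rfl)
  let γ : ShortComplex.LeftHomologyMapData
      ((HomologicalComplex.shortComplexFunctor AddCommGrpCat.{u} (ComplexShape.up ℤ) n).map
        (homComplexPrecomp f L)) (leftHomologyData K' L n) (leftHomologyData K L n) :=
    { φK := AddCommGrpCat.ofHom
        { toFun z := Cocycle.precomp z f
          map_zero' := by ext; simp [Cocycle.precomp]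
          map_add' x y := by ext; simp [Cocycle.precomp] }
      φH := AddCommGrpCat.ofHom φ
      commi := rfl
      commf' := by
        have hi : AddCommGrpCat.ofHom
          { toFun z := Cocycle.precomp z f
            map_zero' := by ext; simp [Cocycle.precomp]
            map_add' x y := by ext; simp [Cocycle.precomp] } ≫ (leftHomologyData K L n).i =
          (leftHomologyData K' L n).i ≫ ((HomologicalComplex.shortComplexFunctor AddCommGrpCat.{u}
            (ComplexShape.up ℤ) n).map (homComplexPrecomp f L)).τ₂ := rfl
        rw [← cancel_mono (leftHomologyData K L n).i]
        refine (Category.assoc _ _ _).trans ?_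
        refine (congrArg (fun t => (leftHomologyData K' L n).f' ≫ t) hi).trans ?_
        refine (Category.assoc _ _ _).symm.trans ?_
        refine (congrArg (fun t => t ≫ _) (leftHomologyData K' L n).f'_i).trans ?_
        refine Eq.trans ?_ (Category.assoc _ _ _).symm
        refine Eq.trans ?_ (congrArg (fun t => _ ≫ t) (leftHomologyData K L n).f'_i).symm
        exact (ShortComplex.Hom.comm₁₂ ((HomologicalComplex.shortComplexFunctor AddCommGrpCat.{u}
            (ComplexShape.up ℤ) n).map (homComplexPrecomp f L))).symm
      commπ := rfl }
  rw [γ.quasiIso_iff]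
  exact (ConcreteCategory.isIso_iff_bijective _).2 hφ

lemma homCxFunctor_map_quasiIso (L : CochainComplex C ℤ) [L.IsKInjective]
    {K K' : CochainComplex C ℤ} (f : K ⟶ K') [QuasiIso f] :
    QuasiIso ((homCxFunctor k L).map f.op) := by
  rw [← HomologicalComplex.quasiIso_map_iff_of_preservesHomology _
    (forget₂ (ModuleCat.{u} k) AddCommGrpCat.{u})]
  exact homComplexPrecomp_quasiIso L f
end
section
open TopologicalSpace Opposite

/-- The category of sheaves of `k`-modules on `X`. -/
abbrev Shv (k : Type u) [CommRing k] (X : TopCat.{u}) := TopCat.Sheaf (ModuleCat.{u} k) X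

variable (k : Type u) [CommRing k] {X : TopCat.{u}}

instance : Linear k (Shv k X) :=
  inferInstanceAs (Linear k (Sheaf (Opens.grothendieckTopology X) (ModuleCat.{u} k)))


/-- Restriction of sheaves on `X` to the open subset `U`. -/
abbrev resOpen (U : Opens X) :
    Shv k X ⥤ Sheaf ((Opens.grothendieckTopology X).over U) (ModuleCat.{u} k) :=
  (Opens.grothendieckTopology X).overPullback (ModuleCat.{u} k) U

/-- Restriction of sheaves on `U` to a smaller open subset `V`. -/
abbrev resOpenOpen {U V : Opens X} (f : V ⟶ U) :
    Sheaf ((Opens.grothendieckTopology X).over U) (ModuleCat.{u} k) ⥤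
    Sheaf ((Opens.grothendieckTopology X).over V) (ModuleCat.{u} k) :=
  (Opens.grothendieckTopology X).overMapPullback (ModuleCat.{u} k) f

instance (U : Opens X) : (resOpen k U).Additive where
instance (U : Opens X) : (resOpen k U).Linear k where
instance  {U V : Opens X} (f : V ⟶ U) : (resOpenOpen k f).Additive where
instance  {U V : Opens X} (f : V ⟶ U) : (resOpenOpen k f).Linear k where


/-- Restriction of complexes of sheaves to `U`. -/
abbrev resCx (U : Opens X) : CochainComplex (Shv k X) ℤ ⥤ CochainComplex
  (Sheaf ((Opens.grothendieckTopology X).over U) (ModuleCat.{u} k)) ℤ :=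
  (resOpen k U).mapHomologicalComplex _

variable {k}

lemma shv_hom_ext {F G : Shv k X} {f g : F ⟶ G} (h : ∀ U, f.hom.app U = g.hom.app U) : f = g :=
  ObjectProperty.hom_ext _ (NatTrans.ext (funext h))

/-- Restriction of cochains `K|U → L|U` to `V`. -/
def cochainRes (K L : CochainComplex (Shv k X) ℤ) {U V : Opens X} (f : V ⟶ U) (n : ℤ) :
    Cochain ((resCx k U).obj K) ((resCx k U).obj L) n →ₗ[k]
      Cochain ((resCx k V).obj K) ((resCx k V).obj L) n where
  toFun z := z.map (resOpenOpen k f)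
  map_add' z z' := Cochain.map_add z z' _
  map_smul' _ _ := rfl

lemma cochainRes_precomp {K K' : CochainComplex (Shv k X) ℤ} (f : K ⟶ K')
    (L : CochainComplex (Shv k X) ℤ) {U V : Opens X} (g : V ⟶ U) (n : ℤ)
    (z : Cochain ((resCx k U).obj K') ((resCx k U).obj L) n) :
    cochainRes K L g n ((Cochain.ofHom ((resCx k U).map f)).comp z (zero_add n)) =
      (Cochain.ofHom ((resCx k V).map f)).comp (cochainRes K' L g n z) (zero_add n) := by
  refine (Cochain.map_comp _ (Cochain.ofHom ((resCx k U).map f)) z (zero_add n)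
    (resOpenOpen k g)).trans ?_
  rw [Cochain.map_ofHom]
  rfl

/-- The presheaf `U ↦ Hom(K|U, L|U)` in degree `n`. -/
def preHom (K L : CochainComplex (Shv k X) ℤ) (n : ℤ) :
    TopCat.Presheaf (ModuleCat.{u} k) X where
  obj U := ModuleCat.of k (Cochain ((resCx k U.unop).obj K) ((resCx k U.unop).obj L) n)
  map f := ModuleCat.ofHom (cochainRes K L f.unop n)
  map_id U := by
    refine ModuleCat.hom_ext (LinearMap.ext fun z => ?_)
    funext T
    exact ConcreteCategory.congr_hom ((sheafHom' (K.X T.p) (L.X T.q)).map_id U) (z T)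
  map_comp f g := by
    refine ModuleCat.hom_ext (LinearMap.ext fun z => ?_)
    funext T
    exact ConcreteCategory.congr_hom ((sheafHom' (K.X T.p) (L.X T.q)).map_comp f g) (z T)

lemma preHom_isSheaf (K L : CochainComplex (Shv k X) ℤ) (n : ℤ) :
    (preHom K L n).IsSheaf := by
  refine (Presheaf.isSheaf_iff_isSheaf_forget _ _ (forget (ModuleCat.{u} k))).2 ?_
  rw [isSheaf_iff_isSheaf_of_type]
  intro U S hS x hx
  have H : ∀ T : Triplet n, Presieve.IsSheafFor (sheafHom' (K.X T.p) (L.X T.q)) S.arrows := fun T =>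
    (isSheaf_iff_isSheaf_of_type _ _).1 (sheafHom (K.X T.p) (L.X T.q)).property S hS
  have hx' : ∀ T : Triplet n, Presieve.FamilyOfElements.Compatible
      (P := sheafHom' (K.X T.p) (L.X T.q)) (R := S.arrows) (fun V f hf => x f hf T) :=
    fun T Y₁ Y₂ Z g₁ g₂ f₁ f₂ h₁ h₂ e => congrFun (hx g₁ g₂ h₁ h₂ e) T
  choose y hy hy' using fun T => H T _ (hx' T)
  exact ⟨y, fun V f hf => funext fun T => hy T f hf,
    fun y' h' => funext fun T => hy' T _ fun V f hf => congrFun (h' f hf) T⟩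

/-- The complex of sheaves `𝓗om(K, L)`, with sections `Hom(K|U, L|U)` on `U`. -/
@[simps]
def sheafHomCx (K L : CochainComplex (Shv k X) ℤ) : CochainComplex (Shv k X) ℤ where
  X n := ⟨preHom K L n, preHom_isSheaf K L n⟩
  d n m := ⟨
    { app U := (homCx k ((resCx k U.unop).obj K) ((resCx k U.unop).obj L)).d n m
      naturality U V f := ModuleCat.hom_ext (LinearMap.ext fun z =>
        δ_map (n := n) m z (resOpenOpen k f.unop)) }⟩
  shape n m h := by
    refine shv_hom_ext fun U => ?_
    exact (homCx k ((resCx k (unop U)).obj K) ((resCx k (unop U)).obj L)).shape n m h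
  d_comp_d' n m l _ _ := by
    refine shv_hom_ext fun U => ?_
    exact (homCx k ((resCx k (unop U)).obj K) ((resCx k (unop U)).obj L)).d_comp_d n m l

/-- The contravariant functor `K ↦ 𝓗om(K, L)`. -/
def sheafHomCxFunctor (L : CochainComplex (Shv k X) ℤ) :
    (CochainComplex (Shv k X) ℤ)ᵒᵖ ⥤ CochainComplex (Shv k X) ℤ where
  obj K := sheafHomCx K.unop L
  map {K K'} f :=
    { f n := ⟨
        { app U := ((homCxFunctor k ((resCx k U.unop).obj L)).map
            ((resCx k U.unop).map f.unop).op).f n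
          naturality U V g := ModuleCat.hom_ext (LinearMap.ext fun z =>
            (cochainRes_precomp f.unop L g.unop n z).symm) }⟩
      comm' n m _ := by
        refine shv_hom_ext fun U => ?_
        exact ((homCxFunctor k ((resCx k (unop U)).obj L)).map
            ((resCx k (unop U)).map f.unop).op).comm n m }
  map_id K := by
    ext n : 1
    refine shv_hom_ext fun U => ?_
    have := congrArg (fun t => HomologicalComplex.Hom.f t n)
      ((homCxFunctor k ((resCx k (unop U)).obj L)).map_id (op ((resCx k (unop U)).obj K.unop)))
    refine Eq.trans ?_ this
    congr 3
  map_comp f g := by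
    ext n : 1
    refine shv_hom_ext fun U => ?_
    have := congrArg (fun t => HomologicalComplex.Hom.f t n)
      ((homCxFunctor k ((resCx k (unop U)).obj L)).map_comp ((resCx k (unop U)).map f.unop).op
        ((resCx k (unop U)).map g.unop).op)
    refine Eq.trans ?_ this
    congr 3
open Limits

/-- Extension by zero, the left adjoint of the restriction to `U`. It is only used to see that
the restriction of an injective sheaf is injective. -/
def jShriek (k : Type u) [CommRing k] (U : Opens X) :
    Sheaf ((Opens.grothendieckTopology X).over U) (ModuleCat.{u} k) ⥤ Shv k X :=
  Functor.sheafPullbackConstruction.sheafPullback (Over.forget U) (ModuleCat.{u} k)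
    ((Opens.grothendieckTopology X).over U) (Opens.grothendieckTopology X)

/-- Extension by zero is left adjoint to the restriction. -/
def jShriekAdj (k : Type u) [CommRing k] (U : Opens X) :  jShriek k U ⊣ resOpen k U :=
  Functor.sheafPullbackConstruction.sheafAdjunctionContinuous (Over.forget U) (ModuleCat.{u} k)
    ((Opens.grothendieckTopology X).over U) (Opens.grothendieckTopology X)

/-- The restriction is left adjoint to the direct image. -/
def resOpenAdj (k : Type u) [CommRing k] (U : Opens X) :  resOpen k U ⊣ 
    (Over.forget U).sheafPushforwardCocontinuous (ModuleCat.{u} k)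
    ((Opens.grothendieckTopology X).over U) (Opens.grothendieckTopology X) :=
  Functor.sheafAdjunctionCocontinuous (Over.forget U) (ModuleCat.{u} k)
    ((Opens.grothendieckTopology X).over U) (Opens.grothendieckTopology X)

instance (U : Opens X) : PreservesFiniteLimits (resOpen k U) := by
  have := (jShriekAdj k U).rightAdjoint_preservesLimits
  infer_instance
instance (U : Opens X) : PreservesFiniteColimits (resOpen k U) := by
  have := (resOpenAdj k U).leftAdjoint_preservesColimits
  infer_instance

instance (U : Opens X) : (Over.forget U).Full where
  map_surjective f := ⟨Over.homMk f (Subsingleton.elim _ _), Subsingleton.elim _ _⟩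

lemma mono_of_iso_square {D : Type*} [Category D] {a b c d : D} (f : a ⟶ b) (β : b ⟶ d) (α : a ⟶ c)
    (g : c ⟶ d) [IsIso α] [IsIso β] [Mono f] (e : f ≫ β = α ≫ g) : Mono g := by
  rw [show g = inv α ≫ f ≫ β by simp [e]]
  infer_instance

lemma lan_mono (U : Opens X) {A B : (Over U)ᵒᵖ ⥤ ModuleCat.{u} k} (f : A ⟶ B) [Mono f] :
    Mono ((Over.forget U).op.lan.map f) := by
  rw [NatTrans.mono_iff_mono_app]
  rintro ⟨V⟩
  by_cases h : V ≤ U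
  · let Y : (Over U)ᵒᵖ := op (Over.mk (homOfLE h))
    have hY : Mono (f.app Y) := inferInstance
    have e := NatTrans.congr_app (((Over.forget U).op.lanUnit (H := ModuleCat.{u} k)).naturality f) Y
    have i1 : IsIso ((((Over.forget U).op.lanUnit (H := ModuleCat.{u} k)).app A).app Y) :=
      inferInstance
    have i2 : IsIso ((((Over.forget U).op.lanUnit (H := ModuleCat.{u} k)).app B).app Y) :=
      inferInstance
    have e' : f.app Y ≫ (((Over.forget U).op.lanUnit (H := ModuleCat.{u} k)).app B).app Y =
      (((Over.forget U).op.lanUnit (H := ModuleCat.{u} k)).app A).app Y ≫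
        ((Over.forget U).op.lan.map f).app (op V) := e
    exact @mono_of_iso_square _ _ _ _ _ _ _ _ _ _ i1 i2 hY e'
  · have hE : IsEmpty (CostructuredArrow (Over.forget U).op (op V)) :=
      ⟨fun Z => h ((leOfHom Z.hom.unop).trans (leOfHom Z.left.unop.hom))⟩
    have hz : IsZero (((Over.forget U).op.lan.obj A).obj (op V)) := by
      refine IsZero.of_iso ?_ ((Over.forget U).op.leftKanExtensionObjIsoColimit A (op V))
      rw [IsZero.iff_id_eq_zero]
      exact colimit.hom_ext fun j => hE.elim j
    exact ⟨fun _ _ _ => hz.eq_of_tgt _ _⟩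

instance (U : Opens X) : (jShriek k U).PreservesMonomorphisms where
  preserves {A B} f hf := by
    have h1 : Mono ((sheafToPresheaf _ _).map f) := inferInstance
    have h2 := lan_mono U ((sheafToPresheaf _ _).map f)
    exact inferInstanceAs (Mono ((presheafToSheaf (Opens.grothendieckTopology X)
      (ModuleCat.{u} k)).map ((Over.forget U).op.lan.map ((sheafToPresheaf _ _).map f))))

instance (U : Opens X) (I : Shv k X) [Injective I] : Injective ((resOpen k U).obj I) :=
  Injective.injective_of_adjoint (jShriekAdj k U) I

lemma quasiIso_of_sections {K L : CochainComplex (Shv k X) ℤ} (φ : K ⟶ L)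
    (h : ∀ U : (Opens X)ᵒᵖ, QuasiIso ((((evaluation _ _).obj U).mapHomologicalComplex
      (ComplexShape.up ℤ)).map (((sheafToPresheaf (Opens.grothendieckTopology X)
      (ModuleCat.{u} k)).mapHomologicalComplex (ComplexShape.up ℤ)).map φ))) : QuasiIso φ := by
  have h1 : QuasiIso (((sheafToPresheaf (Opens.grothendieckTopology X)
      (ModuleCat.{u} k)).mapHomologicalComplex (ComplexShape.up ℤ)).map φ) := by
    rw [HomologicalComplex.quasiIso_iff_evaluation]
    exact h
  have h0 : (presheafToSheaf (Opens.grothendieckTopology X) (ModuleCat.{u} k)).PreservesHomology :=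
    inferInstance
  have h2 : QuasiIso (((presheafToSheaf (Opens.grothendieckTopology X)
      (ModuleCat.{u} k)).mapHomologicalComplex (ComplexShape.up ℤ)).map
      (((sheafToPresheaf (Opens.grothendieckTopology X)
      (ModuleCat.{u} k)).mapHomologicalComplex (ComplexShape.up ℤ)).map φ)) := inferInstance
  let e := asIso (sheafificationAdjunction (Opens.grothendieckTopology X) (ModuleCat.{u} k)).counit
  have : (sheafToPresheaf (Opens.grothendieckTopology X) (ModuleCat.{u} k) ⋙
    presheafToSheaf (Opens.grothendieckTopology X) (ModuleCat.{u} k)).PreservesZeroMorphisms :=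
    inferInstance
  let e' := NatIso.mapHomologicalComplex e (ComplexShape.up ℤ)
  refine @quasiIso_of_arrow_mk_iso _ _ _ _ _ _ _ _ _ _ φ ?_ _ _ _ _ h2
  exact Arrow.isoMk (e'.app K) (e'.app L) (e'.hom.naturality φ).symm

instance (I : CochainComplex (Shv k X) ℤ) [I.IsStrictlyGE 0] [∀ n, Injective (I.X n)]
    (U : Opens X) : ((resCx k U).obj I).IsKInjective := by
  have : ∀ n, Injective (((resCx k U).obj I).X n) := fun n =>
    inferInstanceAs (Injective ((resOpen k U).obj (I.X n)))
  have : ((resCx k U).obj I).IsStrictlyGE 0 := inferInstance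
  exact isKInjective_of_injective _ 0

lemma sheafHomCxFunctor_map_quasiIso (I : CochainComplex (Shv k X) ℤ) [I.IsStrictlyGE 0]
    [∀ n, Injective (I.X n)] {K K' : CochainComplex (Shv k X) ℤ} (f : K ⟶ K') [QuasiIso f] :
    QuasiIso ((sheafHomCxFunctor I).map f.op) := by
  refine quasiIso_of_sections _ fun U => ?_
  exact homCxFunctor_map_quasiIso k ((resCx k U.unop).obj I) ((resCx k U.unop).map f)

end

section

open TopologicalSpace Opposite Topology Limits

/-! ### Derived functors -/

/-- An injective resolution of the object `G`, as a cochain complex indexed by `ℤ`. -/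
def injRes {C : Type*} [Category.{u} C] [Abelian C] [EnoughInjectives C] (G : C) :
    CochainComplex C ℤ :=
  (injectiveResolution G).cochainComplex

instance {C : Type*} [Category.{u} C] [Abelian C] [EnoughInjectives C] (G : C) :
    (injRes G).IsStrictlyGE 0 :=
  inferInstanceAs ((injectiveResolution G).cochainComplex.IsStrictlyGE 0)

instance {C : Type*} [Category.{u} C] [Abelian C] [EnoughInjectives C] (G : C) (n : ℤ) :
    Injective ((injRes G).X n) :=
  inferInstanceAs (Injective ((injectiveResolution G).cochainComplex.X n))

instance {C : Type*} [Category.{u} C] [Abelian C] [EnoughInjectives C] (G : C) :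
    (injRes G).IsKInjective :=
  isKInjective_of_injective _ 0

/-- A functor on complexes, contravariant, which preserves quasi-isomorphisms, becomes a functor
which inverts quasi-isomorphisms. -/
lemma isInvertedBy_of_quasiIso {C D : Type*} [Category C] [Category D] [Abelian C] [Abelian D]
    [HasDerivedCategory.{w₁} D] (Φ : (CochainComplex C ℤ)ᵒᵖ ⥤ CochainComplex D ℤ)
    (h : ∀ (K K' : CochainComplex C ℤ) (f : K ⟶ K') [QuasiIso f], QuasiIso (Φ.map f.op)) :
    (HomologicalComplex.quasiIso C (ComplexShape.up ℤ)).op.IsInvertedBy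
      (Φ ⋙ DerivedCategory.Q) := by
  intro K K' f hf
  have hf' : QuasiIso f.unop := hf
  have := h _ _ f.unop
  exact inferInstanceAs (IsIso (DerivedCategory.Q.map (Φ.map f.unop.op)))

/-- The functor `F ↦ ℝHom(F, G)` to the derived category of `k`-modules: on the class of a
complex `F` it is the complex `Hom(F, I)`, where `I` is an injective resolution of `G`. -/
def RHom {C : Type*} [Category.{u} C] [Abelian C] (k : Type u) [CommRing k] [Linear k C]
    [EnoughInjectives C] [HasDerivedCategory.{w₁} C] [HasDerivedCategory.{w₂} (ModuleCat.{u} k)]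
    (G : C) : (DerivedCategory C)ᵒᵖ ⥤ DerivedCategory (ModuleCat.{u} k) :=
  Localization.lift (homCxFunctor k (injRes G) ⋙ DerivedCategory.Q)
    (isInvertedBy_of_quasiIso _ fun _ _ f _ => homCxFunctor_map_quasiIso k (injRes G) f)
    DerivedCategory.Q.op

/-- The duality `E ↦ E^∨ = ℝHom(E, k)` on the derived category of `k`-modules. -/
abbrev derivedDual (k : Type u) [CommRing k] [HasDerivedCategory.{w₁} (ModuleCat.{u} k)] :
    (DerivedCategory (ModuleCat.{u} k))ᵒᵖ ⥤ DerivedCategory (ModuleCat.{u} k) :=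
  RHom k (ModuleCat.of k k)

/-- The linear duality `M ↦ M^* = Hom(M, k)`. -/
@[simps]
def linearDual (k : Type u) [CommRing k] : (ModuleCat.{u} k)ᵒᵖ ⥤ ModuleCat.{u} k where
  obj M := ModuleCat.of k (Module.Dual k M.unop)
  map f := ModuleCat.ofHom (Module.Dual.transpose (R := k) f.unop.hom)

variable (k : Type u) [CommRing k] {X : TopCat.{u}}

/-- The functor `F ↦ ℝ𝓗om(F, G)`: on the class of a complex `F` it is the complex of sheaves
`𝓗om(F, I)`, where `I` is an injective resolution of `G`. -/
def RSheafHom [HasDerivedCategory.{w₁} (Shv k X)] (G : Shv k X) :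
    (DerivedCategory (Shv k X))ᵒᵖ ⥤ DerivedCategory (Shv k X) :=
  Localization.lift
    (sheafHomCxFunctor (k := k) (X := X) (injRes G) ⋙ (DerivedCategory.Q : _ ⥤ DerivedCategory (Shv k X)))
    (isInvertedBy_of_quasiIso _ fun _ _ f _ =>
      sheafHomCxFunctor_map_quasiIso (k := k) (X := X) (injRes G) f)
    (DerivedCategory.Q : _ ⥤ DerivedCategory (Shv k X)).op

/-- The (exact) stalk functor. -/
abbrev stalkAt (p : X) : Shv k X ⥤ ModuleCat.{u} k :=
  TopCat.Sheaf.forget _ X ⋙ TopCat.Presheaf.stalkFunctor _ p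

/-- The stalk of a complex of sheaves, on derived categories. -/
abbrev derivedStalk [HasDerivedCategory.{w₁} (Shv k X)] [HasDerivedCategory.{w₂} (ModuleCat.{u} k)]
    (p : X) : DerivedCategory (Shv k X) ⥤ DerivedCategory (ModuleCat.{u} k) :=
  (stalkAt k p).mapDerivedCategory

/-! ### Sections with support and local cohomology -/

variable {k} in
/-- The module `Γ_Z(U, F)` of sections of `F` on `U` all of whose germs outside `Z` vanish. -/
def supportedSections (U : Opens X) (Z : Set X) (F : Shv k X) :
    Submodule k (F.presheaf.obj (op U)) where
  carrier := {s | ∀ (x : X) (hx : x ∈ U), x ∉ Z → (F.presheaf.germ U x hx).hom s = 0}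
  zero_mem' x hx _ := map_zero _
  add_mem' hs ht x hx hZ := by rw [map_add, hs x hx hZ, ht x hx hZ, add_zero]
  smul_mem' c s hs x hx hZ := by rw [map_smul, hs x hx hZ, smul_zero]

variable {k} in
lemma map_mem_supportedSections (U : Opens X) (Z : Set X) {F G : Shv k X} (f : F ⟶ G)
    (s : F.presheaf.obj (op U)) (hs : s ∈ supportedSections U Z F) :
    (f.hom.app (op U)).hom s ∈ supportedSections U Z G := by
  intro x hx hZ
  have h := ConcreteCategory.congr_hom (TopCat.Presheaf.stalkFunctor_map_germ U x hx f.hom) s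
  refine h.symm.trans ?_
  refine (congrArg ((TopCat.Presheaf.stalkFunctor (ModuleCat.{u} k) x).map f.hom).hom
    (hs x hx hZ)).trans ?_
  exact map_zero _

/-- The functor `Γ_Z(U, -)`. -/
def supportedSectionsFunctor (U : Opens X) (Z : Set X) : Shv k X ⥤ ModuleCat.{u} k where
  obj F := ModuleCat.of k (supportedSections U Z F)
  map f := ModuleCat.ofHom (LinearMap.restrict (f.hom.app (op U)).hom
    fun s hs => map_mem_supportedSections U Z f s hs)

instance (U : Opens X) (Z : Set X) : (supportedSectionsFunctor k U Z).Additive where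

/-- The functor on complexes of sheaves induced by `Γ_Z(U, -)`, with values in `D(k)`. -/
abbrev supportedSectionsCx (U : Opens X) (Z : Set X) [HasDerivedCategory.{w₂} (ModuleCat.{u} k)] :
    CochainComplex (Shv k X) ℤ ⥤ DerivedCategory (ModuleCat.{u} k) :=
  (supportedSectionsFunctor k U Z).mapHomologicalComplex (ComplexShape.up ℤ) ⋙ DerivedCategory.Q

/-- The functor `Γ_Z(U, -)` can be right derived on the unbounded derived category. -/
abbrev HasRΓ (U : Opens X) (Z : Set X) [HasDerivedCategory.{w₂} (ModuleCat.{u} k)] : Prop :=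
  (supportedSectionsCx k U Z).HasRightDerivedFunctor
    (HomologicalComplex.quasiIso (Shv k X) (ComplexShape.up ℤ))

/-- The right derived functor `ℝΓ_Z(U, -)`. -/
abbrev RΓ (U : Opens X) (Z : Set X) [HasDerivedCategory.{w₁} (Shv k X)]
    [HasDerivedCategory.{w₂} (ModuleCat.{u} k)] [HasRΓ.{u, w₂} k U Z] :
    DerivedCategory (Shv k X) ⥤ DerivedCategory (ModuleCat.{u} k) :=
  (supportedSectionsCx k U Z).totalRightDerived DerivedCategory.Q
    (HomologicalComplex.quasiIso (Shv k X) (ComplexShape.up ℤ))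

/-! ### The constant sheaf supported on an open subset -/

/-- The module of locally constant functions `V → k` that vanish outside `W`. -/
def extByZeroSections (W V : Opens X) : Submodule k (V → k) where
  carrier := {f | IsLocallyConstant f ∧ ∀ x : V, x.1 ∉ W → f x = 0}
  zero_mem' := ⟨IsLocallyConstant.const 0, fun _ _ => rfl⟩
  add_mem' hf hg := ⟨hf.1.add hg.1, fun x hx => by simp [hf.2 x hx, hg.2 x hx]⟩
  smul_mem' c f hf := ⟨hf.1.comp (c * ·), fun x hx => by simp [hf.2 x hx]⟩

/-- The presheaf whose sections on `V` are the locally constant functions `V → k` that vanish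
outside `W`. -/
def extByZeroPresheaf (W : Opens X) : TopCat.Presheaf (ModuleCat.{u} k) X where
  obj V := ModuleCat.of k (extByZeroSections k W V.unop)
  map {V V'} i := ModuleCat.ofHom (LinearMap.restrict
    (LinearMap.funLeft k k (Set.inclusion (leOfHom i.unop)))
    fun f hf => ⟨hf.1.comp_continuous (continuous_inclusion (leOfHom i.unop)),
      fun x hx => hf.2 _ hx⟩)

/-- The same condition, as a local predicate. -/
def extByZeroLocal (W : Opens X) : TopCat.LocalPredicate (fun _ : X => k) where
  pred {V} f := IsLocallyConstant f ∧ ∀ x : V, x.1 ∉ W → f x = 0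
  res i f hf := ⟨hf.1.comp_continuous (continuous_inclusion (leOfHom i)), fun x hx => hf.2 _ hx⟩
  locality {V} f hf := by
    refine ⟨(IsLocallyConstant.iff_exists_open f).2 fun x => ?_, fun x hx => ?_⟩
    · obtain ⟨V', hxV', i, hV'⟩ := hf x
      obtain ⟨T, hT, hxT, h⟩ := (IsLocallyConstant.iff_exists_open _).1 hV'.1 ⟨x.1, hxV'⟩
      refine ⟨Subtype.val ⁻¹' (Subtype.val '' T), ?_, ⟨_, hxT, rfl⟩, ?_⟩
      · exact (V'.isOpen.isOpenMap_subtype_val T hT).preimage continuous_subtype_val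
      · rintro y ⟨z, hz, hzy⟩
        have h1 := h z hz
        have h2 : i z = y := Subtype.ext hzy
        rw [← h2]
        exact h1
    · obtain ⟨V', hxV', i, hV'⟩ := hf x
      exact hV'.2 ⟨x.1, hxV'⟩ hx

lemma extByZeroPresheaf_isSheaf (W : Opens X) : (extByZeroPresheaf k W).IsSheaf := by
  refine (TopCat.Presheaf.isSheaf_iff_isSheaf_comp' (forget (ModuleCat.{u} k)) _).2 ?_
  exact TopCat.subpresheafToTypes.isSheaf (extByZeroLocal k W)

/-- The sheaf `k_W`, for `W` open: the constant sheaf `k` on `W`, extended by zero. -/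
def extByZero (W : Opens X) : Shv k X := ⟨extByZeroPresheaf k W, extByZeroPresheaf_isSheaf k W⟩

/-! ### The affine space over the field with one element -/

/-- The finite space `𝔸ⁿ` over `F₁`: the set of subsets of a set with `n` elements, whose open
subsets are the subsets that are upward closed with respect to inclusion. -/
abbrev AffF1 (n : ℕ) : TopCat.{u} := TopCat.of (WithUpperSet (Finset (ULift.{u} (Fin n))))

variable (n : ℕ)

/-- The closed point `𝟎`, the empty set. -/
def zeroPt : AffF1.{u} n := WithUpperSet.toUpperSet (∅ : Finset (ULift.{u} (Fin n)))

/-- The generic point `𝟏`, the whole set. -/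
def onePt : AffF1.{u} n := WithUpperSet.toUpperSet (Finset.univ : Finset (ULift.{u} (Fin n)))

variable {n} in
/-- The smallest open neighbourhood `U_p = {q | p ⊆ q}` of the point `p`. -/
def minOpen (p : AffF1.{u} n) : Opens (AffF1.{u} n) where
  carrier := {q : WithUpperSet (Finset (ULift.{u} (Fin n))) |
    WithUpperSet.ofUpperSet (α := Finset (ULift.{u} (Fin n))) p ⊆ WithUpperSet.ofUpperSet q}
  is_open' := Topology.IsUpperSet.isOpen_iff_isUpperSet.2
    fun a b (hab : WithUpperSet.ofUpperSet (α := Finset (ULift.{u} (Fin n))) a ≤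
      WithUpperSet.ofUpperSet b) ha => Finset.Subset.trans ha hab

variable {n} in
/-- The dimension `d_p` of the space `U_p` (a natural number, since `U_p` is finite and not
empty). -/
def dimMinOpen (p : AffF1.{u} n) : ℕ := ((topologicalKrullDim (minOpen p)).unbotD 0).toNat

/-- The sheaf `ω = k_{𝟏}`: the constant sheaf `k` supported on the generic point. Note that
`{𝟏}` is the open subset `U_𝟏`. -/
def canonicalSheaf : Shv k (AffF1.{u} n) := extByZero k (minOpen (onePt n))

lemma mem_minOpen_onePt (p : AffF1.{u} n) : p ∈ minOpen (onePt n) ↔ p = onePt n :=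
  Finset.univ_subset_iff

end

end

end PosetDuality

open CategoryTheory PosetDuality

/-!
The open subset `U_p` has only trivial coverings, and the subsets `U_p` form a basis. Hence a sheaf
on the affine space is the same as a diagram of `k`-modules on the poset of subsets of `{1, …, n}`,
and a sheaf on `U_p` is a diagram on the poset of subsets `s` of the complement `κ` of `p`
(`isDenseSubsite_bot`, `sectionsDiagram_isEquivalence`). The stalk at a point is the value of the
diagram there. The duality isomorphism is a statement about complexes of such diagrams.

*Local cohomology.* For `i ∈ κ`, let `T_i` be the functor with `(T_i F)(s) = F(s ∪ {i})`. A section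
on `U_p` is supported at `p` if and only if it vanishes in `F({i}) = (T_i F)(∅)` for all `i`, so that
`Γ_p(U_p, F)` is the value at `∅` of the iterated kernel of the maps `F ⟶ T_i F`
(`nonempty_supportedSections_iso`). Replacing each kernel by the cocone of `F ⟶ T_i F`, one obtains an
exact construction `E` on complexes (`iterCocone`). It agrees with the iterated kernel on complexes
whose terms are finite sums of direct images `i_{r*} M` of modules, because for these each map
`F ⟶ T_i F` is an isomorphism or has zero target. Every unbounded complex is quasi-isomorphic to one
of this form: the poset is finite, and one can split off a maximal point of the support at a time
(`exists_resolution_of_support`). Therefore `ℝΓ_p(U_p, -)` exists and is `F ↦ E(F)(∅)`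
(`hasRightDerivedFunctor_of_resolutions`, `hasRΓ_minOpen`).

*Duality.* The functor `T_i` is left adjoint to the functor `S_i` with `(S_i G)(s) = G(s \ {i})`, and
an adjunction turns cocones into cones: `Hom(cocone(F ⟶ T_i F), G) ≅ Hom(F, cone(S_i G ⟶ G))`
(`homCxCoconeCone`). Since evaluation at `∅` is left adjoint to the direct image from `∅`, it follows
that `Hom(E(F)(∅), J) ≅ Hom(F, 𝒥)` for an injective resolution `J` of `k`, where `𝒥` is an iterated
cone on the direct image of `J` (`homCxLocalCx`). The complex `𝒥` is bounded below with injective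
terms. At the largest subset `κ` its value is `J` shifted by the cardinality of `κ`, and elsewhere it
is acyclic, so that `𝒥` represents the shift of the diagram `k` supported at `κ`, which is the
restriction of `ω` (`nonempty_dualizing_iso`, `nonempty_homCx_iso_localCx`).

The stalk at `p` of `𝓗om(F, I)` is `Hom(F|U_p, I|U_p)`, for an injective resolution `I` of `ω`
(`sheafHomCxStalkIso`), which gives the local isomorphism. The global one is the case `U_𝟎 = 𝔸ⁿ`. The
cardinality of `κ` is the dimension of `U_p` (`dimMinOpen_eq`). Over a field, the dual is exact, hence
commutes with cohomology (`nonempty_shift_derivedDual_homology_iso`).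
-/

namespace PosetDuality

open Limits CochainComplex CochainComplex.HomComplex

noncomputable section

/-! ### Functoriality of the complexes `Hom(K, L)` -/

section

variable {C D : Type*} [Category.{u} C] [Abelian C] [Category.{u} D] [Abelian D]
  (k : Type u) [CommRing k] [Linear k C] [Linear k D]

/-- The adjunction bijection, as a linear equivalence. -/
def adjLinearEquiv {L : C ⥤ D} {R : D ⥤ C} [R.Additive] [R.Linear k] (adj : L ⊣ R) (X : C) (Y : D) :
    (L.obj X ⟶ Y) ≃ₗ[k] (X ⟶ R.obj Y) where
  __ := adj.homEquiv X Y
  map_add' f g := by simp [Adjunction.homEquiv_unit]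
  map_smul' c f := by simp [Adjunction.homEquiv_unit]

lemma adjLinearEquiv_comp {L : C ⥤ D} {R : D ⥤ C} [R.Additive] [R.Linear k] (adj : L ⊣ R)
    {X : C} {Y Y' : D} (f : L.obj X ⟶ Y) (g : Y ⟶ Y') :
    adjLinearEquiv k adj X Y' (f ≫ g) = adjLinearEquiv k adj X Y f ≫ R.map g :=
  adj.homEquiv_naturality_right f g

lemma adjLinearEquiv_map_comp {L : C ⥤ D} {R : D ⥤ C} [R.Additive] [R.Linear k] (adj : L ⊣ R)
    {X X' : C} {Y : D} (f : X' ⟶ X) (g : L.obj X ⟶ Y) :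
    adjLinearEquiv k adj X' Y (L.map f ≫ g) = f ≫ adjLinearEquiv k adj X Y g :=
  adj.homEquiv_naturality_left f g

lemma adjLinearEquiv_add {L : C ⥤ D} {R : D ⥤ C} [R.Additive] [R.Linear k] (adj : L ⊣ R)
    {X X' : C} {Y Y' : D} (a : L.obj X ⟶ Y) (g : Y ⟶ Y') (f : X ⟶ X') (b : L.obj X' ⟶ Y')
    (ε : ℤˣ) :
    adjLinearEquiv k adj X Y' (a ≫ g + ε • L.map f ≫ b) =
      adjLinearEquiv k adj X Y a ≫ R.map g + ε • f ≫ adjLinearEquiv k adj X' Y' b := by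
  rw [map_add, adjLinearEquiv_comp, Units.smul_def, Units.smul_def, map_zsmul,
    adjLinearEquiv_map_comp]

variable {L : C ⥤ D} {R : D ⥤ C} [L.Additive] [R.Additive] [R.Linear k] (adj : L ⊣ R)

/-- For adjoint functors `L ⊣ R`, a cochain `L(K) → G` corresponds to a cochain `K → R(G)`. -/
def cochainAdj (K : CochainComplex C ℤ) (G : CochainComplex D ℤ) (n : ℤ) :
    Cochain ((L.mapHomologicalComplex _).obj K) G n ≃ₗ[k]
      Cochain K ((R.mapHomologicalComplex _).obj G) n where
  toFun z T := adjLinearEquiv k adj (K.X T.p) (G.X T.q) (z T)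
  map_add' _ _ := funext fun T => (adjLinearEquiv k adj (K.X T.p) (G.X T.q)).map_add _ _
  map_smul' _ _ := funext fun T => (adjLinearEquiv k adj (K.X T.p) (G.X T.q)).map_smul _ _
  invFun z T := (adjLinearEquiv k adj (K.X T.p) (G.X T.q)).symm (z T)
  left_inv _ := funext fun T => (adjLinearEquiv k adj (K.X T.p) (G.X T.q)).left_inv _
  right_inv _ := funext fun T => (adjLinearEquiv k adj (K.X T.p) (G.X T.q)).right_inv _

lemma cochainAdj_v (K : CochainComplex C ℤ) (G : CochainComplex D ℤ) (n : ℤ)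
    (z : Cochain ((L.mapHomologicalComplex _).obj K) G n) (p q : ℤ) (h : p + n = q) :
    (cochainAdj k adj K G n z).v p q h = adjLinearEquiv k adj (K.X p) (G.X q) (z.v p q h) :=
  rfl

lemma δ_cochainAdj (K : CochainComplex C ℤ) (G : CochainComplex D ℤ) (n m : ℤ)
    (z : Cochain ((L.mapHomologicalComplex _).obj K) G n) :
    δ n m (cochainAdj k adj K G n z) = cochainAdj k adj K G m (δ n m z) := by
  by_cases h : n + 1 = m
  · ext p q hpq
    rw [cochainAdj_v, δ_v n m h _ p q hpq (q - 1) (p + 1) (by lia) (by lia),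
      δ_v n m h z p q hpq (q - 1) (p + 1) (by lia) (by lia), cochainAdj_v, cochainAdj_v]
    exact (adjLinearEquiv_add k adj (z.v p (q - 1) (by lia)) (G.d (q - 1) q) (K.d p (p + 1))
      (z.v (p + 1) q (by lia)) m.negOnePow).symm
  · rw [δ_shape _ _ h, δ_shape _ _ h, map_zero]

lemma cochainAdj_precomp {K K' : CochainComplex C ℤ} (f : K ⟶ K') (G : CochainComplex D ℤ) (n : ℤ)
    (z : Cochain ((L.mapHomologicalComplex _).obj K') G n) :
    cochainAdj k adj K G n
        ((Cochain.ofHom ((L.mapHomologicalComplex _).map f)).comp z (zero_add n)) =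
      (Cochain.ofHom f).comp (cochainAdj k adj K' G n z) (zero_add n) := by
  ext p q h
  rw [cochainAdj_v, Cochain.zero_cochain_comp_v, Cochain.zero_cochain_comp_v, cochainAdj_v,
    Cochain.ofHom_v, Cochain.ofHom_v]
  exact adjLinearEquiv_map_comp k adj (f.f p) (z.v p q h)

/-- The isomorphism of complexes `Hom(L(K), G) ≅ Hom(K, R(G))` for adjoint functors `L ⊣ R`. -/
def homCxAdj (G : CochainComplex D ℤ) :
    (L.mapHomologicalComplex (ComplexShape.up ℤ)).op ⋙ homCxFunctor k G ≅
      homCxFunctor k ((R.mapHomologicalComplex _).obj G) :=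
  NatIso.ofComponents
    (fun K => HomologicalComplex.Hom.isoOfComponents
      (fun n => (cochainAdj k adj K.unop G n).toModuleIso)
      (fun n m _ => ModuleCat.hom_ext (LinearMap.ext fun z =>
        δ_cochainAdj k adj K.unop G n m z)))
    (fun {K K'} f => by
      ext n : 1
      exact ModuleCat.hom_ext (LinearMap.ext fun z => cochainAdj_precomp k adj f.unop G n z))

end

section

variable {C : Type*} [Category.{u} C] [Abelian C] (k : Type u) [CommRing k] [Linear k C]

/-- The isomorphism of complexes `Hom(K, L)⟦a⟧ ≅ Hom(K, L⟦a⟧)`. -/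
def homCxShift (L : CochainComplex C ℤ) (a : ℤ) :
    homCxFunctor k L ⋙ CategoryTheory.shiftFunctor _ a ≅ homCxFunctor k (L⟦a⟧) :=
  NatIso.ofComponents
    (fun K => HomologicalComplex.Hom.isoOfComponents
      (fun n => (Cochain.rightShiftLinearEquiv k K.unop L (n + a) a n rfl).toModuleIso)
      (fun n m h => ModuleCat.hom_ext (LinearMap.ext fun z => by
        refine (Cochain.δ_rightShift z a n m rfl (m + a) rfl).trans ?_
        exact (Cochain.rightShift_units_smul ..).symm)))
    (fun {K K'} f => by
      ext n : 1
      refine ModuleCat.hom_ext (LinearMap.ext fun (z : Cochain K.unop L (n + a)) => ?_)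
      change ((Cochain.ofHom f.unop).comp z (zero_add _)).rightShift a n rfl =
        (Cochain.ofHom f.unop).comp (z.rightShift a n rfl) (zero_add n)
      ext p q h
      rw [Cochain.zero_cochain_comp_v, Cochain.rightShift_v _ a n rfl p q h _ rfl,
        Cochain.rightShift_v _ a n rfl p q h _ rfl, Cochain.zero_cochain_comp_v, Category.assoc])

/-- Postcomposition with a morphism of complexes. -/
def homCxPostcomp {L L' : CochainComplex C ℤ} (g : L ⟶ L') :
    homCxFunctor k L ⟶ homCxFunctor k L' where
  app K :=
    { f n := ModuleCat.ofHom
        { toFun z := Cochain.comp z (Cochain.ofHom g) (add_zero n)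
          map_add' _ _ := Cochain.add_comp ..
          map_smul' _ _ := Cochain.smul_comp .. }
      comm' n m _ := ModuleCat.hom_ext (LinearMap.ext fun z => δ_comp_ofHom z g m) }
  naturality K K' f := by
    ext n : 1
    refine ModuleCat.hom_ext (LinearMap.ext fun z => ?_)
    exact Cochain.comp_assoc_of_first_is_zero_cochain _ _ _ (add_zero n)

lemma homCxPostcomp_comp {L L' L'' : CochainComplex C ℤ} (g : L ⟶ L') (g' : L' ⟶ L'') :
    homCxPostcomp k (g ≫ g') = homCxPostcomp k g ≫ homCxPostcomp k g' := by
  ext K n : 3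
  refine ModuleCat.hom_ext (LinearMap.ext fun (z : Cochain K.unop L n) => ?_)
  change z.comp (Cochain.ofHom (g ≫ g')) (add_zero n) =
    (z.comp (Cochain.ofHom g) (add_zero n)).comp (Cochain.ofHom g') (add_zero n)
  rw [Cochain.ofHom_comp, Cochain.comp_assoc_of_third_is_zero_cochain]

lemma homCxPostcomp_id (L : CochainComplex C ℤ) :
    homCxPostcomp k (𝟙 L) = 𝟙 (homCxFunctor k L) := by
  ext K n : 3
  exact ModuleCat.hom_ext (LinearMap.ext fun (z : Cochain K.unop L n) => Cochain.comp_id z)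

/-- Composition with a cochain of degree `-1`. -/
def homCxCompNegOne {L L' : CochainComplex C ℤ} (h : Cochain L L' (-1)) (K : (CochainComplex C ℤ)ᵒᵖ)
    (n m : ℤ) (hm : m + 1 = n) :
    ((homCxFunctor k L).obj K).X n ⟶ ((homCxFunctor k L').obj K).X m :=
  ModuleCat.ofHom
    { toFun z := Cochain.comp z h (show n + -1 = m by lia)
      map_add' _ _ := Cochain.add_comp ..
      map_smul' _ _ := Cochain.smul_comp .. }

/-- A homotopy between `g` and `g'` induces a homotopy between the postcompositions. -/
def homCxPostcompHomotopy {L L' : CochainComplex C ℤ} {g g' : L ⟶ L'} (h : Homotopy g g')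
    (K : (CochainComplex C ℤ)ᵒᵖ) :
    Homotopy ((homCxPostcomp k g).app K) ((homCxPostcomp k g').app K) where
  hom n m := if hm : m + 1 = n then homCxCompNegOne k (Cochain.ofHomotopy h) K n m hm else 0
  zero n m hm := dif_neg hm
  comm n := by
    rw [dNext_eq _ (show (ComplexShape.up ℤ).Rel n (n + 1) from rfl),
      prevD_eq _ (show (ComplexShape.up ℤ).Rel (n - 1) n from sub_add_cancel n 1),
      dif_pos rfl, dif_pos (sub_add_cancel n 1)]
    refine ModuleCat.hom_ext (LinearMap.ext fun (z : Cochain K.unop L n) => ?_)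
    change z.comp (Cochain.ofHom g) (add_zero n) =
      (δ n (n + 1) z).comp (Cochain.ofHomotopy h) (by lia) +
        δ (n - 1) n (z.comp (Cochain.ofHomotopy h) (by lia)) +
          z.comp (Cochain.ofHom g') (add_zero n)
    -- Leibniz rule: the two terms with `δ z` cancel.
    rw [δ_comp z (Cochain.ofHomotopy h) (show n + -1 = n - 1 by lia) (n + 1) 0 n (by lia) rfl
      (by lia), δ_ofHomotopy, Cochain.comp_sub]
    simp

/-- Postcomposition with a quasi-isomorphism between K-injective complexes is a
quasi-isomorphism. -/
lemma homCxPostcomp_quasiIso {L L' : CochainComplex C ℤ} [L.IsKInjective] [L'.IsKInjective]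
    (g : L ⟶ L') [QuasiIso g] (K : (CochainComplex C ℤ)ᵒᵖ) :
    QuasiIso ((homCxPostcomp k g).app K) := by
  obtain ⟨e, rfl⟩ := (IsKInjective.quasiIso_iff g).1 inferInstance
  have h₁ := homCxPostcompHomotopy k e.homotopyHomInvId K
  have h₂ := homCxPostcompHomotopy k e.homotopyInvHomId K
  rw [homCxPostcomp_comp, homCxPostcomp_id] at h₁ h₂
  exact homotopyEquivalences_le_quasiIso _ _ _ ⟨HomotopyEquiv.mk _ _ h₁ h₂, rfl⟩

end

/-! ### Cocones of natural transformations -/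

section

variable {C : Type*} [Category.{u} C] [Abelian C] (T : C ⥤ C) [T.Additive] (η : 𝟭 C ⟶ T)

/-- The morphism of complexes `F ⟶ T(F)` given by a natural transformation `η : 𝟭 ⟶ T`. -/
@[simps]
def unitCx (F : CochainComplex C ℤ) : F ⟶ (T.mapHomologicalComplex _).obj F where
  f i := η.app (F.X i)
  comm' i j _ := (η.naturality (F.d i j)).symm

lemma unitCx_naturality {F G : CochainComplex C ℤ} (f : F ⟶ G) :
    f ≫ unitCx T η G = unitCx T η F ≫ (T.mapHomologicalComplex _).map f := by
  ext i
  exact η.naturality (f.f i)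

/-- The morphism between mapping cocones induced by a commutative square. -/
def mappingCoconeMap {F F' G G' : CochainComplex C ℤ} (φ : F ⟶ G) (φ' : F' ⟶ G')
    (a : F ⟶ F') (b : G ⟶ G') (comm : φ ≫ b = a ≫ φ') : mappingCocone φ ⟶ mappingCocone φ' :=
  (mappingCone.map φ φ' a b comm)⟦(-1 : ℤ)⟧'

/-- Morphisms to a mapping cocone are determined by their two components. -/
lemma mappingCocone_ext_to {F G : CochainComplex C ℤ} (φ : F ⟶ G) {i j : ℤ} (hij : i + -1 = j)
    {A : C} {f g : A ⟶ (mappingCocone φ).X i}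
    (h₁ : f ≫ (mappingCocone.fst φ).f i = g ≫ (mappingCocone.fst φ).f i)
    (h₂ : f ≫ (mappingCocone.snd φ).v i j hij = g ≫ (mappingCocone.snd φ).v i j hij) : f = g := by
  rw [← Category.comp_id f, ← Category.comp_id g, ← mappingCocone.id_X φ i j hij]
  simp only [Preadditive.comp_add, reassoc_of% h₁, reassoc_of% h₂]

/-- Morphisms from a mapping cocone are determined by their two components. -/
lemma mappingCocone_ext_from {F G : CochainComplex C ℤ} (φ : F ⟶ G) {i j : ℤ} (hij : i + -1 = j)
    {A : C} {f g : (mappingCocone φ).X i ⟶ A}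
    (h₁ : (mappingCocone.inl φ).v i i (add_zero i) ≫ f =
      (mappingCocone.inl φ).v i i (add_zero i) ≫ g)
    (h₂ : (mappingCocone.inr φ).1.v j i (by lia) ≫ f =
      (mappingCocone.inr φ).1.v j i (by lia) ≫ g) : f = g := by
  rw [← Category.id_comp f, ← Category.id_comp g, ← mappingCocone.id_X φ i j hij]
  simp only [Preadditive.add_comp, Category.assoc, h₁, h₂]

section
variable {F F' G G' : CochainComplex C ℤ} (φ : F ⟶ G) (φ' : F' ⟶ G')
    (a : F ⟶ F') (b : G ⟶ G') (comm : φ ≫ b = a ≫ φ')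

lemma mappingConeMap_fst (i j : ℤ) (hij : i + 1 = j) :
    (mappingCone.map φ φ' a b comm).f i ≫ (mappingCone.fst φ').1.v i j hij =
      (mappingCone.fst φ).1.v i j hij ≫ a.f j := by
  apply mappingCone.ext_from φ j i hij <;> simp [mappingCone.map]

lemma mappingConeMap_snd (i : ℤ) :
    (mappingCone.map φ φ' a b comm).f i ≫ (mappingCone.snd φ').v i i (add_zero i) =
      (mappingCone.snd φ).v i i (add_zero i) ≫ b.f i := by
  apply mappingCone.ext_from φ (i + 1) i rfl <;> simp [mappingCone.map]

/-- The cocone is the cone shifted by `-1`: the signs in the definitions of the shift and of the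
projection of the cocone cancel. -/
lemma mappingCocone_fst_f (i : ℤ) :
    (mappingCocone.fst φ).f i = (mappingCone.fst φ).1.v (i + -1) i (by lia) := by
  simp only [mappingCocone.fst, HomologicalComplex.neg_f_apply, Cocycle.homOf_f,
    Cocycle.leftShift_coe,
    Cochain.leftShift_v (n := 1) _ _ _ _ i i _ (i + -1) (by lia),
    HomologicalComplex.XIsoOfEq_rfl, shiftFunctorObjXIso]
  rw [show ((-1 : ℤ) * 0 + -1 * (-1 - 1) / 2).negOnePow = -1 from rfl, Units.neg_smul, one_smul,
    neg_neg]
  exact Category.id_comp _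

lemma mappingCocone_snd_v (i : ℤ) :
    (mappingCocone.snd φ).v i (i + -1) rfl = (mappingCone.snd φ).v (i + -1) (i + -1) (by lia) := by
  refine (Cochain.leftShift_v (mappingCone.snd φ) (-1) (-1) (zero_add _) i (i + -1) rfl (i + -1)
    (add_zero (i + -1))).trans ?_
  simp only [HomologicalComplex.XIsoOfEq_rfl, shiftFunctorObjXIso]
  rw [show ((-1 : ℤ) * -1 + -1 * (-1 - 1) / 2).negOnePow = 1 from rfl, one_smul]
  exact Category.id_comp _

lemma mappingCoconeMap_f_fst (i : ℤ) :
    (mappingCoconeMap φ φ' a b comm).f i ≫ (mappingCocone.fst φ').f i =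
      (mappingCocone.fst φ).f i ≫ a.f i := by
  rw [mappingCocone_fst_f, mappingCocone_fst_f]
  exact mappingConeMap_fst φ φ' a b comm (i + -1) i (by lia)

lemma mappingCoconeMap_f_snd (i j : ℤ) (hij : i + -1 = j) :
    (mappingCoconeMap φ φ' a b comm).f i ≫ (mappingCocone.snd φ').v i j hij =
      (mappingCocone.snd φ).v i j hij ≫ b.f j := by
  subst hij
  rw [mappingCocone_snd_v, mappingCocone_snd_v]
  exact mappingConeMap_snd φ φ' a b comm (i + -1)

lemma inl_mappingCoconeMap (i : ℤ) :
    (mappingCocone.inl φ).v i i (add_zero i) ≫ (mappingCoconeMap φ φ' a b comm).f i =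
      a.f i ≫ (mappingCocone.inl φ').v i i (add_zero i) := by
  apply mappingCocone_ext_to φ' (show i + -1 = i - 1 by lia)
  · simp [mappingCoconeMap_f_fst]
  · simp [mappingCoconeMap_f_snd]

lemma inr_mappingCoconeMap (i j : ℤ) (hij : i + 1 = j) :
    (mappingCocone.inr φ).1.v i j hij ≫ (mappingCoconeMap φ φ' a b comm).f j =
      b.f i ≫ (mappingCocone.inr φ').1.v i j hij := by
  subst hij
  apply mappingCocone_ext_to φ' (show (i + 1) + -1 = i by lia)
  · simp [mappingCoconeMap_f_fst]
  · simp [mappingCoconeMap_f_snd]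

lemma mappingConeMap_quasiIso [QuasiIso a] [QuasiIso b] :
    QuasiIso (mappingCone.map φ φ' a b comm) := by
  let _ := HasDerivedCategory.standard C
  rw [← DerivedCategory.isIso_Q_map_iff_quasiIso]
  have h₁ : IsIso (DerivedCategory.Q.map a) := inferInstance
  have h₂ : IsIso (DerivedCategory.Q.map b) := inferInstance
  exact Pretriangulated.isIso₃_of_isIso₁₂
    (DerivedCategory.Q.mapTriangle.map (mappingCone.triangleMap φ φ' a b comm))
    (DerivedCategory.mappingCone_triangle_distinguished φ)
    (DerivedCategory.mappingCone_triangle_distinguished φ') h₁ h₂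

lemma mappingCoconeMap_quasiIso [QuasiIso a] [QuasiIso b] :
    QuasiIso (mappingCoconeMap φ φ' a b comm) := by
  have := mappingConeMap_quasiIso φ φ' a b comm
  exact inferInstanceAs (QuasiIso ((mappingCone.map φ φ' a b comm)⟦(-1 : ℤ)⟧'))

end

/-- The functor `F ↦ cocone(F ⟶ T(F))` on complexes. -/
def coconeFunctor : CochainComplex C ℤ ⥤ CochainComplex C ℤ where
  obj F := mappingCocone (unitCx T η F)
  map f := mappingCoconeMap _ _ f ((T.mapHomologicalComplex _).map f) (unitCx_naturality T η f).symm
  map_id F := by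
    simp only [mappingCoconeMap]
    rw! [CategoryTheory.Functor.map_id]
    rw [mappingCone.map_id, CategoryTheory.Functor.map_id]
    rfl
  map_comp f g := by
    refine Eq.trans ?_ (CategoryTheory.Functor.map_comp _ _ _)
    refine congrArg _ (Eq.trans ?_ (mappingCone.map_comp ..))
    congr 1
    exact CategoryTheory.Functor.map_comp _ _ _

instance {F G : CochainComplex C ℤ} (f : F ⟶ G)  [QuasiIso f] [PreservesFiniteLimits T]
    [PreservesFiniteColimits T] : QuasiIso ((coconeFunctor T η).map f) :=
  mappingCoconeMap_quasiIso ..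

/-! ### Duality between cocones and cones -/

variable (S : C ⥤ C) [S.Additive] (adj : T ⊣ S)

/-- The natural transformation `S ⟶ 𝟭` which is conjugate to `η : 𝟭 ⟶ T`, for `T ⊣ S`. -/
@[simps]
def coUnit : S ⟶ 𝟭 C where
  app G := η.app (S.obj G) ≫ adj.counit.app G
  naturality G G' f := by
    have := η.naturality (S.map f)
    dsimp at this ⊢
    rw [reassoc_of% this]
    simp

/-- The morphism of complexes `S(G) ⟶ G` given by `coUnit`. -/
@[simps]
def counitCx (G : CochainComplex C ℤ) : (S.mapHomologicalComplex _).obj G ⟶ G where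
  f i := (coUnit T η S adj).app (G.X i)
  comm' i j _ := ((coUnit T η S adj).naturality (G.d i j)).symm

/-- The complex `cone(S(G) ⟶ G)`. -/
abbrev coneObj (G : CochainComplex C ℤ) : CochainComplex C ℤ := mappingCone (counitCx T η S adj G)

variable {T S} in
set_option linter.unusedSectionVars false in
/-- The defining property of the conjugate transformation. -/
lemma adjLinearEquiv_coUnit (k : Type u) [CommRing k] [Linear k C] [S.Linear k] {F G : C}
    (b : T.obj F ⟶ G) :
    adjLinearEquiv k adj F G b ≫ (coUnit T η S adj).app G = η.app F ≫ b := by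
  refine Eq.trans ?_ (congrArg (fun t => η.app F ≫ t)
    ((adj.homEquiv_counit (g := adjLinearEquiv k adj F G b)).symm.trans ((adj.homEquiv F G).left_inv b)))
  have h := η.naturality (adjLinearEquiv k adj F G b)
  dsimp only [Functor.id_map] at h
  simp only [coUnit_app, ← Category.assoc]
  exact congrArg (· ≫ adj.counit.app G) h

end

section

variable {C : Type*} [Category.{u} C] [Abelian C] (k : Type u) [CommRing k] [Linear k C]

lemma inl_comp_fst_add {F G M : CochainComplex C ℤ} (φ : F ⟶ G) {m n : ℤ} (h : m + 1 = n)
    (α : Cochain F M m) (β : Cochain G M n) :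
    (mappingCocone.inl φ).comp ((Cochain.ofHom (mappingCocone.fst φ)).comp α (zero_add m) +
      (mappingCocone.snd φ).comp β (by lia)) (zero_add m) = α := by
  ext p q hpq
  simp [Cochain.comp_v (mappingCocone.snd φ) β (show -1 + n = m by lia) p (p + -1) q rfl (by lia)]

lemma inr_comp_fst_add {F G M : CochainComplex C ℤ} (φ : F ⟶ G) {m n : ℤ} (h : m + 1 = n)
    (α : Cochain F M m) (β : Cochain G M n) :
    (mappingCocone.inr φ).1.comp ((Cochain.ofHom (mappingCocone.fst φ)).comp α (zero_add m) +
      (mappingCocone.snd φ).comp β (by lia)) (show 1 + m = n by lia) = β := by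
  ext p q hpq
  simp [Cochain.comp_v (mappingCocone.inr φ).1 _ (show 1 + m = n by lia) p (p + 1) q rfl (by lia),
    Cochain.comp_v (mappingCocone.snd φ) β (show -1 + n = m by lia) (p + 1) p q (by lia) (by lia)]

/-- Cochains from a mapping cocone are pairs of cochains. -/
def fromCoconeEquiv {F G : CochainComplex C ℤ} (φ : F ⟶ G) (M : CochainComplex C ℤ) (m : ℤ) :
    Cochain (mappingCocone φ) M m ≃ₗ[k] Cochain F M m × Cochain G M (m + 1) where
  toFun z := ((mappingCocone.inl φ).comp z (zero_add m),
    (mappingCocone.inr φ).1.comp z (add_comm 1 m))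
  map_add' _ _ := Prod.ext (Cochain.comp_add (h := zero_add m) ..)
    (Cochain.comp_add (h := add_comm 1 m) ..)
  map_smul' _ _ := Prod.ext (Cochain.comp_smul (h := zero_add m) ..)
    (Cochain.comp_smul (h := add_comm 1 m) ..)
  invFun z := mappingCocone.descCochain φ z.1 z.2 rfl
  left_inv z := by
    ext p q hpq
    apply mappingCocone_ext_from φ (show p + -1 = p - 1 by lia)
    · simp
    · simp [Cochain.comp_v (mappingCocone.inr φ).1 z (add_comm 1 m) (p - 1) p q (by lia) hpq]
  right_inv z := by simp

/-- Cochains to a mapping cone are pairs of cochains. -/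
def toConeEquiv {F G : CochainComplex C ℤ} (φ : F ⟶ G) (M : CochainComplex C ℤ) (m : ℤ) :
    (Cochain M G m × Cochain M F (m + 1)) ≃ₗ[k] Cochain M (mappingCone φ) m where
  toFun z := mappingCone.liftCochain φ z.2 z.1 rfl
  map_add' z z' := by simp only [mappingCone.liftCochain, Prod.fst_add, Prod.snd_add,
    Cochain.add_comp]; abel
  map_smul' c z := by simp [mappingCone.liftCochain]
  invFun z := (z.comp (mappingCone.snd φ) (add_zero m), z.comp (mappingCone.fst φ).1 rfl)
  left_inv z := by simp
  right_inv z := by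
    ext p q hpq
    apply mappingCone.ext_to φ q (q + 1) rfl
    · simp [Cochain.comp_v z (mappingCone.fst φ).1 rfl p q (q + 1) hpq rfl]
    · simp

variable {T : C ⥤ C} [T.Additive] (η : 𝟭 C ⟶ T) {S : C ⥤ C} [S.Additive] [S.Linear k] (adj : T ⊣ S)

/-- Multiplication by the sign `(-1)ᵐ`. -/
def signEquiv (m : ℤ) (M : Type*) [AddCommGroup M] [Module k M] : M ≃ₗ[k] M :=
  LinearEquiv.smulOfUnit (Units.map (Int.castRingHom k).toMonoidHom m.negOnePow)

lemma signEquiv_apply (m : ℤ) {M : Type*} [AddCommGroup M] [Module k M] (x : M) :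
    signEquiv k m M x = m.negOnePow • x := by
  rcases Int.even_or_odd m with h | h
  · simp [signEquiv, Int.negOnePow_even _ h, LinearEquiv.smulOfUnit]
  · simp [signEquiv, Int.negOnePow_odd _ h, LinearEquiv.smulOfUnit, Units.smul_def]

/-- Cochains from `cocone(F ⟶ T(F))` to `G` correspond to cochains from `F` to
`cone(S(G) ⟶ G)`: both are pairs of a cochain `F → G` and of a cochain `T(F) → G`, respectively
`F → S(G)`, of one degree more. The sign `(-1)ᵐ` makes the bijection compatible with the
differentials. -/
def coconeConeEquiv (F G : CochainComplex C ℤ) (m : ℤ) :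
    Cochain (mappingCocone (unitCx T η F)) G m ≃ₗ[k] Cochain F (coneObj T η S adj G) m :=
  fromCoconeEquiv k (unitCx T η F) G m ≪≫ₗ
    (LinearEquiv.prodCongr (LinearEquiv.refl k _)
      (cochainAdj k adj F G (m + 1) ≪≫ₗ signEquiv k m _)) ≪≫ₗ
    toConeEquiv k (counitCx T η S adj G) F m

lemma coconeConeEquiv_apply (F G : CochainComplex C ℤ) (m : ℤ)
    (z : Cochain (mappingCocone (unitCx T η F)) G m) :
    coconeConeEquiv k η adj F G m z =
      mappingCone.liftCochain (counitCx T η S adj G)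
        (m.negOnePow • cochainAdj k adj F G (m + 1)
          ((mappingCocone.inr (unitCx T η F)).1.comp z (add_comm 1 m)))
        ((mappingCocone.inl (unitCx T η F)).comp z (zero_add m)) rfl := by
  rw [← signEquiv_apply k]
  rfl

lemma cochainAdj_comp_counitCx (F G : CochainComplex C ℤ) (m : ℤ)
    (z : Cochain ((T.mapHomologicalComplex _).obj F) G m) :
    (cochainAdj k adj F G m z).comp (Cochain.ofHom (counitCx T η S adj G)) (add_zero m) =
      (Cochain.ofHom (unitCx T η F)).comp z (zero_add m) := by
  ext p q hpq
  rw [Cochain.comp_zero_cochain_v, Cochain.zero_cochain_comp_v, cochainAdj_v, Cochain.ofHom_v,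
    Cochain.ofHom_v]
  exact adjLinearEquiv_coUnit η adj k (z.v p q hpq)

lemma δ_coconeConeEquiv (F G : CochainComplex C ℤ) (m n : ℤ)
    (z : Cochain (mappingCocone (unitCx T η F)) G m) :
    δ m n (coconeConeEquiv k η adj F G m z) = coconeConeEquiv k η adj F G n (δ m n z) := by
  by_cases h : m + 1 = n
  · obtain ⟨⟨α, β⟩, rfl⟩ := (fromCoconeEquiv k (unitCx T η F) G m).symm.surjective z
    change δ m n (coconeConeEquiv k η adj F G m (mappingCocone.descCochain _ α β rfl)) =
      coconeConeEquiv k η adj F G n (δ m n (mappingCocone.descCochain _ α β rfl))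
    subst h
    rw [mappingCocone.δ_descCochain _ _ _ _ (m + 1 + 1) rfl, coconeConeEquiv_apply,
      coconeConeEquiv_apply, inl_comp_fst_add, inr_comp_fst_add, mappingCocone.inl_comp_descCochain,
      mappingCocone.inr_comp_descCochain, mappingCone.δ_liftCochain _ _ _ _ (m + 1 + 1) rfl,
      δ_units_smul, δ_cochainAdj, Cochain.units_smul_comp, Cochain.units_smul_comp, cochainAdj_comp_counitCx,
      Int.negOnePow_succ, mappingCone.liftCochain, Units.neg_smul, Cochain.neg_comp,
      Cochain.units_smul_comp]
    all_goals rfl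
  · rw [δ_shape _ _ h, δ_shape _ _ h, map_zero]

lemma liftCochain_precomp {F F' G G' : CochainComplex C ℤ} (f : F ⟶ F') (φ : G ⟶ G') {m n : ℤ}
    (α : Cochain F' G n) (β : Cochain F' G' m) (h : m + 1 = n) :
    (Cochain.ofHom f).comp (mappingCone.liftCochain φ α β h) (zero_add m) =
      mappingCone.liftCochain φ ((Cochain.ofHom f).comp α (zero_add n))
        ((Cochain.ofHom f).comp β (zero_add m)) h := by
  simp only [mappingCone.liftCochain, Cochain.comp_add,
    Cochain.comp_assoc_of_first_is_zero_cochain]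

lemma inl_comp_mappingCoconeMap_comp {F F' G G' M : CochainComplex C ℤ} (φ : F ⟶ G) (φ' : F' ⟶ G')
    (a : F ⟶ F') (b : G ⟶ G') (comm : φ ≫ b = a ≫ φ') {m : ℤ}
    (z : Cochain (mappingCocone φ') M m) :
    (mappingCocone.inl φ).comp ((Cochain.ofHom (mappingCoconeMap φ φ' a b comm)).comp
      z (zero_add m)) (zero_add m) =
      (Cochain.ofHom a).comp ((mappingCocone.inl φ').comp z (zero_add m)) (zero_add m) := by
  ext p q hpq
  simp only [Cochain.zero_cochain_comp_v, Cochain.ofHom_v, ← Category.assoc]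
  exact congrArg (· ≫ z.v p q hpq) (inl_mappingCoconeMap ..)

lemma inr_comp_mappingCoconeMap_comp {F F' G G' M : CochainComplex C ℤ} (φ : F ⟶ G) (φ' : F' ⟶ G')
    (a : F ⟶ F') (b : G ⟶ G') (comm : φ ≫ b = a ≫ φ') {m n : ℤ}
    (z : Cochain (mappingCocone φ') M m) (h : 1 + m = n) :
    (mappingCocone.inr φ).1.comp ((Cochain.ofHom (mappingCoconeMap φ φ' a b comm)).comp
      z (zero_add m)) h =
      (Cochain.ofHom b).comp ((mappingCocone.inr φ').1.comp z h) (zero_add n) := by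
  ext p q hpq
  simp only [Cochain.zero_cochain_comp_v, Cochain.ofHom_v,
    Cochain.comp_v _ _ h p (p + 1) q rfl (by lia), ← Category.assoc]
  exact congrArg (· ≫ z.v (p + 1) q (by lia)) (inr_mappingCoconeMap ..)

lemma coconeConeEquiv_precomp {F F' : CochainComplex C ℤ} (f : F ⟶ F') (G : CochainComplex C ℤ)
    (m : ℤ) (z : Cochain (mappingCocone (unitCx T η F')) G m) :
    coconeConeEquiv k η adj F G m
        ((Cochain.ofHom (mappingCoconeMap _ _ f ((T.mapHomologicalComplex _).map f)
          (unitCx_naturality T η f).symm)).comp z (zero_add m)) =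
      (Cochain.ofHom f).comp (coconeConeEquiv k η adj F' G m z) (zero_add m) := by
  rw [coconeConeEquiv_apply, coconeConeEquiv_apply]
  refine Eq.trans (congrArg₂ (fun a b => mappingCone.liftCochain (counitCx T η S adj G)
    (m.negOnePow • cochainAdj k adj F G (m + 1) a) b rfl)
    (inr_comp_mappingCoconeMap_comp _ _ _ _ (unitCx_naturality T η f).symm z (add_comm 1 m))
    (inl_comp_mappingCoconeMap_comp _ _ _ _ (unitCx_naturality T η f).symm z)) ?_
  rw [cochainAdj_precomp, ← Cochain.comp_units_smul]
  exact (liftCochain_precomp ..).symm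

/-- The isomorphism of complexes `Hom(cocone(F ⟶ T(F)), G) ≅ Hom(F, cone(S(G) ⟶ G))`, for
`T ⊣ S`. -/
def homCxCoconeCone (G : CochainComplex C ℤ) :
    (coconeFunctor T η).op ⋙ homCxFunctor k G ≅ homCxFunctor k (coneObj T η S adj G) :=
  NatIso.ofComponents
    (fun F => HomologicalComplex.Hom.isoOfComponents
      (fun n => (coconeConeEquiv k η adj F.unop G n).toModuleIso)
      (fun n m _ => ModuleCat.hom_ext (LinearMap.ext fun z =>
        δ_coconeConeEquiv k η adj F.unop G n m z)))
    (fun {K K'} f => by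
      ext n : 1
      exact ModuleCat.hom_ext (LinearMap.ext fun z =>
        coconeConeEquiv_precomp k η adj f.unop G n z))

end

/-! ### Iterated cocones and iterated kernels -/

section

variable {C : Type*} [Category.{u} C] [Abelian C]

lemma isZero_Q_obj_iff [HasDerivedCategory.{w₁} C] (K : CochainComplex C ℤ) :
    IsZero (DerivedCategory.Q.obj K) ↔ K.Acyclic := by
  refine ⟨fun h i => ?_, fun h => ?_⟩
  · rw [HomologicalComplex.exactAt_iff_isZero_homology]
    exact IsZero.of_iso ((DerivedCategory.homologyFunctor C i).map_isZero h)
      ((DerivedCategory.homologyFunctorFactors C i).app K).symm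
  · let Z : CochainComplex C ℤ := HomologicalComplex.zero
    have hZ : IsZero Z := HomologicalComplex.isZero_zero
    have : QuasiIso (0 : K ⟶ Z) := ⟨fun i => by
      rw [quasiIsoAt_iff_exactAt _ _ (h i)]
      exact HomologicalComplex.acyclic_of_isZero _ hZ i⟩
    exact IsZero.of_iso (DerivedCategory.Q.map_isZero hZ)
      (asIso (DerivedCategory.Q.map (0 : K ⟶ Z)))

lemma isZero_Q_mappingCocone_iff [HasDerivedCategory.{w₁} C] {K L : CochainComplex C ℤ}
    (φ : K ⟶ L) : IsZero (DerivedCategory.Q.obj (mappingCocone φ)) ↔ QuasiIso φ := by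
  rw [← DerivedCategory.isIso_Q_map_iff_quasiIso]
  exact Pretriangulated.Triangle.isZero₁_iff_isIso₂ _
    (DerivedCategory.mappingCocone_triangle_distinguished φ)

lemma isZero_Q_mappingCone_iff [HasDerivedCategory.{w₁} C] {K L : CochainComplex C ℤ}
    (φ : K ⟶ L) : IsZero (DerivedCategory.Q.obj (mappingCone φ)) ↔ QuasiIso φ := by
  rw [← DerivedCategory.isIso_Q_map_iff_quasiIso]
  exact Pretriangulated.Triangle.isZero₃_iff_isIso₁ _
    (DerivedCategory.mappingCone_triangle_distinguished φ)

/-- A monomorphism with acyclic cokernel is a quasi-isomorphism. -/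
lemma quasiIso_f_of_shortExact [HasDerivedCategory.{w₁} C]
    {S : ShortComplex (CochainComplex C ℤ)} (hS : S.ShortExact)
    (h : IsZero (DerivedCategory.Q.obj S.X₃)) : QuasiIso S.f := by
  rw [← DerivedCategory.isIso_Q_map_iff_quasiIso]
  exact (Pretriangulated.Triangle.isZero₃_iff_isIso₁ _
    (DerivedCategory.triangleOfSES_distinguished hS)).1 h

section

variable {K F G : CochainComplex C ℤ} (j : K ⟶ F) (φ : F ⟶ G) (w : j ≫ φ = 0)

/-- The morphism to `cocone(φ)` given by a morphism `j` such that `j ≫ φ = 0`. -/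
def toCocone : K ⟶ mappingCocone φ :=
  mappingCocone.lift φ j (0 : Cochain _ _ (-1)) (by simp [w])

lemma toCocone_fst (i : ℤ) : (toCocone j φ w).f i ≫ (mappingCocone.fst φ).f i = j.f i :=
  mappingCocone.lift_f_fst_f ..

lemma toCocone_snd (i i' : ℤ) (h : i + -1 = i') :
    (toCocone j φ w).f i ≫ (mappingCocone.snd φ).v i i' h = 0 :=
  (mappingCocone.lift_f_snd_v φ j (0 : Cochain _ _ (-1)) _ i i' h).trans rfl

lemma toCocone_naturality {K' F' G' : CochainComplex C ℤ} (j' : K' ⟶ F') (φ' : F' ⟶ G')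
    (w' : j' ≫ φ' = 0) (a : K ⟶ K') (b : F ⟶ F') (c : G ⟶ G') (h : a ≫ j' = j ≫ b)
    (comm : φ ≫ c = b ≫ φ') :
    a ≫ toCocone j' φ' w' = toCocone j φ w ≫ mappingCoconeMap φ φ' b c comm := by
  ext i
  refine mappingCocone_ext_to φ' (sub_eq_add_neg i 1).symm ?_ ?_
  · rw [HomologicalComplex.comp_f, HomologicalComplex.comp_f, Category.assoc, Category.assoc,
      toCocone_fst, mappingCoconeMap_f_fst, reassoc_of% (toCocone_fst j φ w i), ← HomologicalComplex.comp_f, h, HomologicalComplex.comp_f]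
  · rw [HomologicalComplex.comp_f, HomologicalComplex.comp_f, Category.assoc, Category.assoc,
      toCocone_snd, mappingCoconeMap_f_snd, reassoc_of% (toCocone_snd j φ w i (i - 1)), comp_zero, zero_comp]

/-- The kernel of an epimorphism of complexes is quasi-isomorphic to the cocone: the quotient is
the cocone of an identity. -/
lemma toCocone_quasiIso (hS : (ShortComplex.mk j φ w).ShortExact) :
    QuasiIso (toCocone j φ w) := by
  let _ := HasDerivedCategory.standard C
  let g : mappingCocone φ ⟶ mappingCocone (𝟙 G) := mappingCoconeMap φ (𝟙 G) φ (𝟙 G) rfl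
  have hg₁ (i : ℤ) : g.f i ≫ (mappingCocone.fst (𝟙 G)).f i =
      (mappingCocone.fst φ).f i ≫ φ.f i := mappingCoconeMap_f_fst ..
  have hg₂ (i j : ℤ) (hij : i + -1 = j) : g.f i ≫ (mappingCocone.snd (𝟙 G)).v i j hij =
      (mappingCocone.snd φ).v i j hij :=
    (mappingCoconeMap_f_snd ..).trans (Category.comp_id _)
  have hj (i : ℤ) := hS.map_of_exact (HomologicalComplex.eval C (ComplexShape.up ℤ) i)
  have hz (i : ℤ) : (toCocone j φ w).f i ≫ g.f i = 0 := by
    refine mappingCocone_ext_to (𝟙 G) (sub_eq_add_neg i 1).symm ?_ ?_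
    · rw [zero_comp, Category.assoc, hg₁, ← Category.assoc, toCocone_fst,
        ← HomologicalComplex.comp_f, w, HomologicalComplex.zero_f]
    · rw [zero_comp, Category.assoc, hg₂, toCocone_snd]
  have hzero : toCocone j φ w ≫ g = 0 := by
    ext i
    exact hz i
  refine quasiIso_f_of_shortExact (S := ShortComplex.mk _ _ hzero) ?_ ?_
  · refine HomologicalComplex.shortExact_of_degreewise_shortExact _ fun i => ?_
    have hmono : Mono (j.f i) := (hj i).mono_f
    have hepi : Epi (φ.f i) := (hj i).epi_g
    have h₁ : Mono ((toCocone j φ w).f i) := by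
      have : Mono ((toCocone j φ w).f i ≫ (mappingCocone.fst φ).f i) := by
        rw [toCocone_fst]; infer_instance
      exact mono_of_mono _ ((mappingCocone.fst φ).f i)
    have h₂ : Epi (g.f i) := by
      refine ⟨fun {A} a b hab => mappingCocone_ext_from (𝟙 G) (sub_eq_add_neg i 1).symm ?_ ?_⟩
      · have h := inl_mappingCoconeMap φ (𝟙 G) φ (𝟙 G) rfl i
        rw [← cancel_epi (φ.f i), ← Category.assoc, ← Category.assoc, ← h, Category.assoc,
          Category.assoc, hab]
      · have h := (inr_mappingCoconeMap φ (𝟙 G) φ (𝟙 G) rfl (i - 1) i (sub_add_cancel i 1)).trans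
          (Category.id_comp _)
        rw [← h, Category.assoc, Category.assoc, hab]
    refine { exact := ShortComplex.exact_of_f_is_kernel _ ?_, mono_f := h₁, epi_g := h₂ }
    refine KernelFork.IsLimit.ofι' (i := (toCocone j φ w).f i) _ fun {A} a ha => ?_
    have ha' : a ≫ g.f i = 0 := ha
    have ha₁ : (a ≫ (mappingCocone.fst φ).f i) ≫ φ.f i = 0 := by
      rw [Category.assoc, ← hg₁, ← Category.assoc, ha', zero_comp]
    have ha₂ : a ≫ (mappingCocone.snd φ).v i (i - 1) (sub_eq_add_neg i 1).symm = 0 := by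
      rw [← hg₂, ← Category.assoc, ha', zero_comp]
    have l₁ : (hj i).fIsKernel.lift (KernelFork.ofι _ ha₁) ≫ j.f i =
      a ≫ (mappingCocone.fst φ).f i := (hj i).fIsKernel.fac (KernelFork.ofι _ ha₁) .zero
    refine ⟨(hj i).fIsKernel.lift (KernelFork.ofι _ ha₁), ?_⟩
    refine mappingCocone_ext_to φ (sub_eq_add_neg i 1).symm ?_ ?_
    · refine (Category.assoc _ _ _).trans ?_
      rw [toCocone_fst]
      exact l₁
    · refine (Category.assoc _ _ _).trans ?_
      rw [toCocone_snd, ha₂]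
      exact comp_zero
  · exact (isZero_Q_mappingCocone_iff _).2 inferInstance

end

variable (T : C ⥤ C) [T.Additive] (η : 𝟭 C ⟶ T)

/-- The functor `F ↦ ker(F ⟶ T(F))`. -/
def unitKernel : C ⥤ C where
  obj F := kernel (η.app F)
  map {F G} f := kernel.map _ _ f (T.map f) (η.naturality f).symm
  map_id F := by ext; simp
  map_comp f g := by ext; simp

/-- The inclusion of the kernel of `F ⟶ T(F)`. -/
def unitKernelι (F : C) : (unitKernel T η).obj F ⟶ F := kernel.ι (η.app F)

instance (F : C) : Mono (unitKernelι T η F) := inferInstanceAs (Mono (kernel.ι (η.app F)))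

omit [T.Additive] in
lemma unitKernelι_naturality {F G : C} (f : F ⟶ G) :
    (unitKernel T η).map f ≫ unitKernelι T η G = unitKernelι T η F ≫ f := kernel.lift_ι _ _ _

omit [T.Additive] in
lemma unitKernelι_comp (F : C) : unitKernelι T η F ≫ η.app F = 0 := kernel.condition _

instance : (unitKernel T η).Additive where
  map_add {F G f g} := by
    rw [← cancel_mono (unitKernelι T η G), Preadditive.add_comp, unitKernelι_naturality,
      unitKernelι_naturality, unitKernelι_naturality, Preadditive.comp_add]

/-- The inclusion of the kernel of `F ⟶ T(F)`, for a complex `F`. -/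
def unitKernelιCx (F : CochainComplex C ℤ) :
    ((unitKernel T η).mapHomologicalComplex _).obj F ⟶ F where
  f i := unitKernelι T η (F.X i)
  comm' i j _ := (unitKernelι_naturality T η (F.d i j)).symm

lemma unitKernelιCx_comp (F : CochainComplex C ℤ) : unitKernelιCx T η F ≫ unitCx T η F = 0 := by
  ext i
  exact unitKernelι_comp T η (F.X i)

/-- The comparison morphism `ker(F ⟶ T(F)) ⟶ cocone(F ⟶ T(F))`. -/
def kernelToCocone (F : CochainComplex C ℤ) :
    ((unitKernel T η).mapHomologicalComplex _).obj F ⟶ (coconeFunctor T η).obj F :=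
  toCocone _ _ (unitKernelιCx_comp T η F)

lemma kernelToCocone_naturality {F G : CochainComplex C ℤ} (f : F ⟶ G) :
    ((unitKernel T η).mapHomologicalComplex _).map f ≫ kernelToCocone T η G =
      kernelToCocone T η F ≫ (coconeFunctor T η).map f := by
  refine toCocone_naturality _ _ _ _ _ _ _ _ _ ?_ _
  ext i
  exact unitKernelι_naturality T η (f.f i)

lemma kernelToCocone_quasiIso (F : CochainComplex C ℤ) (hF : ∀ i, Epi (η.app (F.X i))) :
    QuasiIso (kernelToCocone T η F) := by
  refine toCocone_quasiIso _ _ _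
    (HomologicalComplex.shortExact_of_degreewise_shortExact _ fun i => ?_)
  have : Mono ((unitKernelιCx T η F).f i) := inferInstanceAs (Mono (unitKernelι T η (F.X i)))
  have : Epi ((unitCx T η F).f i) := hF i
  exact { exact := ShortComplex.exact_of_f_is_kernel _ (kernelIsKernel (η.app (F.X i)))
          mono_f := ‹_›
          epi_g := hF i }

end

set_option linter.unusedSectionVars false
set_option linter.unusedVariables false

section

variable {C : Type*} [Category.{u} C] [Abelian C] {ι : Type*} (T : ι → C ⥤ C)
  [∀ i, (T i).Additive] (η : ∀ i, 𝟭 C ⟶ T i)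

/-- The iterated cocone construction: `F ↦ cocone(F ⟶ T(F))` for the functors `T` in the list,
one after the other. For sheaves and the restrictions to the members of an open covering, this is
a Čech complex. -/
def iterCocone : List ι → CochainComplex C ℤ ⥤ CochainComplex C ℤ
  | [] => 𝟭 _
  | i :: l => coconeFunctor (T i) (η i) ⋙ iterCocone l

/-- The iterated kernel construction: the largest subobject of `F` with zero image in `T(F)` for
all functors `T` in the list, in the case of restriction functors. -/
def iterKernel : List ι → C ⥤ C
  | [] => 𝟭 _
  | i :: l => unitKernel (T i) (η i) ⋙ iterKernel l

instance iterKernel_additive : (l : List ι) → (iterKernel T η l).Additive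
  | [] => inferInstanceAs (𝟭 C).Additive
  | i :: l =>
    have := iterKernel_additive l
    inferInstanceAs (unitKernel (T i) (η i) ⋙ iterKernel T η l).Additive

instance iterCocone_map_quasiIso [∀ i, PreservesFiniteLimits (T i)]
    [∀ i, PreservesFiniteColimits (T i)] : (l : List ι) → {F G : CochainComplex C ℤ} → (f : F ⟶ G) →
      [QuasiIso f] → QuasiIso ((iterCocone T η l).map f)
  | [], _, _, f, hf => hf
  | i :: l, F, G, f, hf => iterCocone_map_quasiIso l ((coconeFunctor (T i) (η i)).map f)

/-- The comparison between iterated kernels and iterated cocones. -/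
def iterKernelToCocone : (l : List ι) → (F : CochainComplex C ℤ) →
    (((iterKernel T η l).mapHomologicalComplex _).obj F ⟶ (iterCocone T η l).obj F)
  | [], F => { f i := 𝟙 (F.X i), comm' i j _ := (Category.id_comp _).trans (Category.comp_id _).symm }
  | i :: l, F => iterKernelToCocone l (((unitKernel (T i) (η i)).mapHomologicalComplex _).obj F) ≫
      (iterCocone T η l).map (kernelToCocone (T i) (η i) F)

lemma iterKernelToCocone_naturality : (l : List ι) → {F G : CochainComplex C ℤ} → (f : F ⟶ G) →
    ((iterKernel T η l).mapHomologicalComplex _).map f ≫ iterKernelToCocone T η l G =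
      iterKernelToCocone T η l F ≫ (iterCocone T η l).map f
  | [], F, G, f => by
    ext i
    exact (Category.comp_id _).trans (Category.id_comp _).symm
  | i :: l, F, G, f => by
    have h := iterKernelToCocone_naturality l
      (((unitKernel (T i) (η i)).mapHomologicalComplex _).map f)
    refine (Category.assoc _ _ _).symm.trans ((congrArg (· ≫ _) h).trans ?_)
    refine (Category.assoc _ _ _).trans (Eq.trans ?_ (Category.assoc _ _ _).symm)
    refine congrArg (fun t => _ ≫ t) ?_
    refine (Functor.map_comp _ _ _).symm.trans (Eq.trans ?_ (Functor.map_comp _ _ _))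
    exact congrArg _ (kernelToCocone_naturality (T i) (η i) f)

/-- An object `F` is iteratively flasque if `F ⟶ T(F)` is an epimorphism for the first functor
`T`, and its kernel is iteratively flasque for the remaining functors. -/
def IterFlasque : List ι → C → Prop
  | [], _ => True
  | i :: l, F => Epi ((η i).app F) ∧ IterFlasque l ((unitKernel (T i) (η i)).obj F)

/-- On iteratively flasque objects, the iterated cocone is a resolution of the iterated kernel. -/
lemma iterKernelToCocone_quasiIso [∀ i, PreservesFiniteLimits (T i)]
    [∀ i, PreservesFiniteColimits (T i)] : (l : List ι) → (F : CochainComplex C ℤ) →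
    (∀ n, IterFlasque T η l (F.X n)) → QuasiIso (iterKernelToCocone T η l F)
  | [], F, _ => by
    have : iterKernelToCocone T η [] F = 𝟙 F := rfl
    exact inferInstanceAs (QuasiIso (𝟙 F))
  | i :: l, F, hF => by
    have := iterKernelToCocone_quasiIso l
      (((unitKernel (T i) (η i)).mapHomologicalComplex _).obj F) fun n => (hF n).2
    have := kernelToCocone_quasiIso (T i) (η i) F fun n => (hF n).1
    exact inferInstanceAs (QuasiIso (iterKernelToCocone T η l _ ≫
      (iterCocone T η l).map (kernelToCocone (T i) (η i) F)))

/-- The class of iteratively flasque objects is stable by finite sums and direct summands. -/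
lemma IterFlasque.of_sum : (l : List ι) → {F X Y : C} → (i₁ : X ⟶ F) → (f₁ : F ⟶ X) →
    (i₂ : Y ⟶ F) → (f₂ : F ⟶ Y) → f₁ ≫ i₁ + f₂ ≫ i₂ = 𝟙 F → IterFlasque T η l X →
    IterFlasque T η l Y → IterFlasque T η l F
  | [], _, _, _, _, _, _, _, _, _, _ => trivial
  | i :: l, F, X, Y, i₁, f₁, i₂, f₂, h, hX, hY => by
    constructor
    · refine ⟨fun {A} a b hab => ?_⟩
      have key {Z : C} (j : Z ⟶ F) (hZ : Epi ((η i).app Z)) :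
          (T i).map j ≫ a = (T i).map j ≫ b := by
        refine (cancel_epi ((η i).app Z)).1 ?_
        have h := (η i).naturality j
        dsimp only [Functor.id_map] at h
        rw [← Category.assoc, ← Category.assoc]
        refine (congrArg (· ≫ a) h.symm).trans (Eq.trans ?_ (congrArg (· ≫ b) h))
        refine (Category.assoc _ _ _).trans (Eq.trans ?_ (Category.assoc _ _ _).symm)
        exact congrArg (j ≫ ·) hab
      have h' := congrArg (T i).map h
      rw [Functor.map_add, Functor.map_comp, Functor.map_comp, CategoryTheory.Functor.map_id] at h'
      rw [← Category.id_comp a, ← Category.id_comp b, ← h', Preadditive.add_comp,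
        Preadditive.add_comp, Category.assoc, Category.assoc, Category.assoc, Category.assoc,
        key i₁ hX.1, key i₂ hY.1]
    · refine IterFlasque.of_sum l ((unitKernel (T i) (η i)).map i₁)
        ((unitKernel (T i) (η i)).map f₁) ((unitKernel (T i) (η i)).map i₂)
        ((unitKernel (T i) (η i)).map f₂) ?_ hX.2 hY.2
      rw [← Functor.map_comp, ← Functor.map_comp, ← Functor.map_add, h,
        CategoryTheory.Functor.map_id]

lemma IterFlasque.of_iso (l : List ι) {F G : C} (e : F ≅ G) (h : IterFlasque T η l F) :
    IterFlasque T η l G :=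
  IterFlasque.of_sum T η l e.hom e.inv 0 (0 : G ⟶ F) (by simp) h h

lemma IterFlasque.of_isZero : (l : List ι) → {F : C} → IsZero F → IterFlasque T η l F
  | [], _, _ => trivial
  | i :: l, F, h => ⟨⟨fun _ _ _ => ((T i).map_isZero h).eq_of_src _ _⟩, IterFlasque.of_isZero l
        (IsZero.of_mono (unitKernelι (T i) (η i) F) h)⟩

lemma IterFlasque.of_isIso_or_isZero : (l : List ι) → {F : C} →
    (∀ i, IsIso ((η i).app F) ∨ IsZero ((T i).obj F)) → IterFlasque T η l F
  | [], _, _ => trivial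
  | i :: l, F, h => by
    rcases h i with hi | hi
    · exact ⟨inferInstance, IterFlasque.of_isZero T η l (isZero_kernel_of_mono _)⟩
    · refine ⟨⟨fun _ _ _ => hi.eq_of_src _ _⟩, IterFlasque.of_iso T η l ?_
        (IterFlasque.of_isIso_or_isZero l h)⟩
      have : IsIso (kernel.ι ((η i).app F)) := by
        rw [hi.eq_of_tgt ((η i).app F) 0]
        infer_instance
      exact (asIso (kernel.ι ((η i).app F))).symm

variable (k : Type u) [CommRing k] [Linear k C] {S : ι → C ⥤ C} [∀ i, (S i).Additive]
  [∀ i, (S i).Linear k] {T} (adj : ∀ i, T i ⊣ S i)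

/-- The iterated cone construction, right adjoint to the iterated cocone construction. -/
def iterCone (G : CochainComplex C ℤ) : List ι → CochainComplex C ℤ
  | [] => G
  | i :: l => coneObj (T i) (η i) (S i) (adj i) (iterCone G l)

/-- The isomorphism of complexes between morphisms from an iterated cocone and morphisms to an
iterated cone. -/
def homCxIterCone (G : CochainComplex C ℤ) : (l : List ι) →
    ((iterCocone T η l).op ⋙ homCxFunctor k G ≅ homCxFunctor k (iterCone η adj G l))
  | [] => Iso.refl _
  | i :: l => Functor.isoWhiskerLeft (coconeFunctor (T i) (η i)).op (homCxIterCone G l) ≪≫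
      homCxCoconeCone k (η i) (adj i) (iterCone η adj G l)

variable (S) in
lemma iterCone_injective (G : CochainComplex C ℤ) [∀ n, Injective (G.X n)]
    (hS : ∀ i X, Injective X → Injective ((S i).obj X)) : (l : List ι) → (n : ℤ) →
    Injective ((iterCone η adj G l).X n)
  | [], n => inferInstanceAs (Injective (G.X n))
  | i :: l, n => by
    have h₁ := hS i _ (iterCone_injective G hS l (n + 1))
    have h₂ := iterCone_injective G hS l n
    let e := HomologicalComplex.homotopyCofiber.XIsoBiprod
      (counitCx (T i) (η i) (S i) (adj i) (iterCone η adj G l)) n (n + 1) rfl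
    have h₃ : Injective (((((S i).mapHomologicalComplex _).obj (iterCone η adj G l)).X (n + 1)) ⊞
      (iterCone η adj G l).X n) := by
      have : Injective ((((S i).mapHomologicalComplex _).obj (iterCone η adj G l)).X (n + 1)) := h₁
      infer_instance
    exact Injective.of_iso e.symm h₃

lemma iterCone_isZero (G : CochainComplex C ℤ) [G.IsStrictlyGE 0] : (l : List ι) → (n : ℤ) →
    n < -l.length → IsZero ((iterCone η adj G l).X n)
  | [], n, hn => G.isZero_of_isStrictlyGE 0 n (by simpa using hn)
  | i :: l, n, hn => by
    refine (mappingCone.isZero_X_iff _ _).2 ⟨(S i).map_isZero (iterCone_isZero G l _ ?_),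
      iterCone_isZero G l _ ?_⟩ <;> simp at hn <;> lia

lemma iterCone_isKInjective (G : CochainComplex C ℤ) [G.IsStrictlyGE 0]
    [∀ n, Injective (G.X n)] (hS : ∀ i X, Injective X → Injective ((S i).obj X)) (l : List ι) :
    (iterCone η adj G l).IsKInjective := by
  have : (iterCone η adj G l).IsStrictlyGE (-l.length) := by
    rw [isStrictlyGE_iff]
    exact iterCone_isZero η adj G l
  have := iterCone_injective η S adj G hS l
  exact isKInjective_of_injective _ (-l.length)

end

/-! ### Diagrams of modules on the poset of finite subsets -/

lemma rightAdjoint_linear {C D : Type*} [Category C] [Category D] [Preadditive C] [Preadditive D]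
    (k : Type u) [CommRing k] [Linear k C] [Linear k D] {L : C ⥤ D} {R : D ⥤ C} (adj : L ⊣ R)
    [R.Additive] [L.Additive] [L.Linear k] : R.Linear k where
  map_smul {X Y} f r := by
    apply (adj.homEquiv _ _).symm.injective
    rw [adj.homEquiv_counit, adj.homEquiv_counit, adj.counit_naturality, L.map_smul,
      Linear.smul_comp, adj.counit_naturality, Linear.comp_smul]

section

variable (k : Type u) [CommRing k] (κ : Type u)

/-- The category of diagrams of `k`-modules indexed by the poset of finite subsets of `κ`. For a
finite set `κ`, this is the category of sheaves of `k`-modules on the finite space of subsets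
of `κ`. -/
abbrev PosetMod := Finset κ ⥤ ModuleCat.{u} k

variable {κ}

/-- The exact functor `F ↦ F(s)`. -/
abbrev evalAt (s : Finset κ) : PosetMod k κ ⥤ ModuleCat.{u} k := (evaluation _ _).obj s

instance (s : Finset κ) : (evalAt k s).Linear k where

/-- The right adjoint of the evaluation at `r`: the diagram with value `M` on the subsets of `r`
and `0` elsewhere. -/
abbrev directImage (r : Finset κ) : ModuleCat.{u} k ⥤ PosetMod k κ := evaluationRightAdjoint _ r

/-- The evaluation at `r` is left adjoint to the direct image functor. -/
abbrev evalDirectImageAdj (r : Finset κ) : evalAt k r ⊣ directImage k r :=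
  evaluationAdjunctionLeft _ _

instance (r : Finset κ) : (directImage k r).Additive :=
  (evalDirectImageAdj k r).right_adjoint_additive

instance (r : Finset κ) : (directImage k r).Linear k :=
  rightAdjoint_linear k (evalDirectImageAdj k r)

lemma isZero_directImage_obj (r : Finset κ) (M : ModuleCat.{u} k) (s : Finset κ) (hs : ¬ s ⊆ r) :
    IsZero (((directImage k r).obj M).obj s) := by
  rw [IsZero.iff_id_eq_zero]
  exact limit.hom_ext fun ⟨j⟩ => (hs (leOfHom j)).elim

lemma isIso_directImage_π {r s : Finset κ} (M : ModuleCat.{u} k) (j : s ⟶ r) :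
    IsIso (Pi.π (fun _ : s ⟶ r => M) j) :=
  ⟨Pi.lift fun _ => 𝟙 M, by
    refine limit.hom_ext fun ⟨j'⟩ => ?_
    refine (Category.assoc _ _ _).trans ?_
    refine (congrArg (fun t => _ ≫ t) (Pi.lift_π (fun _ => 𝟙 M) j')).trans ?_
    refine (Category.comp_id _).trans (Eq.trans ?_ (Category.id_comp _).symm)
    exact congrArg (Pi.π (fun _ : s ⟶ r => M)) (Subsingleton.elim _ _),
    Pi.lift_π (fun _ => 𝟙 M) _⟩

lemma isIso_directImage_map (r : Finset κ) (M : ModuleCat.{u} k) {s t : Finset κ} (f : s ⟶ t)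
    (h : s ⊆ r → t ⊆ r) : IsIso (((directImage k r).obj M).map f) := by
  by_cases ht : t ⊆ r
  · have h₁ := isIso_directImage_π k M (homOfLE ht)
    have h₂ := isIso_directImage_π k M (f ≫ homOfLE ht)
    have h₃ : ((directImage k r).obj M).map f ≫ Pi.π (fun _ : t ⟶ r => M) (homOfLE ht) =
      Pi.π (fun _ : s ⟶ r => M) (f ≫ homOfLE ht) := Pi.lift_π _ _
    rw [← h₃] at h₂
    exact @IsIso.of_isIso_comp_right _ _ _ _ _ _ _ h₁ h₂
  · have h₁ := isZero_directImage_obj k r M t ht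
    have h₂ := isZero_directImage_obj k r M s fun hs => ht (h hs)
    exact ⟨0, h₂.eq_of_src _ _, h₁.eq_of_src _ _⟩

instance (r : Finset κ) : IsIso (evalDirectImageAdj k r).counit :=
  have (M : ModuleCat.{u} k) : IsIso ((evalDirectImageAdj k r).counit.app M) :=
    isIso_directImage_π k M (𝟙 r)
  NatIso.isIso_of_isIso_app _

lemma isIso_evalAt_unit (r : Finset κ) (F : PosetMod k κ) :
    IsIso ((evalAt k r).map ((evalDirectImageAdj k r).unit.app F)) := by
  have h : IsIso ((evalAt k r).map ((evalDirectImageAdj k r).unit.app F) ≫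
      (evalDirectImageAdj k r).counit.app ((evalAt k r).obj F)) := by
    have e := (evalDirectImageAdj k r).left_triangle_components F
    exact (congrArg IsIso e).mpr inferInstance
  exact IsIso.of_isIso_comp_right _ ((evalDirectImageAdj k r).counit.app _)

/-- The value at `r` of the direct image. -/
def directImageEvalIso (r : Finset κ) : directImage k r ⋙ evalAt k r ≅ 𝟭 _ :=
  asIso (evalDirectImageAdj k r).counit

variable [DecidableEq κ]

/-- The monotone map `s ↦ s ∪ {i}`. -/
def insertFunctor (i : κ) : Finset κ ⥤ Finset κ :=
  Monotone.functor (f := insert i) fun _ _ h => Finset.insert_subset_insert i h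

/-- The monotone map `s ↦ s \ {i}`. -/
def eraseFunctor (i : κ) : Finset κ ⥤ Finset κ :=
  Monotone.functor (f := fun s => s.erase i) fun _ _ h => Finset.erase_subset_erase i h

/-- The map `s ↦ s \ {i}` is left adjoint to the map `s ↦ s ∪ {i}`. -/
def eraseInsertAdj (i : κ) : eraseFunctor i ⊣ insertFunctor i :=
  GaloisConnection.adjunction (l := fun s : Finset κ => s.erase i) (u := insert i) fun _ _ =>
    Finset.subset_insert_iff.symm

/-- The functor `F ↦ (s ↦ F(s ∪ {i}))`. -/
abbrev insertPullback (i : κ) : PosetMod k κ ⥤ PosetMod k κ :=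
  (Functor.whiskeringLeft _ _ _).obj (insertFunctor i)

/-- The functor `F ↦ (s ↦ F(s \ {i}))`. -/
abbrev erasePullback (i : κ) : PosetMod k κ ⥤ PosetMod k κ :=
  (Functor.whiskeringLeft _ _ _).obj (eraseFunctor i)

/-- Adjunction between the two functors. -/
def insertEraseAdj (i : κ) : insertPullback k i ⊣ erasePullback k i :=
  (eraseInsertAdj i).whiskerLeft _

instance (i : κ) : (insertPullback k i).Additive where
instance (i : κ) : (erasePullback k i).Additive where
instance (i : κ) : (erasePullback k i).Linear k where

/-- The natural transformation given by the morphisms `F(s) ⟶ F(s ∪ {i})`. -/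
def insertUnit (i : κ) : 𝟭 (PosetMod k κ) ⟶ insertPullback k i where
  app F :=
    { app s := F.map (homOfLE (Finset.subset_insert i s))
      naturality s t f := by
        refine (F.map_comp _ _).symm.trans (Eq.trans ?_ (F.map_comp _ _))
        exact congrArg F.map (Subsingleton.elim _ _) }
  naturality F G f := by
    ext s : 2
    exact (f.naturality (homOfLE (Finset.subset_insert i s))).symm

lemma coUnit_insertUnit (i : κ) (G : PosetMod k κ) (s : Finset κ) :
    ((coUnit _ (insertUnit k i) _ (insertEraseAdj k i)).app G).app s =
      G.map (homOfLE (Finset.erase_subset i s)) := by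
  refine (G.map_comp ((eraseFunctor i).map (homOfLE (Finset.subset_insert i s))) _).symm.trans ?_
  exact congrArg G.map (Subsingleton.elim _ _)

lemma erasePullback_injective (i : κ) (G : PosetMod k κ) (hG : Injective G) :
    Injective ((erasePullback k i).obj G) :=
  Injective.injective_of_adjoint (insertEraseAdj k i) G

/-! ### Stalks of iterated cones -/

/-- The class in the derived category of the complex `G(s)`. -/
abbrev evalQ [HasDerivedCategory.{w₂} (ModuleCat.{u} k)] (s : Finset κ) :
    CochainComplex (PosetMod k κ) ℤ ⥤ DerivedCategory (ModuleCat.{u} k) :=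
  (evalAt k s).mapHomologicalComplex (ComplexShape.up ℤ) ⋙ DerivedCategory.Q

section

variable [HasDerivedCategory.{w₂} (ModuleCat.{u} k)] (s : Finset κ)

/-- The complex `cone(G(s \ {i}) ⟶ G(s))`. -/
def evalCone (i : κ) (G : CochainComplex (PosetMod k κ) ℤ) :
    (evalQ k s).obj (coneObj _ (insertUnit k i) _ (insertEraseAdj k i) G) ≅
      DerivedCategory.Q.obj (mappingCone (((evalAt k s).mapHomologicalComplex _).map
        (counitCx _ (insertUnit k i) _ (insertEraseAdj k i) G))) :=
  DerivedCategory.Q.mapIso (mappingCone.mapHomologicalComplexIso _ _)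

lemma isZero_evalQ_cone_of_notMem (i : κ) (hi : i ∉ s) (G : CochainComplex (PosetMod k κ) ℤ) :
    IsZero ((evalQ k s).obj (coneObj _ (insertUnit k i) _ (insertEraseAdj k i) G)) := by
  refine IsZero.of_iso ((isZero_Q_mappingCone_iff _).2 ?_) (evalCone k s i G)
  have (n : ℤ) : IsIso ((((evalAt k s).mapHomologicalComplex (ComplexShape.up ℤ)).map
      (counitCx _ (insertUnit k i) _ (insertEraseAdj k i) G)).f n) := by
    have e := coUnit_insertUnit k i (G.X n) s
    have : IsIso (homOfLE (Finset.erase_subset i s)) :=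
      ⟨homOfLE (Finset.erase_eq_of_notMem hi).ge, Subsingleton.elim _ _, Subsingleton.elim _ _⟩
    have h : IsIso ((G.X n).map (homOfLE (Finset.erase_subset i s))) := inferInstance
    rw [← e] at h
    exact h
  have := HomologicalComplex.Hom.isIso_of_components (((evalAt k s).mapHomologicalComplex
    (ComplexShape.up ℤ)).map (counitCx _ (insertUnit k i) _ (insertEraseAdj k i) G))
  infer_instance

lemma isZero_evalQ_cone (i : κ) (G : CochainComplex (PosetMod k κ) ℤ)
    (h₁ : IsZero ((evalQ k s).obj G)) (h₂ : IsZero ((evalQ k (s.erase i)).obj G)) :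
    IsZero ((evalQ k s).obj (coneObj _ (insertUnit k i) _ (insertEraseAdj k i) G)) := by
  refine IsZero.of_iso ((isZero_Q_mappingCone_iff _).2 ?_) (evalCone k s i G)
  rw [← DerivedCategory.isIso_Q_map_iff_quasiIso]
  exact ⟨0, h₂.eq_of_src _ _, h₁.eq_of_src _ _⟩

lemma nonempty_evalQ_cone_iso (i : κ) (G : CochainComplex (PosetMod k κ) ℤ)
    (h₁ : IsZero ((evalQ k s).obj G)) :
    Nonempty ((evalQ k s).obj (coneObj _ (insertUnit k i) _ (insertEraseAdj k i) G) ≅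
      ((evalQ k (s.erase i)).obj G)⟦(1 : ℤ)⟧) := by
  have h := DerivedCategory.mappingCone_triangle_distinguished
    (((evalAt k s).mapHomologicalComplex (ComplexShape.up ℤ)).map
      (counitCx _ (insertUnit k i) _ (insertEraseAdj k i) G))
  have := (Pretriangulated.Triangle.isZero₂_iff_isIso₃ _ h).1 h₁
  exact ⟨evalCone k s i G ≪≫ @asIso _ _ _ _ _ this⟩

variable (J : CochainComplex (ModuleCat.{u} k) ℤ)

variable (κ) in
/-- The complex of diagrams which represents `F ↦ Hom(E(F)(∅), J)`, where `E` is the iterated cocone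
construction: an iterated cone on the direct image of `J` at `∅`. -/
abbrev dualizing (l : List κ) : CochainComplex (PosetMod k κ) ℤ :=
  iterCone (insertUnit k) (insertEraseAdj k) (((directImage k ∅).mapHomologicalComplex _).obj J) l

/-- Each cone involves only the values at `s` and at the sets `s \ {j}` with `j ∈ l`, hence at
nonempty sets if `s` has an element outside of `l`, where the direct image at `∅` vanishes. -/
lemma isZero_evalQ_dualizing_of_not_subset : (l : List κ) → (s : Finset κ) →
    (∃ i ∈ s, i ∉ l) → IsZero ((evalQ k s).obj (dualizing k κ J l))
  | [], s, ⟨i, hi, _⟩ => by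
    refine (isZero_Q_obj_iff _).2 (HomologicalComplex.acyclic_of_isZero _ ?_)
    rw [IsZero.iff_id_eq_zero]
    ext n : 1
    exact (isZero_directImage_obj k ∅ (J.X n) s
      fun h => by simpa using h hi).eq_of_src _ _
  | j :: l, s, ⟨i, hi, hl⟩ => by
    simp only [List.mem_cons, not_or] at hl
    exact isZero_evalQ_cone k s j _ (isZero_evalQ_dualizing_of_not_subset l s ⟨i, hi, hl.2⟩)
      (isZero_evalQ_dualizing_of_not_subset l _ ⟨i, Finset.mem_erase.2 ⟨hl.1, hi⟩, hl.2⟩)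

/-- If `j ∉ s`, the cone of `G(s \ {j}) ⟶ G(s)` is the cone of an isomorphism. -/
lemma isZero_evalQ_dualizing_of_notMem : (l : List κ) → (s : Finset κ) →
    (∃ i ∈ l, i ∉ s) → IsZero ((evalQ k s).obj (dualizing k κ J l))
  | [], s, ⟨i, hi, _⟩ => by simp at hi
  | j :: l, s, ⟨i, hl, hi⟩ => by
    by_cases h : j ∈ s
    · have hl' : i ∈ l := (List.mem_cons.1 hl).resolve_left (by rintro rfl; exact hi h)
      exact isZero_evalQ_cone k s j _ (isZero_evalQ_dualizing_of_notMem l s ⟨i, hl', hi⟩)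
        (isZero_evalQ_dualizing_of_notMem l _ ⟨i, hl', fun h' => hi (Finset.mem_of_mem_erase h')⟩)
    · exact isZero_evalQ_cone_of_notMem k s j h _

/-- At the set of all members of `l`, each cone is a shift of its source, because its target is
acyclic. -/
lemma nonempty_evalQ_dualizing_iso : (l : List κ) → l.Nodup →
    Nonempty ((evalQ k l.toFinset).obj (dualizing k κ J l) ≅
      (DerivedCategory.Q.obj J)⟦(l.length : ℤ)⟧)
  | [], _ => ⟨DerivedCategory.Q.mapIso
      (((NatIso.mapHomologicalComplex (directImageEvalIso k ∅) (ComplexShape.up ℤ)).app J) ≪≫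
        (HomologicalComplex.Hom.isoOfComponents (fun _ => Iso.refl _)
          (fun _ _ _ => (Category.id_comp _).trans (Category.comp_id _).symm) :
          ((𝟭 _ : ModuleCat.{u} k ⥤ _).mapHomologicalComplex (ComplexShape.up ℤ)).obj J ≅ J)) ≪≫
      ((shiftFunctorZero _ ℤ).app _).symm⟩
  | i :: l, h => by
    obtain ⟨hi, hl⟩ := List.nodup_cons.1 h
    obtain ⟨e⟩ := nonempty_evalQ_dualizing_iso l hl
    have hi' : i ∉ l.toFinset := by simpa using hi
    have hs : ((i :: l).toFinset).erase i = l.toFinset := by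
      rw [List.toFinset_cons, Finset.erase_insert hi']
    obtain ⟨e'⟩ := nonempty_evalQ_cone_iso k (i :: l).toFinset i (dualizing k κ J l)
      (isZero_evalQ_dualizing_of_not_subset k J l _ ⟨i, by simp, hi⟩)
    rw [hs] at e'
    refine ⟨e' ≪≫ (CategoryTheory.shiftFunctor _ (1 : ℤ)).mapIso e ≪≫
      ((CategoryTheory.shiftFunctorAdd' _ (l.length : ℤ) 1 ((i :: l).length : ℤ) (by simp)).app _).symm⟩

end
end

/-! ### Homology and exact functors -/

/-- An exact functor commutes with homology. -/
def mapHomologyIso {C D : Type*} [Category C] [Category D] [Abelian C] [Abelian D] (F : C ⥤ D)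
    [F.Additive] [PreservesFiniteLimits F] [PreservesFiniteColimits F] (m : ℤ) :
    F.mapHomologicalComplex (ComplexShape.up ℤ) ⋙ HomologicalComplex.homologyFunctor D _ m ≅
      HomologicalComplex.homologyFunctor C _ m ⋙ F :=
  Functor.isoWhiskerLeft _ (HomologicalComplex.homologyFunctorIso D (ComplexShape.up ℤ) m) ≪≫
    Functor.isoWhiskerLeft (HomologicalComplex.shortComplexFunctor C (ComplexShape.up ℤ) m)
      (ShortComplex.homologyFunctorIso F) ≪≫
    Functor.isoWhiskerRight (HomologicalComplex.homologyFunctorIso C (ComplexShape.up ℤ) m).symm F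

/-- The homology of the image of a complex under an exact functor. -/
def mapHomologyQIso {C D : Type*} [Category C] [Category D] [Abelian C] [Abelian D] (F : C ⥤ D)
    [F.Additive] [PreservesFiniteLimits F] [PreservesFiniteColimits F]
    [HasDerivedCategory.{w₁} C] [HasDerivedCategory.{w₂} D] (m : ℤ) :
    F.mapHomologicalComplex (ComplexShape.up ℤ) ⋙ DerivedCategory.Q ⋙
        DerivedCategory.homologyFunctor D m ≅
      DerivedCategory.Q ⋙ DerivedCategory.homologyFunctor C m ⋙ F :=
  Functor.isoWhiskerLeft _ (DerivedCategory.homologyFunctorFactors D m) ≪≫ mapHomologyIso F m ≪≫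
    Functor.isoWhiskerRight (DerivedCategory.homologyFunctorFactors C m).symm F

/-- An exact functor commutes with homology, on derived categories. -/
def mapDerivedCategoryHomologyIso {C D : Type*} [Category C] [Category D] [Abelian C] [Abelian D]
    (F : C ⥤ D) [F.Additive] [PreservesFiniteLimits F] [PreservesFiniteColimits F]
    [HasDerivedCategory.{w₁} C] [HasDerivedCategory.{w₂} D] (m : ℤ) :
    F.mapDerivedCategory ⋙ DerivedCategory.homologyFunctor D m ≅
      DerivedCategory.homologyFunctor C m ⋙ F :=
  Localization.liftNatIso DerivedCategory.Q
    (HomologicalComplex.quasiIso C (ComplexShape.up ℤ))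
    (DerivedCategory.Q ⋙ F.mapDerivedCategory ⋙ DerivedCategory.homologyFunctor D m)
    (DerivedCategory.Q ⋙ DerivedCategory.homologyFunctor C m ⋙ F) _ _
    (Functor.isoWhiskerRight F.mapDerivedCategoryFactors (DerivedCategory.homologyFunctor D m) ≪≫
      mapHomologyQIso F m)

/-- An isomorphism of functors on the derived category of complexes can be checked on complexes. -/
def liftQOpIso {C D : Type*} [Category C] [Category D] [Abelian C] [HasDerivedCategory.{w₁} C]
    {F G : (DerivedCategory C)ᵒᵖ ⥤ D}
    (e : (DerivedCategory.Q : CochainComplex C ℤ ⥤ _).op ⋙ F ≅ DerivedCategory.Q.op ⋙ G) :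
    F ≅ G :=
  Localization.liftNatIso DerivedCategory.Q.op
    (HomologicalComplex.quasiIso C (ComplexShape.up ℤ)).op _ _ F G e

/-- An injective resolution of `G` is isomorphic to `G` in the derived category. -/
def injResIso {C : Type*} [Category.{u} C] [Abelian C] [EnoughInjectives C]
    [HasDerivedCategory.{w₁} C] (G : C) :
    (DerivedCategory.singleFunctor C 0).obj G ≅ DerivedCategory.Q.obj (injRes G) :=
  have : QuasiIso (injectiveResolution G).ι' := inferInstance
  (DerivedCategory.singleFunctorIsoCompQ C 0).app G ≪≫
    (asIso (DerivedCategory.Q.map (injectiveResolution G).ι') :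
      DerivedCategory.Q.obj ((CochainComplex.singleFunctor C 0).obj G) ≅
        DerivedCategory.Q.obj (injectiveResolution G).cochainComplex)

/-- A morphism in the derived category to a K-injective complex is represented by a morphism of
complexes. -/
lemma exists_Q_map_eq {C : Type*} [Category.{u} C] [Abelian C] [HasDerivedCategory.{w₁} C]
    {K L : CochainComplex C ℤ} [L.IsKInjective]
    (f : DerivedCategory.Q.obj K ⟶ DerivedCategory.Q.obj L) :
    ∃ g : K ⟶ L, DerivedCategory.Q.map g = f := by
  obtain ⟨g, hg⟩ := (CochainComplex.IsKInjective.Qh_map_bijective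
    ((HomotopyCategory.quotient C (ComplexShape.up ℤ)).obj K) L).2
    ((DerivedCategory.quotientCompQhIso C).hom.app K ≫ f ≫
      (DerivedCategory.quotientCompQhIso C).inv.app L)
  obtain ⟨g, rfl⟩ := (HomotopyCategory.quotient C (ComplexShape.up ℤ)).map_surjective g
  refine ⟨g, ?_⟩
  have h := (DerivedCategory.quotientCompQhIso C).hom.naturality g
  rw [← cancel_epi ((DerivedCategory.quotientCompQhIso C).hom.app K), ← h]
  refine (congrArg (· ≫ _) hg).trans ?_
  simp

/-- Up to isomorphism, the functor `Hom(-, L)` with values in the derived category depends only on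
the class of the K-injective complex `L` in the derived category. -/
lemma nonempty_homCxFunctor_iso {C : Type*} [Category.{u} C] [Abelian C] (k : Type u) [CommRing k]
    [Linear k C] [HasDerivedCategory.{w₁} C] [HasDerivedCategory.{w₂} (ModuleCat.{u} k)]
    {L L' : CochainComplex C ℤ} [L.IsKInjective] [L'.IsKInjective]
    (e : DerivedCategory.Q.obj L ≅ DerivedCategory.Q.obj L') :
    Nonempty (homCxFunctor k L ⋙ DerivedCategory.Q ≅ homCxFunctor k L' ⋙ DerivedCategory.Q) := by
  obtain ⟨g, hg⟩ := exists_Q_map_eq e.hom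
  have : QuasiIso g := by
    rw [← DerivedCategory.isIso_Q_map_iff_quasiIso, hg]
    infer_instance
  have (K : (CochainComplex C ℤ)ᵒᵖ) : IsIso ((Functor.whiskerRight (homCxPostcomp k g)
      (DerivedCategory.Q : _ ⥤ DerivedCategory (ModuleCat.{u} k))).app K) := by
    have := homCxPostcomp_quasiIso k g K
    exact inferInstanceAs (IsIso (DerivedCategory.Q.map ((homCxPostcomp k g).app K)))
  have := NatIso.isIso_of_isIso_app (Functor.whiskerRight (homCxPostcomp k g)
      (DerivedCategory.Q : _ ⥤ DerivedCategory (ModuleCat.{u} k)))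
  exact ⟨asIso (Functor.whiskerRight (homCxPostcomp k g) DerivedCategory.Q)⟩

/-! ### The dualizing complex -/

section

variable (k : Type u) [CommRing k] {κ : Type u} [Fintype κ]

/-- A diagram supported at the largest subset is determined by its value there. -/
lemma nonempty_iso_of_support {F G : PosetMod k κ} (hF : ∀ s, s ≠ Finset.univ → IsZero (F.obj s))
    (hG : ∀ s, s ≠ Finset.univ → IsZero (G.obj s))
    (e : F.obj Finset.univ ≅ G.obj Finset.univ) : Nonempty (F ≅ G) := by
  classical
  refine ⟨NatIso.ofComponents (fun s => if h : s = Finset.univ then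
    eqToIso (by rw [h]) ≪≫ e ≪≫ eqToIso (by rw [h]) else (hF s h).iso (hG s h)) ?_⟩
  intro s t f
  by_cases h : s = Finset.univ
  · subst h
    obtain rfl : t = Finset.univ := Finset.univ_subset_iff.1 (leOfHom f)
    obtain rfl : f = 𝟙 _ := Subsingleton.elim _ _
    simp
  · exact (hF s h).eq_of_src _ _

variable [DecidableEq κ] [HasDerivedCategory.{w₁} (PosetMod k κ)]
    [HasDerivedCategory.{w₂} (ModuleCat.{u} k)]

/-- The dualizing complex is the diagram `k` supported at the largest subset, up to a shift. -/
lemma nonempty_dualizing_iso (l : List κ) (hl : l.Nodup) (hl' : ∀ i, i ∈ l) (F : PosetMod k κ)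
    (hF : ∀ s, s ≠ Finset.univ → IsZero (F.obj s))
    (e : F.obj Finset.univ ≅ ModuleCat.of k k) :
    Nonempty (DerivedCategory.Q.obj (dualizing k κ (injRes (ModuleCat.of k k)) l) ≅
      (DerivedCategory.singleFunctor _ (-(l.length : ℤ))).obj F) := by
  have huniv : l.toFinset = Finset.univ := by ext; simp [hl']
  set 𝒥 := dualizing k κ (injRes (ModuleCat.of k k)) l
  let H (m : ℤ) (s : Finset κ) : (DerivedCategory.homologyFunctor _ m).obj ((evalQ k s).obj 𝒥) ≅
      ((DerivedCategory.homologyFunctor _ m).obj (DerivedCategory.Q.obj 𝒥)).obj s :=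
    (mapHomologyQIso (evalAt k s) m).app 𝒥
  obtain ⟨e₁⟩ := nonempty_evalQ_dualizing_iso k (injRes (ModuleCat.of k k)) l hl
  rw [huniv] at e₁
  have hzero (s : Finset κ) (hs : s ≠ Finset.univ) : IsZero ((evalQ k s).obj 𝒥) := by
    obtain ⟨i, hi⟩ : ∃ i, i ∉ s := by
      by_contra! h
      exact hs (Finset.eq_univ_of_forall h)
    exact isZero_evalQ_dualizing_of_notMem k _ l s ⟨i, hl' i, hi⟩
  have hz (m : ℤ) (s : Finset κ) (hs : s ≠ Finset.univ) :
      IsZero (((DerivedCategory.homologyFunctor _ m).obj (DerivedCategory.Q.obj 𝒥)).obj s) :=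
    IsZero.of_iso ((DerivedCategory.homologyFunctor _ m).map_isZero (hzero s hs)) (H m s).symm
  let e₂ : (evalQ k Finset.univ).obj 𝒥 ≅
      (DerivedCategory.singleFunctor _ (-(l.length : ℤ))).obj (ModuleCat.of k k) :=
    e₁ ≪≫ (CategoryTheory.shiftFunctor _ _).mapIso (injResIso (ModuleCat.of k k)).symm ≪≫
      ((DerivedCategory.singleFunctors (ModuleCat.{u} k)).shiftIso (l.length : ℤ)
        (-(l.length : ℤ)) 0 (by lia)).app _
  have hdeg (m : ℤ) (hm : m ≠ -(l.length : ℤ)) :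
      IsZero ((DerivedCategory.homologyFunctor _ m).obj (DerivedCategory.Q.obj 𝒥)) := by
    refine (Functor.isZero_iff _).2 fun s => ?_
    by_cases hs : s = Finset.univ
    · subst hs
      refine IsZero.of_iso ?_ ((H m _).symm ≪≫ (DerivedCategory.homologyFunctor _ m).mapIso e₂)
      rcases lt_or_gt_of_ne hm with h | h
      · exact DerivedCategory.isZero_of_isGE _ (-(l.length : ℤ)) m h
      · exact DerivedCategory.isZero_of_isLE _ (-(l.length : ℤ)) m h
    · exact hz m s hs
  have : (DerivedCategory.Q.obj 𝒥).IsGE (-(l.length : ℤ)) :=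
    (DerivedCategory.isGE_iff _ _).2 fun m hm => hdeg m hm.ne
  have : (DerivedCategory.Q.obj 𝒥).IsLE (-(l.length : ℤ)) :=
    (DerivedCategory.isLE_iff _ _).2 fun m hm => hdeg m hm.ne'
  obtain ⟨Y, ⟨eY⟩⟩ := DerivedCategory.exists_iso_singleFunctor_obj_of_isGE_of_isLE
    (DerivedCategory.Q.obj 𝒥) (-(l.length : ℤ))
  let e₃ : (DerivedCategory.homologyFunctor _ (-(l.length : ℤ))).obj (DerivedCategory.Q.obj 𝒥) ≅
      Y := (DerivedCategory.homologyFunctor _ _).mapIso eY ≪≫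
        (DerivedCategory.singleFunctorCompHomologyFunctorIso _ _).app Y
  obtain ⟨e₄⟩ := nonempty_iso_of_support k (F := Y) (G := F)
    (fun s hs => IsZero.of_iso (hz _ s hs) (e₃.symm.app s)) hF
    (e₃.symm.app _ ≪≫ (H _ _).symm ≪≫ (DerivedCategory.homologyFunctor _ _).mapIso e₂ ≪≫
      (DerivedCategory.singleFunctorCompHomologyFunctorIso _ _).app _ ≪≫ e.symm)
  exact ⟨eY ≪≫ (DerivedCategory.singleFunctor _ _).mapIso e₄⟩

/-- The functor `F ↦ E(F)(∅)` on complexes, for the iterated cocone construction `E`. -/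
abbrev localCx (l : List κ) :
    CochainComplex (PosetMod k κ) ℤ ⥤ CochainComplex (ModuleCat.{u} k) ℤ :=
  iterCocone (insertPullback k) (insertUnit k) l ⋙ (evalAt k ∅).mapHomologicalComplex _

/-- The isomorphism of complexes `Hom(E(F)(∅), J) ≅ Hom(F, 𝒥)`. -/
def homCxLocalCx (l : List κ) (J : CochainComplex (ModuleCat.{u} k) ℤ) :
    (localCx k l).op ⋙ homCxFunctor k J ≅ homCxFunctor k (dualizing k κ J l) :=
  Functor.isoWhiskerLeft (iterCocone (insertPullback k) (insertUnit k) l).op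
    (homCxAdj k (evalDirectImageAdj k ∅) J) ≪≫
    homCxIterCone (insertUnit k) k (insertEraseAdj k) _ l

instance dualizing_isKInjective (l : List κ) (J : CochainComplex (ModuleCat.{u} k) ℤ)
    [J.IsStrictlyGE 0] [∀ n, Injective (J.X n)] : (dualizing k κ J l).IsKInjective := by
  have (n : ℤ) : Injective ((((directImage k (∅ : Finset κ)).mapHomologicalComplex _).obj J).X n) :=
    Injective.injective_of_adjoint (evalDirectImageAdj k ∅) (J.X n)
  exact iterCone_isKInjective _ _ _ (erasePullback_injective k) l

/-- Duality for diagrams: `Hom(F, I)` is the dual of the complex `E(F)(∅)`, shifted, for a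
K-injective resolution `I` of the diagram `k` supported at the largest subset. -/
lemma nonempty_homCx_iso_localCx (l : List κ) (hl : l.Nodup) (hl' : ∀ i, i ∈ l)
    (F : PosetMod k κ) (hF : ∀ s, s ≠ Finset.univ → IsZero (F.obj s))
    (e : F.obj Finset.univ ≅ ModuleCat.of k k) (I : CochainComplex (PosetMod k κ) ℤ)
    [I.IsKInjective] (eI : DerivedCategory.Q.obj I ≅ (DerivedCategory.singleFunctor _ 0).obj F) :
    Nonempty (homCxFunctor k I ⋙ DerivedCategory.Q ≅
      (localCx k l).op ⋙ homCxFunctor k (injRes (ModuleCat.of k k)) ⋙ DerivedCategory.Q ⋙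
        CategoryTheory.shiftFunctor _ (-(l.length : ℤ))) := by
  obtain ⟨e₁⟩ := nonempty_dualizing_iso k l hl hl' F hF e
  let 𝒥 := dualizing k κ (injRes (ModuleCat.of k k)) l
  have h𝒥 : 𝒥.IsKInjective := inferInstance
  let e₂ : DerivedCategory.Q.obj I ≅ DerivedCategory.Q.obj (𝒥⟦-(l.length : ℤ)⟧) :=
    eI ≪≫ (((DerivedCategory.singleFunctors (PosetMod k κ)).shiftIso (-(l.length : ℤ)) 0
        (-(l.length : ℤ)) (by lia)).app F).symm ≪≫
      (CategoryTheory.shiftFunctor _ _).mapIso e₁.symm ≪≫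
      (DerivedCategory.Q.commShiftIso (-(l.length : ℤ))).symm.app 𝒥
  obtain ⟨e₃⟩ := nonempty_homCxFunctor_iso k e₂
  exact ⟨e₃ ≪≫ Functor.isoWhiskerRight (homCxShift k 𝒥 (-(l.length : ℤ))).symm
      DerivedCategory.Q ≪≫
    Functor.isoWhiskerRight
      (Functor.isoWhiskerRight (homCxLocalCx k l (injRes (ModuleCat.of k k))).symm
        (CategoryTheory.shiftFunctor _ (-(l.length : ℤ)))) DerivedCategory.Q ≪≫
    Functor.isoWhiskerLeft ((localCx k l).op ⋙ homCxFunctor k (injRes (ModuleCat.of k k)))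
      (DerivedCategory.Q.commShiftIso (-(l.length : ℤ)))⟩

end

/-! ### Right derived functors from acyclic resolutions -/

section

variable {C H : Type*} [Category C] [Abelian C] [Category H] [HasDerivedCategory.{w₁} C]
  {F : CochainComplex C ℤ ⥤ H} (RF : DerivedCategory C ⥤ H) (β : F ⟶ DerivedCategory.Q ⋙ RF)

/-- The value of the universal extension of `γ` at a complex on which `β` is an isomorphism. -/
def derivedDescAux {G : DerivedCategory C ⥤ H} (γ : F ⟶ DerivedCategory.Q ⋙ G)
    (R : CochainComplex C ℤ) (hR : IsIso (β.app R)) :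
    RF.obj (DerivedCategory.Q.obj R) ⟶ G.obj (DerivedCategory.Q.obj R) :=
  inv (β.app R) ≫ γ.app R

lemma comp_derivedDescAux {G : DerivedCategory C ⥤ H} (γ : F ⟶ DerivedCategory.Q ⋙ G)
    (R : CochainComplex C ℤ) (hR : IsIso (β.app R)) :
    β.app R ≫ derivedDescAux RF β γ R hR = γ.app R :=
  IsIso.hom_inv_id_assoc (β.app R) (γ.app R)

lemma map_comp_derivedDescAux {G : DerivedCategory C ⥤ H} (γ : F ⟶ DerivedCategory.Q ⋙ G)
    {R R' : CochainComplex C ℤ} (hR : IsIso (β.app R)) (hR' : IsIso (β.app R')) (f : R ⟶ R') :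
    RF.map (DerivedCategory.Q.map f) ≫ derivedDescAux RF β γ R' hR' =
      derivedDescAux RF β γ R hR ≫ G.map (DerivedCategory.Q.map f) := by
  rw [← cancel_epi (β.app R)]
  have h₁ := β.naturality f
  have h₂ := γ.naturality f
  dsimp only [Functor.comp_obj, Functor.comp_map] at h₁ h₂ ⊢
  rw [← Category.assoc, ← Category.assoc, ← h₁, comp_derivedDescAux, ← h₂, Category.assoc,
    comp_derivedDescAux]

variable (h : ∀ K : CochainComplex C ℤ, ∃ (R : CochainComplex C ℤ) (s : K ⟶ R),
  QuasiIso s ∧ IsIso (β.app R))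

include h

lemma derived_map_comp_derivedDescAux {G : DerivedCategory C ⥤ H}
    (γ : F ⟶ DerivedCategory.Q ⋙ G) {R R' : CochainComplex C ℤ} (hR : IsIso (β.app R))
    (hR' : IsIso (β.app R')) (ψ : DerivedCategory.Q.obj R ⟶ DerivedCategory.Q.obj R') :
    RF.map ψ ≫ derivedDescAux RF β γ R' hR' = derivedDescAux RF β γ R hR ≫ G.map ψ := by
  obtain ⟨Y, g, t, ht, rfl⟩ := DerivedCategory.left_fac ψ
  obtain ⟨R'', s, hs, hR''⟩ := h Y
  have hst : IsIso (DerivedCategory.Q.map (t ≫ s)) := by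
    rw [Functor.map_comp]
    infer_instance
  have e : DerivedCategory.Q.map g ≫ inv (DerivedCategory.Q.map t) =
      DerivedCategory.Q.map (g ≫ s) ≫ inv (DerivedCategory.Q.map (t ≫ s)) := by
    rw [IsIso.eq_comp_inv, Functor.map_comp, Functor.map_comp, Category.assoc,
      IsIso.inv_hom_id_assoc]
  have h₁ := map_comp_derivedDescAux RF β γ hR hR'' (g ≫ s)
  have h₂ := map_comp_derivedDescAux RF β γ hR' hR'' (t ≫ s)
  rw [e, RF.map_comp, G.map_comp, Functor.map_inv, Functor.map_inv, ← Category.assoc (f :=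
    derivedDescAux RF β γ R hR), IsIso.eq_comp_inv, ← h₁, Category.assoc, Category.assoc, ← h₂,
    IsIso.inv_hom_id_assoc]

lemma exists_resolution_iso (X : DerivedCategory C) :
    ∃ (R : CochainComplex C ℤ) (_ : IsIso (β.app R)), Nonempty (DerivedCategory.Q.obj R ≅ X) := by
  obtain ⟨R, s, hs, hR⟩ := h (DerivedCategory.Q.objPreimage X)
  exact ⟨R, hR, ⟨(asIso (DerivedCategory.Q.map s)).symm ≪≫ DerivedCategory.Q.objObjPreimageIso X⟩⟩

lemma exists_derivedDesc {G : DerivedCategory C ⥤ H} (γ : F ⟶ DerivedCategory.Q ⋙ G) :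
    ∃ δ : RF ⟶ G, ∀ K, β.app K ≫ δ.app (DerivedCategory.Q.obj K) = γ.app K := by
  choose R hR e using exists_resolution_iso RF β h
  let e' (X : DerivedCategory C) := (e X).some
  have key {R R' : CochainComplex C ℤ} (hR : IsIso (β.app R)) (hR' : IsIso (β.app R'))
      (ψ : DerivedCategory.Q.obj R ⟶ DerivedCategory.Q.obj R') :=
    derived_map_comp_derivedDescAux RF β h γ hR hR' ψ
  refine ⟨{ app X := RF.map (e' X).inv ≫ derivedDescAux RF β γ (R X) (hR X) ≫ G.map (e' X).hom,
            naturality X X' f := ?_ }, fun K => ?_⟩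
  · have h := key (hR X) (hR X') ((e' X).hom ≫ f ≫ (e' X').inv)
    have h' := congrArg (fun t => RF.map (e' X).inv ≫ t ≫ G.map (e' X').hom) h
    simpa [← Functor.map_comp, ← Functor.map_comp_assoc] using h'
  · obtain ⟨R', s, hs, hR'⟩ := h K
    have h₁ := key (hR (DerivedCategory.Q.obj K)) hR'
      ((e' (DerivedCategory.Q.obj K)).hom ≫ DerivedCategory.Q.map s)
    have h₂ : β.app K ≫ RF.map (DerivedCategory.Q.map s) = F.map s ≫ β.app R' :=
      (β.naturality s).symm
    have h₃ : F.map s ≫ γ.app R' = γ.app K ≫ G.map (DerivedCategory.Q.map s) :=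
      γ.naturality s
    have h₄ : (RF.map (e' (DerivedCategory.Q.obj K)).inv ≫
        derivedDescAux RF β γ (R (DerivedCategory.Q.obj K)) (hR _) ≫
          G.map (e' (DerivedCategory.Q.obj K)).hom) ≫ G.map (DerivedCategory.Q.map s) =
        RF.map (DerivedCategory.Q.map s) ≫ derivedDescAux RF β γ R' hR' := by
      rw [Category.assoc, Category.assoc, ← Functor.map_comp, ← h₁, ← Functor.map_comp_assoc,
        Iso.inv_hom_id_assoc]
    refine (cancel_mono (G.map (DerivedCategory.Q.map s))).1 ?_
    refine Eq.trans ?_ h₃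
    refine (Category.assoc _ _ _).trans ((congrArg (fun t => β.app K ≫ t) h₄).trans ?_)
    rw [← Category.assoc, h₂, Category.assoc]
    exact congrArg (fun t => F.map s ≫ t) (comp_derivedDescAux RF β γ R' hR')

lemma derivedDesc_ext {G : DerivedCategory C ⥤ H} (δ δ' : RF ⟶ G)
    (hδ : ∀ K, β.app K ≫ δ.app (DerivedCategory.Q.obj K) =
      β.app K ≫ δ'.app (DerivedCategory.Q.obj K)) : δ = δ' := by
  ext X
  obtain ⟨R, hR, ⟨e⟩⟩ := exists_resolution_iso RF β h X
  have h₂ : δ.app (DerivedCategory.Q.obj R) = δ'.app (DerivedCategory.Q.obj R) :=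
    (cancel_epi (β.app R)).1 (hδ R)
  rw [← cancel_epi (RF.map e.hom), δ.naturality, δ'.naturality, h₂]

/-- If every complex is quasi-isomorphic to a complex on which `β : F ⟶ RF` is an isomorphism,
then `RF` is the right derived functor of `F`. -/
lemma isRightDerivedFunctor_of_resolutions :
    RF.IsRightDerivedFunctor β (HomologicalComplex.quasiIso C (ComplexShape.up ℤ)) := by
  choose δ hδ using fun (G : DerivedCategory C ⥤ H) (γ : F ⟶ DerivedCategory.Q ⋙ G) =>
    exists_derivedDesc RF β h γ
  refine ⟨⟨⟨IsInitial.ofUniqueHom (fun Y => StructuredArrow.homMk (δ Y.right Y.hom)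
    (NatTrans.ext (funext (hδ Y.right Y.hom)))) fun Y m => ?_⟩⟩⟩
  refine StructuredArrow.hom_ext _ _ (derivedDesc_ext RF β h m.right _ fun K => ?_)
  exact (NatTrans.congr_app (StructuredArrow.w m) K).trans (hδ Y.right Y.hom K).symm

end

section

variable {C H : Type*} [Category C] [Abelian C] [Category H] [HasDerivedCategory.{w₁} C]
  {F Č : CochainComplex C ℤ ⥤ H} (α : F ⟶ Č)
  (hČ : (HomologicalComplex.quasiIso C (ComplexShape.up ℤ)).IsInvertedBy Č)
  (h : ∀ K : CochainComplex C ℤ, ∃ (R : CochainComplex C ℤ) (s : K ⟶ R),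
    QuasiIso s ∧ IsIso (α.app R))

include h hČ in
/-- If every complex is quasi-isomorphic to a complex on which `α : F ⟶ Č` is an isomorphism, and
`Č` inverts quasi-isomorphisms, then `F` has a right derived functor, which is induced
by `Č`. -/
lemma hasRightDerivedFunctor_of_resolutions :
    ∃ _ : F.HasRightDerivedFunctor (HomologicalComplex.quasiIso C (ComplexShape.up ℤ)),
      Nonempty (DerivedCategory.Q ⋙ F.totalRightDerived DerivedCategory.Q
        (HomologicalComplex.quasiIso C (ComplexShape.up ℤ)) ≅ Č) := by
  let RF : DerivedCategory C ⥤ H := Localization.lift Č hČ DerivedCategory.Q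
  let eF : DerivedCategory.Q ⋙ RF ≅ Č := Localization.fac Č hČ DerivedCategory.Q
  let β : F ⟶ DerivedCategory.Q ⋙ RF := α ≫ eF.inv
  have : RF.IsRightDerivedFunctor β (HomologicalComplex.quasiIso C (ComplexShape.up ℤ)) :=
    isRightDerivedFunctor_of_resolutions RF β fun K => by
      obtain ⟨R, s, hs, hR⟩ := h K
      exact ⟨R, s, hs, inferInstanceAs (IsIso (α.app R ≫ eF.inv.app R))⟩
  have hF : F.HasRightDerivedFunctor (HomologicalComplex.quasiIso C (ComplexShape.up ℤ)) :=
    Functor.HasRightDerivedFunctor.mk' RF β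
  exact ⟨hF, ⟨Functor.isoWhiskerLeft DerivedCategory.Q (Functor.rightDerivedUnique
    (F.totalRightDerived DerivedCategory.Q (HomologicalComplex.quasiIso C (ComplexShape.up ℤ))) RF
    (F.totalRightDerivedUnit DerivedCategory.Q _) β
    (HomologicalComplex.quasiIso C (ComplexShape.up ℤ))) ≪≫ eF⟩⟩

end

/-! ### Resolutions by direct images -/

/-- A complex `K` is quasi-isomorphic to the cocone of the inclusion `L ⟶ cone(K ⟶ L)`. -/
lemma exists_quasiIso_mappingCocone_inr {C : Type*} [Category C] [Abelian C]
    {K L : CochainComplex C ℤ} (φ : K ⟶ L) :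
    ∃ f : K ⟶ mappingCocone (mappingCone.inr φ), QuasiIso f := by
  let e := mappingCone.rotateHomotopyEquiv φ
  have : QuasiIso e.hom := inferInstance
  have h₁ : QuasiIso (e.hom⟦(-1 : ℤ)⟧') := inferInstance
  have h₂ : QuasiIso ((shiftFunctorCompIsoId (CochainComplex C ℤ) (1 : ℤ) (-1)
    (add_neg_cancel 1)).inv.app K) := inferInstance
  exact ⟨(shiftFunctorCompIsoId (CochainComplex C ℤ) (1 : ℤ) (-1)
    (add_neg_cancel 1)).inv.app K ≫ e.hom⟦(-1 : ℤ)⟧', quasiIso_comp (hφ := h₂) (hφ' := h₁)⟩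

section

variable (k : Type u) [CommRing k] {κ : Type u} [HasDerivedCategory.{w₂} (ModuleCat.{u} k)]

lemma acyclic_of_evalQ (K : CochainComplex (PosetMod k κ) ℤ)
    (h : ∀ s, IsZero ((evalQ k s).obj K)) : K.Acyclic := by
  intro m
  rw [HomologicalComplex.exactAt_iff_isZero_homology, Functor.isZero_iff]
  intro s
  have h' := ((isZero_Q_obj_iff _).1 (h s)) m
  rw [HomologicalComplex.exactAt_iff_isZero_homology] at h'
  exact IsZero.of_iso h' ((mapHomologyIso (evalAt k s) m).app K).symm

/-- The functor `F ↦ i_{r*}(F(r))`. -/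
abbrev evalDirectImage (r : Finset κ) : PosetMod k κ ⥤ PosetMod k κ :=
  evalAt k r ⋙ directImage k r

lemma isZero_evalQ_mappingCone (s : Finset κ) {K L : CochainComplex (PosetMod k κ) ℤ} (φ : K ⟶ L)
    (h : QuasiIso (((evalAt k s).mapHomologicalComplex _).map φ)) :
    IsZero ((evalQ k s).obj (mappingCone φ)) :=
  IsZero.of_iso ((isZero_Q_mappingCone_iff _).2 h)
    (DerivedCategory.Q.mapIso (mappingCone.mapHomologicalComplexIso φ (evalAt k s)))

/-- The cone of `K ⟶ i_{r*}(K(r))` is acyclic at `r`, and at the subsets that are not contained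
in `r` and where `K` is acyclic. -/
lemma isZero_evalQ_mappingCone_unit (r s : Finset κ) (K : CochainComplex (PosetMod k κ) ℤ)
    (h : s = r ∨ (¬ s ⊆ r ∧ IsZero ((evalQ k s).obj K))) :
    IsZero ((evalQ k s).obj
      (mappingCone (unitCx (evalDirectImage k r) (evalDirectImageAdj k r).unit K))) := by
  refine isZero_evalQ_mappingCone k s _ ?_
  rcases h with rfl | ⟨hs, hK⟩
  · have (n : ℤ) : IsIso ((((evalAt k s).mapHomologicalComplex (ComplexShape.up ℤ)).map
      (unitCx (evalDirectImage k s) (evalDirectImageAdj k s).unit K)).f n) :=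
      isIso_evalAt_unit k s (K.X n)
    have := HomologicalComplex.Hom.isIso_of_components
      (((evalAt k s).mapHomologicalComplex (ComplexShape.up ℤ)).map
        (unitCx (evalDirectImage k s) (evalDirectImageAdj k s).unit K))
    infer_instance
  · rw [← DerivedCategory.isIso_Q_map_iff_quasiIso]
    refine ⟨0, hK.eq_of_src _ _, IsZero.eq_of_src ?_ _ _⟩
    refine (isZero_Q_obj_iff _).2 (HomologicalComplex.acyclic_of_isZero _ ?_)
    rw [IsZero.iff_id_eq_zero]
    ext n : 1
    exact (isZero_directImage_obj k r _ s hs).eq_of_src _ _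

variable (P : PosetMod k κ → Prop) (h₀ : ∀ F, IsZero F → P F)
  (hsum : ∀ {F X Y : PosetMod k κ} (i₁ : X ⟶ F) (f₁ : F ⟶ X) (i₂ : Y ⟶ F) (f₂ : F ⟶ Y),
    f₁ ≫ i₁ + f₂ ≫ i₂ = 𝟙 F → P X → P Y → P F)
  (hP : ∀ r M, P ((directImage k r).obj M))

include h₀ hsum hP in
/-- A complex which is acyclic outside of a finite family `D` of subsets is quasi-isomorphic to a
complex whose terms are finite sums of direct images: for a maximal element `r` of `D`, the cone of
`K ⟶ i_{r*}(K(r))` is acyclic outside of `D \ {r}`. -/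
lemma exists_resolution_of_support (D : Finset (Finset κ)) :
    ∀ (_ : ∀ s ∈ D, ∀ t, t ⊆ s → t ∈ D) (K : CochainComplex (PosetMod k κ) ℤ)
    (_ : ∀ s, s ∉ D → IsZero ((evalQ k s).obj K)),
    ∃ (R : CochainComplex (PosetMod k κ) ℤ) (f : K ⟶ R), QuasiIso f ∧ ∀ n, P (R.X n) := by
  classical
  induction D using Finset.strongInduction with
  | H D ih =>
    intro hD K hK
    rcases D.eq_empty_or_nonempty with rfl | hne
    · refine ⟨HomologicalComplex.zero, 0, ⟨fun i => ?_⟩, fun n => h₀ _ ?_⟩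
      · rw [quasiIsoAt_iff_exactAt _ _ (acyclic_of_evalQ k K (fun s => hK s (by simp)) i)]
        exact HomologicalComplex.acyclic_of_isZero _ HomologicalComplex.isZero_zero i
      · exact (HomologicalComplex.eval _ (ComplexShape.up ℤ) n).map_isZero
          HomologicalComplex.isZero_zero
    · obtain ⟨r, hr⟩ := D.exists_maximal hne
      let φ := unitCx (evalDirectImage k r) (evalDirectImageAdj k r).unit K
      obtain ⟨R, ρ, hρ, hR⟩ := ih (D.erase r) (Finset.erase_ssubset hr.1)
        (fun s hs t hts => by
          obtain ⟨hs₁, hs₂⟩ := Finset.mem_erase.1 hs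
          refine Finset.mem_erase.2 ⟨?_, hD s hs₂ t hts⟩
          rintro rfl
          exact hs₁ (Finset.Subset.antisymm (hr.2 hs₂ hts) hts)) (mappingCone φ)
        (fun s hs => isZero_evalQ_mappingCone_unit k r s K (by
          by_cases h : s = r
          · exact Or.inl h
          · have hs' : s ∉ D := fun h' => hs (Finset.mem_erase.2 ⟨h, h'⟩)
            exact Or.inr ⟨fun h' => hs' (hD r hr.1 s h'), hK s hs'⟩))
      obtain ⟨f, hf⟩ := exists_quasiIso_mappingCocone_inr φ
      let g := mappingCoconeMap (mappingCone.inr φ) (mappingCone.inr φ ≫ ρ) (𝟙 _) ρ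
        (Category.id_comp _).symm
      have hg : QuasiIso g := mappingCoconeMap_quasiIso ..
      refine ⟨_, f ≫ g, inferInstance, fun n => ?_⟩
      exact hsum _ _ _ _ (mappingCocone.id_X (mappingCone.inr φ ≫ ρ) n (n - 1)
        (sub_eq_add_neg n 1).symm) (hP r _) (hR _)

include h₀ hsum hP in
/-- Every complex of diagrams on a finite poset of subsets is quasi-isomorphic to a complex whose
terms are finite sums of direct images. -/
lemma exists_resolution [Fintype κ] (K : CochainComplex (PosetMod k κ) ℤ) :
    ∃ (R : CochainComplex (PosetMod k κ) ℤ) (f : K ⟶ R), QuasiIso f ∧ ∀ n, P (R.X n) :=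
  exists_resolution_of_support k P h₀ hsum hP Finset.univ (by simp) K (by simp)

end

/-! ### Restriction to the subsets that contain a given subset -/

section

variable (k : Type u) [CommRing k] {ι : Type u} [DecidableEq ι] (p : Finset ι)

/-- The map `s ↦ p ∪ s`, from the finite subsets of the complement of `p` to the finite subsets
that contain `p`. -/
def unionFunctor : Finset {i // i ∉ p} ⥤ Finset ι :=
  Monotone.functor (f := fun s => p ∪ s.map (Function.Embedding.subtype _)) fun _ _ h =>
    Finset.union_subset_union_right (Finset.map_subset_map.2 h)

lemma unionFunctor_obj (s : Finset {i // i ∉ p}) :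
    (unionFunctor p).obj s = p ∪ s.map (Function.Embedding.subtype _) := rfl

/-- The restriction of diagrams to the subsets that contain `p`. -/
abbrev unionPullback : PosetMod k ι ⥤ PosetMod k {i // i ∉ p} :=
  (Functor.whiskeringLeft _ _ _).obj (unionFunctor p)

instance : (unionPullback k p).Additive where
instance : (unionPullback k p).Linear k where

lemma iterFlasque_directImage (l : List {i // i ∉ p}) (r : Finset ι) (M : ModuleCat.{u} k) :
    IterFlasque (insertPullback k) (insertUnit k) l
      ((unionPullback k p).obj ((directImage k r).obj M)) := by
  refine IterFlasque.of_isIso_or_isZero _ _ l fun i => ?_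
  by_cases hi : i.1 ∈ r
  · left
    have (s : Finset {i // i ∉ p}) : IsIso (((insertUnit k i).app
        ((unionPullback k p).obj ((directImage k r).obj M))).app s) := by
      refine isIso_directImage_map k r M _ fun h x hx => ?_
      rcases Finset.mem_union.1 hx with hx | hx
      · exact h (Finset.mem_union_left _ hx)
      · obtain ⟨y, hy, rfl⟩ := Finset.mem_map.1 hx
        rcases Finset.mem_insert.1 hy with rfl | hy
        · exact hi
        · exact h (Finset.mem_union_right _ (Finset.mem_map_of_mem _ hy))
    exact NatIso.isIso_of_isIso_app _
  · right
    refine (Functor.isZero_iff _).2 fun s => isZero_directImage_obj k r M _ fun h => hi ?_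
    exact h (Finset.mem_union_right _ (Finset.mem_map.2 ⟨i, Finset.mem_insert_self _ _, rfl⟩))

/-- Every complex of diagrams is quasi-isomorphic to a complex whose terms are iteratively
flasque. -/
lemma exists_iterFlasque_resolution [Fintype ι] (l : List {i // i ∉ p})
    (K : CochainComplex (PosetMod k ι) ℤ) :
    ∃ (R : CochainComplex (PosetMod k ι) ℤ) (f : K ⟶ R), QuasiIso f ∧
      ∀ n, IterFlasque (insertPullback k) (insertUnit k) l ((unionPullback k p).obj (R.X n)) := by
  let _ := HasDerivedCategory.standard (ModuleCat.{u} k)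
  refine exists_resolution k (fun F => IterFlasque (insertPullback k) (insertUnit k) l
    ((unionPullback k p).obj F)) (fun F hF => ?_) (fun i₁ f₁ i₂ f₂ h hX hY => ?_)
    (iterFlasque_directImage k p l) K
  · exact IterFlasque.of_isZero _ _ l ((unionPullback k p).map_isZero hF)
  · exact IterFlasque.of_sum _ _ l ((unionPullback k p).map i₁) ((unionPullback k p).map f₁)
      ((unionPullback k p).map i₂) ((unionPullback k p).map f₂)
      (congrArg (unionPullback k p).map h) hX hY

end

/-! ### Sheaves of modules as diagrams on a poset -/

section

open Opposite

variable {D : Type u} [Category.{u} D] (K : GrothendieckTopology D) {κ : Type u}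
  (G : (Finset κ)ᵒᵖ ⥤ D)

/-- If the objects `G(s)` have only the trivial covering, and cover all objects, then `G` is a
dense subsite for the trivial topology. -/
lemma isDenseSubsite_bot [G.Full] [G.Faithful] [G.IsCoverDense K]
    (h : ∀ s (S : Sieve (G.obj s)), S ∈ K (G.obj s) → S (𝟙 _)) :
    G.IsDenseSubsite ⊥ K where
  functorPushforward_mem_iff {s S} := by
    rw [GrothendieckTopology.bot_covering]
    refine ⟨fun hS => ?_, ?_⟩
    · obtain ⟨t, g, f, hg, e⟩ := h _ _ hS
      rw [← Sieve.id_mem_iff_eq_top]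
      have e' : 𝟙 s = G.preimage f ≫ g := G.map_injective (by simpa using e)
      rw [e']
      exact S.downward_closed hg _
    · rintro rfl
      rw [Sieve.functorPushforward_top]
      exact K.top_mem _

variable (k : Type u) [CommRing k]

/-- The diagram of the sections of a sheaf on the objects `G(s)`. -/
abbrev sectionsDiagram : Sheaf K (ModuleCat.{u} k) ⥤ PosetMod k κ :=
  sheafToPresheaf K _ ⋙ (Functor.whiskeringLeft _ _ _).obj G.rightOp

instance : (sectionsDiagram K G k).Additive where
instance : (sectionsDiagram K G k).Linear k where

lemma sectionsDiagram_isEquivalence [G.IsDenseSubsite ⊥ K] :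
    (sectionsDiagram K G k).IsEquivalence := by
  let E : Sheaf K (ModuleCat.{u} k) ⥤ PosetMod k κ :=
    G.sheafPushforwardContinuous (ModuleCat.{u} k) ⊥ K ⋙ (sheafBotEquivalence _).functor ⋙
      (Functor.whiskeringLeft _ _ _).obj (opOp (Finset κ))
  have : E.IsEquivalence := inferInstance
  exact Functor.isEquivalence_of_iso (F := E) (Iso.refl _)

end


/-! ### Hom complexes and fully faithful functors -/

section

variable {C D : Type*} [Category.{u} C] [Abelian C] [Category.{u} D] [Abelian D]
  (k : Type u) [CommRing k] [Linear k C] [Linear k D]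
  (Ψ : C ⥤ D) [Ψ.Additive] [Ψ.Linear k] [Ψ.Full] [Ψ.Faithful]

/-- A fully faithful functor induces isomorphisms of the modules of cochains. -/
def cochainMapEquiv (K L : CochainComplex C ℤ) (n : ℤ) : Cochain K L n ≃ₗ[k]
    Cochain ((Ψ.mapHomologicalComplex _).obj K) ((Ψ.mapHomologicalComplex _).obj L) n where
  toFun z := z.map Ψ
  map_add' z z' := Cochain.map_add z z' _
  map_smul' c z := by
    ext p q hpq
    exact Ψ.map_smul c (z.v p q hpq)
  invFun z := Cochain.mk fun p q hpq => Ψ.preimage (z.v p q hpq)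
  left_inv z := by
    ext p q hpq
    exact Ψ.preimage_map _
  right_inv z := by
    ext p q hpq
    exact Ψ.map_preimage _

/-- A fully faithful functor induces isomorphisms of the complexes `Hom(K, L)`. -/
def homCxFullyFaithful (L : CochainComplex C ℤ) :
    homCxFunctor k L ≅ (Ψ.mapHomologicalComplex (ComplexShape.up ℤ)).op ⋙
      homCxFunctor k ((Ψ.mapHomologicalComplex _).obj L) :=
  NatIso.ofComponents
    (fun K => HomologicalComplex.Hom.isoOfComponents
      (fun n => (cochainMapEquiv k Ψ K.unop L n).toModuleIso)
      (fun n m _ => ModuleCat.hom_ext (LinearMap.ext fun z => δ_map (n := n) m z Ψ)))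
    (fun {K K'} f => by
      ext n : 1
      refine ModuleCat.hom_ext (LinearMap.ext fun z => ?_)
      refine (Cochain.map_comp _ (Cochain.ofHom f.unop) z (zero_add n) Ψ).trans ?_
      rw [Cochain.map_ofHom]
      rfl)

end

/-! ### The iterated kernel as a submodule -/

section

variable {C : Type*} [Category.{u} C] [Abelian C] {ι : Type*} (T : ι → C ⥤ C)
  [∀ i, (T i).Additive] (η : ∀ i, 𝟭 C ⟶ T i)

/-- The inclusion of the iterated kernel. -/
def iterKernelι : (l : List ι) → (iterKernel T η l ⟶ 𝟭 C)
  | [] => 𝟙 _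
  | i :: l =>
    { app F := (iterKernelι l).app ((unitKernel (T i) (η i)).obj F) ≫ unitKernelι (T i) (η i) F
      naturality F G f := by
        refine ((iterKernelι l).naturality_assoc ((unitKernel (T i) (η i)).map f) _).trans ?_
        exact (congrArg (fun t => _ ≫ t) (unitKernelι_naturality (T i) (η i) f)).trans
          (Category.assoc _ _ _).symm }

instance mono_iterKernelι_app : (l : List ι) → (F : C) → Mono ((iterKernelι T η l).app F)
  | [], F => inferInstanceAs (Mono (𝟙 F))
  | i :: l, F =>
    have := mono_iterKernelι_app l
    inferInstanceAs (Mono ((iterKernelι T η l).app ((unitKernel (T i) (η i)).obj F) ≫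
      unitKernelι (T i) (η i) F))

end

section

variable (k : Type u) [CommRing k] {κ : Type u} [DecidableEq κ]

lemma exists_unitKernelι_iff (i : κ) (F : PosetMod k κ) (s : Finset κ) (x : F.obj s) :
    (∃ y, ((unitKernelι (insertPullback k i) (insertUnit k i) F).app s).hom y = x) ↔
      (F.map (homOfLE (Finset.subset_insert i s))).hom x = 0 := by
  constructor
  · rintro ⟨y, rfl⟩
    have h := congrArg (fun t => (evalAt k s).map t)
      (unitKernelι_comp (insertPullback k i) (insertUnit k i) F)
    exact ConcreteCategory.congr_hom h y
  · intro hx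
    have h := (ShortComplex.exact_kernel ((insertUnit k i).app F)).map (evalAt k s)
    rw [ShortComplex.moduleCat_exact_iff] at h
    exact h x hx

lemma exists_iterKernelι_iff : (l : List κ) → (F : PosetMod k κ) → (s : Finset κ) →
    (x : F.obj s) →
    ((∃ y, (((iterKernelι (insertPullback k) (insertUnit k) l).app F).app s).hom y = x) ↔
      ∀ i ∈ l, (F.map (homOfLE (Finset.subset_insert i s))).hom x = 0)
  | [], F, s, x => by
    simp only [List.not_mem_nil, false_imp_iff, implies_true, iff_true]
    exact ⟨x, rfl⟩
  | i :: l, F, s, x => by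
    have key (y) : (∃ z, (((iterKernelι (insertPullback k) (insertUnit k) l).app
        ((unitKernel (insertPullback k i) (insertUnit k i)).obj F)).app s).hom z = y) ↔
        ∀ j ∈ l, (F.map (homOfLE (Finset.subset_insert j s))).hom
          (((unitKernelι (insertPullback k i) (insertUnit k i) F).app s).hom y) = 0 := by
      refine (exists_iterKernelι_iff l _ s y).trans (forall₂_congr fun j _ => ?_)
      have h := ConcreteCategory.congr_hom ((unitKernelι (insertPullback k i)
        (insertUnit k i) F).naturality (homOfLE (Finset.subset_insert j s))) y
      have hinj : Function.Injective ((unitKernelι (insertPullback k i)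
          (insertUnit k i) F).app (insert j s)).hom :=
        (ModuleCat.mono_iff_injective _).1 inferInstance
      exact ((map_eq_zero_iff (ModuleCat.Hom.hom ((unitKernelι (insertPullback k i)
          (insertUnit k i) F).app (insert j s))) hinj).symm.trans (Eq.congr_left h))
    rw [List.forall_mem_cons, ← exists_unitKernelι_iff]
    constructor
    · rintro ⟨z, rfl⟩
      exact ⟨⟨_, rfl⟩, (key _).1 ⟨z, rfl⟩⟩
    · rintro ⟨⟨y, rfl⟩, h⟩
      obtain ⟨z, rfl⟩ := (key y).2 h
      exact ⟨z, rfl⟩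

/-- Two functors to modules with natural embeddings in a third one are isomorphic if the images
coincide. -/
lemma nonempty_iso_of_range_eq {C : Type*} [Category C] {A B E : C ⥤ ModuleCat.{u} k} (a : A ⟶ E)
    (b : B ⟶ E) (ha : ∀ X, Function.Injective (a.app X).hom)
    (hb : ∀ X, Function.Injective (b.app X).hom)
    (h : ∀ X (x : E.obj X), (∃ y, (a.app X).hom y = x) ↔ ∃ z, (b.app X).hom z = x) :
    Nonempty (A ≅ B) := by
  have hr (X : C) : LinearMap.range (a.app X).hom = LinearMap.range (b.app X).hom :=
    Submodule.ext (h X)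
  let e (X : C) : A.obj X ≃ₗ[k] B.obj X :=
    (LinearEquiv.ofInjective _ (ha X)).trans ((LinearEquiv.ofEq _ _ (hr X)).trans
      (LinearEquiv.ofInjective _ (hb X)).symm)
  have he (X : C) (y : A.obj X) : (b.app X).hom (e X y) = (a.app X).hom y :=
    congrArg Subtype.val ((LinearEquiv.ofInjective _ (hb X)).apply_symm_apply _)
  refine ⟨NatIso.ofComponents (fun X => (e X).toModuleIso) fun {X Y} f => ?_⟩
  refine ModuleCat.hom_ext (LinearMap.ext fun y => hb Y ?_)
  have h₁ := ConcreteCategory.congr_hom (a.naturality f) y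
  have h₂ := ConcreteCategory.congr_hom (b.naturality f) (e X y)
  refine (he Y _).trans (h₁.trans (Eq.trans ?_ h₂.symm))
  exact congrArg (E.map f).hom (he X y).symm

end


/-! ### Sheaves on the affine space as diagrams -/

section

open Opposite TopologicalSpace Topology

variable {n : ℕ}

/-- The subset of `{1, …, n}` which underlies a point of the affine space. -/
abbrev pointSet (p : AffF1.{u} n) : Finset (ULift.{u} (Fin n)) :=
  WithUpperSet.ofUpperSet (α := Finset (ULift.{u} (Fin n))) p

/-- The point of the affine space given by a subset of `{1, …, n}`. -/
abbrev setPoint (s : Finset (ULift.{u} (Fin n))) : AffF1.{u} n :=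
  WithUpperSet.toUpperSet s

lemma self_mem_minOpen (p : AffF1.{u} n) : p ∈ minOpen p := Finset.Subset.refl _

lemma minOpen_le_iff (p : AffF1.{u} n) (U : Opens (AffF1.{u} n)) : minOpen p ≤ U ↔ p ∈ U := by
  refine ⟨fun h => h (self_mem_minOpen p), fun h q hq => ?_⟩
  exact Topology.IsUpperSet.isOpen_iff_isUpperSet.1 U.isOpen
    (show WithUpperSet.toUpperSet (pointSet p) ≤ WithUpperSet.toUpperSet (pointSet q) from hq) h

lemma minOpen_le_minOpen_iff (p q : AffF1.{u} n) :
    minOpen p ≤ minOpen q ↔ pointSet q ⊆ pointSet p := minOpen_le_iff p _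

lemma minOpen_zeroPt : minOpen (zeroPt.{u} n) = ⊤ :=
  top_unique fun q _ => Finset.empty_subset (pointSet q)

/-- A covering of `U_p` contains `U_p`. -/
lemma sieve_id_of_mem (p : AffF1.{u} n) (S : Sieve (minOpen p))
    (hS : S ∈ Opens.grothendieckTopology (AffF1.{u} n) (minOpen p)) : S (𝟙 _) := by
  obtain ⟨V, f, hf, hV⟩ := hS p (self_mem_minOpen p)
  exact S.downward_closed (f := f) hf (homOfLE ((minOpen_le_iff p V).2 hV))

/-- The open subsets `U_s`, as a functor. -/
def minOpenFunctor (n : ℕ) : (Finset (ULift.{u} (Fin n)))ᵒᵖ ⥤ Opens (AffF1.{u} n) where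
  obj s := minOpen (setPoint s.unop)
  map f := homOfLE ((minOpen_le_minOpen_iff _ _).2 (leOfHom f.unop))

instance : (minOpenFunctor.{u} n).Full where
  map_surjective f := ⟨(homOfLE ((minOpen_le_minOpen_iff _ _).1 (leOfHom f))).op,
    Subsingleton.elim _ _⟩

instance : (minOpenFunctor.{u} n).Faithful where
  map_injective _ := Quiver.Hom.unop_inj (Subsingleton.elim _ _)

instance : (minOpenFunctor.{u} n).IsCoverDense (Opens.grothendieckTopology (AffF1.{u} n)) where
  is_cover U x hx := ⟨minOpen x, homOfLE ((minOpen_le_iff x U).2 hx),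
    ⟨⟨op (pointSet x), 𝟙 _, homOfLE ((minOpen_le_iff x U).2 hx), Subsingleton.elim _ _⟩⟩,
    self_mem_minOpen x⟩

instance : (minOpenFunctor.{u} n).IsDenseSubsite ⊥ (Opens.grothendieckTopology (AffF1.{u} n)) :=
  isDenseSubsite_bot _ _ fun _ S hS => sieve_id_of_mem _ S hS

/-- The open subsets `U_{p ∪ s}` of `U_p`, as a functor. -/
def minOpenOverFunctor (p : AffF1.{u} n) :
    (Finset {i // i ∉ pointSet p})ᵒᵖ ⥤ Over (minOpen p) where
  obj s := Over.mk (Y := minOpen (setPoint ((unionFunctor (pointSet p)).obj s.unop)))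
    (homOfLE ((minOpen_le_minOpen_iff _ _).2 Finset.subset_union_left))
  map f := Over.homMk ((minOpenFunctor n).map ((unionFunctor (pointSet p)).map f.unop).op)

lemma subset_of_unionFunctor_subset {ι : Type u} [DecidableEq ι] (p : Finset ι)
    {s t : Finset {i // i ∉ p}} (h : (unionFunctor p).obj s ⊆ (unionFunctor p).obj t) :
    s ⊆ t := by
  intro x hx
  have := h (Finset.mem_union_right _ (Finset.mem_map_of_mem (Function.Embedding.subtype _) hx))
  rcases Finset.mem_union.1 this with h' | h'
  · exact (x.2 h').elim
  · exact (Finset.mem_map' _).1 h'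

lemma unionFunctor_subtype {ι : Type u} [DecidableEq ι] (p t : Finset ι) (h : p ⊆ t) :
    (unionFunctor p).obj (t.subtype (· ∉ p)) = t := by
  rw [unionFunctor_obj, Finset.subtype_map]
  ext x
  by_cases hx : x ∈ p
  · simp [hx, h hx]
  · simp [hx]

instance (p : AffF1.{u} n) : (minOpenOverFunctor p).Full where
  map_surjective f := ⟨(homOfLE (subset_of_unionFunctor_subset _
    ((minOpen_le_minOpen_iff _ _).1 (leOfHom f.left)))).op,
    Over.OverMorphism.ext (Subsingleton.elim _ _)⟩

instance (p : AffF1.{u} n) : (minOpenOverFunctor p).Faithful where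
  map_injective _ := Quiver.Hom.unop_inj (Subsingleton.elim _ _)

instance (p : AffF1.{u} n) : (minOpenOverFunctor p).IsCoverDense
    ((Opens.grothendieckTopology (AffF1.{u} n)).over (minOpen p)) where
  is_cover Y := by
    rw [GrothendieckTopology.mem_over_iff]
    intro x hx
    have hxp : pointSet p ⊆ pointSet x := leOfHom Y.hom hx
    have hle : minOpen x ≤ Y.left := (minOpen_le_iff x _).2 hx
    have e := unionFunctor_subtype (pointSet p) (pointSet x) hxp
    refine ⟨minOpen x, homOfLE hle, ?_, self_mem_minOpen x⟩
    rw [Sieve.overEquiv_iff]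
    have h₁ : minOpen x ≤ minOpen (setPoint ((unionFunctor (pointSet p)).obj
      ((pointSet x).subtype (· ∉ pointSet p)))) := (minOpen_le_minOpen_iff _ _).2 e.le
    have h₂ : minOpen (setPoint ((unionFunctor (pointSet p)).obj
      ((pointSet x).subtype (· ∉ pointSet p)))) ≤ minOpen x := (minOpen_le_minOpen_iff _ _).2 e.ge
    exact ⟨⟨op ((pointSet x).subtype (· ∉ pointSet p)),
      Over.homMk (homOfLE h₁) (Subsingleton.elim _ _),
      Over.homMk (homOfLE (h₂.trans hle)) (Subsingleton.elim _ _),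
      Over.OverMorphism.ext (Subsingleton.elim _ _)⟩⟩

instance (p : AffF1.{u} n) : (minOpenOverFunctor p).IsDenseSubsite ⊥
    ((Opens.grothendieckTopology (AffF1.{u} n)).over (minOpen p)) :=
  isDenseSubsite_bot _ _ fun s S hS => by
    rw [GrothendieckTopology.mem_over_iff] at hS
    exact (Sieve.overEquiv_iff S _).1 (sieve_id_of_mem _ _ hS)

variable (k : Type u) [CommRing k]

/-- The equivalence between sheaves on the affine space and diagrams on the poset of subsets
of `{1, …, n}`. -/
abbrev toDiagram (n : ℕ) : Shv k (AffF1.{u} n) ⥤ PosetMod k (ULift.{u} (Fin n)) :=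
  sectionsDiagram (Opens.grothendieckTopology (AffF1.{u} n)) (minOpenFunctor n) k

/-- The equivalence between sheaves on `U_p` and diagrams on the poset of subsets of the
complement of `p`. -/
abbrev toDiagramOver (p : AffF1.{u} n) :
    Sheaf ((Opens.grothendieckTopology (AffF1.{u} n)).over (minOpen p)) (ModuleCat.{u} k) ⥤
      PosetMod k {i // i ∉ pointSet p} :=
  sectionsDiagram _ (minOpenOverFunctor p) k

instance : (toDiagram.{u} k n).IsEquivalence := sectionsDiagram_isEquivalence _ _ k

instance (p : AffF1.{u} n) : (toDiagramOver k p).IsEquivalence :=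
  sectionsDiagram_isEquivalence _ _ k

instance : (toDiagram.{u} k n).Additive where
instance : (toDiagram.{u} k n).Linear k where

/-- The restriction to `U_p` of a sheaf, as a diagram. -/
abbrev localDiagram (p : AffF1.{u} n) :
    Shv k (AffF1.{u} n) ⥤ PosetMod k {i // i ∉ pointSet p} :=
  toDiagram k n ⋙ unionPullback k (pointSet p)

instance (p : AffF1.{u} n) : (localDiagram k p).Additive :=
  inferInstanceAs (toDiagram k n ⋙ unionPullback k (pointSet p)).Additive

instance (p : AffF1.{u} n) : (localDiagram k p).Linear k :=
  inferInstanceAs ((toDiagram k n ⋙ unionPullback k (pointSet p)).Linear k)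

instance (p : AffF1.{u} n) : PreservesFiniteLimits (localDiagram k p) := by
  infer_instance
instance (p : AffF1.{u} n) : PreservesFiniteColimits (localDiagram k p) := by
  infer_instance

lemma isEquivalence_localDiagram_zeroPt : (localDiagram.{u} k (zeroPt n)).IsEquivalence := by
  have : (unionFunctor (pointSet (zeroPt.{u} n))).Full :=
    ⟨fun f => ⟨homOfLE (subset_of_unionFunctor_subset _ (leOfHom f)), Subsingleton.elim _ _⟩⟩
  have : (unionFunctor (pointSet (zeroPt.{u} n))).Faithful :=
    ⟨fun _ => Subsingleton.elim _ _⟩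
  have : (unionFunctor (pointSet (zeroPt.{u} n))).EssSurj :=
    ⟨fun t => ⟨_, ⟨eqToIso (unionFunctor_subtype _ t (Finset.empty_subset t))⟩⟩⟩
  have : (unionFunctor (pointSet (zeroPt.{u} n))).IsEquivalence := {}
  infer_instance

end


/-! ### Stalks, sections with support and the canonical sheaf -/

section

open Opposite TopologicalSpace Topology

variable (k : Type u) [CommRing k] {n : ℕ}

/-- The sections on `U`. -/
abbrev sectionsOn (U : Opens (AffF1.{u} n)) : Shv k (AffF1.{u} n) ⥤ ModuleCat.{u} k :=
  sheafToPresheaf _ _ ⋙ (evaluation _ _).obj (op U)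

instance (U : Opens (AffF1.{u} n)) : (sectionsOn k U).Additive where

lemma isIso_germ (p : AffF1.{u} n) (F : TopCat.Presheaf (ModuleCat.{u} k) (AffF1.{u} n)) :
    IsIso (F.germ (minOpen p) p (self_mem_minOpen p)) := by
  have h : IsTerminal (op (⟨minOpen p, self_mem_minOpen p⟩ : OpenNhds p)) :=
    IsTerminal.ofUniqueHom (fun U => (homOfLE ((minOpen_le_iff p _).2 U.unop.2)).op)
      fun _ _ => Quiver.Hom.unop_inj (Subsingleton.elim _ _)
  exact isIso_ι_of_isTerminal h ((OpenNhds.inclusion p).op ⋙ F)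

/-- The stalk at `p` is the module of sections on `U_p`. -/
def sectionsIsoStalk (p : AffF1.{u} n) : sectionsOn k (minOpen p) ≅ stalkAt k p :=
  NatIso.ofComponents
    (fun F => @asIso _ _ _ _ (F.presheaf.germ (minOpen p) p (self_mem_minOpen p))
      (isIso_germ k p F.presheaf))
    (fun f => (TopCat.Presheaf.stalkFunctor_map_germ (minOpen p) p (self_mem_minOpen p)
      f.hom).symm)

lemma germ_eq_zero_iff (F : Shv k (AffF1.{u} n)) (U : Opens (AffF1.{u} n)) (x : AffF1.{u} n)
    (hx : x ∈ U) (s : F.presheaf.obj (op U)) :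
    (F.presheaf.germ U x hx).hom s = 0 ↔
      (F.presheaf.map (homOfLE ((minOpen_le_iff x U).2 hx)).op).hom s = 0 := by
  have := isIso_germ k x F.presheaf
  have hinj : Function.Injective (F.presheaf.germ (minOpen x) x (self_mem_minOpen x)).hom :=
    (ModuleCat.mono_iff_injective _).1 inferInstance
  rw [← map_eq_zero_iff _ hinj]
  have h := ConcreteCategory.congr_hom (TopCat.Presheaf.germ_res F.presheaf
    (homOfLE ((minOpen_le_iff x U).2 hx)) x (self_mem_minOpen x)) s
  exact (Eq.congr_left h).symm

lemma mem_supportedSections_iff (p : AffF1.{u} n) (F : Shv k (AffF1.{u} n))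
    (s : F.presheaf.obj (op (minOpen p))) :
    s ∈ supportedSections (minOpen p) {p} F ↔ ∀ (q : AffF1.{u} n) (h : minOpen q ≤ minOpen p),
      q ≠ p → (F.presheaf.map (homOfLE h).op).hom s = 0 := by
  refine ⟨fun h q hq hqp => ?_, fun h q hq hqp => ?_⟩
  · exact (germ_eq_zero_iff k F _ q (hq (self_mem_minOpen q)) s).1 (h q _ hqp)
  · exact (germ_eq_zero_iff k F _ q hq s).2 (h q _ hqp)

lemma restrict_eq_zero_of_le {F : Shv k (AffF1.{u} n)} {U V W : Opens (AffF1.{u} n)}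
    (hV : V ≤ U) (hW : W ≤ V) (s : F.presheaf.obj (op U))
    (h : (F.presheaf.map (homOfLE hV).op).hom s = 0) :
    (F.presheaf.map (homOfLE (hW.trans hV)).op).hom s = 0 := by
  have e := ConcreteCategory.congr_hom (F.presheaf.map_comp (homOfLE hV).op (homOfLE hW).op) s
  refine Eq.trans e ?_
  refine (congrArg (F.presheaf.map (homOfLE hW).op).hom h).trans ?_
  exact map_zero _

lemma unionFunctor_empty {ι : Type u} [DecidableEq ι] (p : Finset ι) :
    (unionFunctor p).obj ∅ = p := by
  simp [unionFunctor_obj]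

lemma unionFunctor_insert {ι : Type u} [DecidableEq ι] (p : Finset ι) (i : {i // i ∉ p}) :
    (unionFunctor p).obj (insert i ∅) = insert i.1 p := by
  simp [unionFunctor_obj]

lemma le_minOpen_union_empty (p : AffF1.{u} n) :
    minOpen (setPoint ((unionFunctor (pointSet p)).obj ∅)) ≤ minOpen p :=
  (minOpen_le_minOpen_iff _ _).2 (unionFunctor_empty (pointSet p)).ge

lemma minOpen_union_empty_le (p : AffF1.{u} n) :
    minOpen p ≤ minOpen (setPoint ((unionFunctor (pointSet p)).obj ∅)) :=
  (minOpen_le_minOpen_iff _ _).2 (unionFunctor_empty (pointSet p)).le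

/-- The sections on `U_p`, in terms of diagrams. -/
def sectionsLocalDiagram (p : AffF1.{u} n) :
    sectionsOn k (minOpen p) ≅ localDiagram k p ⋙ evalAt k ∅ :=
  Functor.isoWhiskerLeft _ ((evaluation _ _).mapIso (Iso.op
    (⟨homOfLE (le_minOpen_union_empty p), homOfLE (minOpen_union_empty_le p),
      Subsingleton.elim _ _, Subsingleton.elim _ _⟩ :
      minOpen (setPoint ((unionFunctor (pointSet p)).obj ∅)) ≅ minOpen p)))

/-- A section of `F` on `U_p` is supported at `p` if and only if its restrictions to the open
subsets `U_{p ∪ {i}}` vanish, since these cover the complement of `p` in `U_p`. -/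
lemma mem_supportedSections_iff_insert (p : AffF1.{u} n) (l : List {i // i ∉ pointSet p})
    (hl : ∀ i, i ∈ l) (F : Shv k (AffF1.{u} n)) (s : F.presheaf.obj (op (minOpen p))) :
    s ∈ supportedSections (minOpen p) {p} F ↔ ∀ i ∈ l, (((localDiagram k p).obj F).map
      (homOfLE (Finset.subset_insert i ∅))).hom (((sectionsLocalDiagram k p).hom.app F).hom s)
        = 0 := by
  have hle (i : {i // i ∉ pointSet p}) :
      minOpen (setPoint ((unionFunctor (pointSet p)).obj (insert i ∅))) ≤ minOpen p :=
    (minOpen_le_minOpen_iff _ _).2 Finset.subset_union_left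
  have key (i : {i // i ∉ pointSet p}) : (((localDiagram k p).obj F).map
      (homOfLE (Finset.subset_insert i ∅))).hom (((sectionsLocalDiagram k p).hom.app F).hom s) =
      (F.presheaf.map (homOfLE (hle i)).op).hom s :=
    (ConcreteCategory.congr_hom (F.presheaf.map_comp (homOfLE (le_minOpen_union_empty p)).op
      (homOfLE ((minOpen_le_minOpen_iff _ _).2
        ((unionFunctor (pointSet p)).map (homOfLE (Finset.subset_insert i ∅))).le)).op) s).symm
  rw [mem_supportedSections_iff]
  constructor
  · intro h i _
    refine (key i).trans (h _ (hle i) fun e => i.2 ?_)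
    have e' : (unionFunctor (pointSet p)).obj (insert i ∅) = pointSet p := congrArg pointSet e
    rw [unionFunctor_insert] at e'
    exact (Finset.ext_iff.1 e' _).1 (Finset.mem_insert_self _ _)
  · intro h q hq hqp
    have hpq : pointSet p ⊆ pointSet q := (minOpen_le_minOpen_iff _ _).1 hq
    obtain ⟨i, hiq, hip⟩ : ∃ i ∈ pointSet q, i ∉ pointSet p := by
      by_contra! hc
      exact hqp (Finset.Subset.antisymm hc hpq)
    have hW : minOpen q ≤ minOpen (setPoint ((unionFunctor (pointSet p)).obj
        (insert ⟨i, hip⟩ ∅))) := by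
      refine (minOpen_le_minOpen_iff _ _).2 ?_
      refine (unionFunctor_insert (pointSet p) ⟨i, hip⟩).le.trans ?_
      exact Finset.insert_subset hiq hpq
    exact restrict_eq_zero_of_le k (hle ⟨i, hip⟩) hW s
      ((key ⟨i, hip⟩).symm.trans (h ⟨i, hip⟩ (hl _)))

/-- The sections supported at `p` are the iterated kernel of the diagram of `F`. -/
lemma nonempty_supportedSections_iso (p : AffF1.{u} n) (l : List {i // i ∉ pointSet p})
    (hl : ∀ i, i ∈ l) :
    Nonempty (supportedSectionsFunctor k (minOpen p) {p} ≅
      localDiagram k p ⋙ iterKernel (insertPullback k) (insertUnit k) l ⋙ evalAt k ∅) := by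
  let a : supportedSectionsFunctor k (minOpen p) {p} ⟶ localDiagram k p ⋙ evalAt k ∅ :=
    { app F := ModuleCat.ofHom (supportedSections (minOpen p) {p} F).subtype ≫
        (sectionsLocalDiagram k p).hom.app F
      naturality F G f :=
        congrArg (fun t => ModuleCat.ofHom (supportedSections (minOpen p) {p} F).subtype ≫ t)
          ((sectionsLocalDiagram k p).hom.naturality f) }
  let b : localDiagram k p ⋙ iterKernel (insertPullback k) (insertUnit k) l ⋙ evalAt k ∅ ⟶
      localDiagram k p ⋙ evalAt k ∅ :=
    Functor.whiskerLeft (localDiagram k p)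
      (Functor.whiskerRight (iterKernelι (insertPullback k) (insertUnit k) l) (evalAt k ∅))
  have hs (F : Shv k (AffF1.{u} n)) :
      Function.Bijective ((sectionsLocalDiagram k p).hom.app F).hom :=
    (ConcreteCategory.isIso_iff_bijective ((sectionsLocalDiagram k p).hom.app F)).1 inferInstance
  refine nonempty_iso_of_range_eq k a b (fun F => (hs F).1.comp Subtype.val_injective)
    (fun F => ?_) fun F x => ?_
  · have : Mono ((evalAt k ∅).map ((iterKernelι (insertPullback k) (insertUnit k) l).app
      ((localDiagram k p).obj F))) := inferInstance
    exact (ModuleCat.mono_iff_injective _).1 this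
  · obtain ⟨s, rfl⟩ := (hs F).2 x
    refine Iff.trans ?_ ((mem_supportedSections_iff_insert k p l hl F s).trans
      (exists_iterKernelι_iff k l ((localDiagram k p).obj F) ∅ _).symm)
    constructor
    · rintro ⟨y, hy⟩
      have := (hs F).1 hy
      exact this ▸ y.2
    · exact fun h => ⟨⟨s, h⟩, rfl⟩

end


section

open Opposite TopologicalSpace Topology

variable (k : Type u) [CommRing k] {n : ℕ}

lemma extByZeroSections_eq_zero (q : AffF1.{u} n) (hq : q ≠ onePt n)
    (f : extByZeroSections k (minOpen (onePt n)) (minOpen q)) : f = 0 := by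
  obtain ⟨f, hf, hf'⟩ := f
  refine Subtype.ext (funext fun x => ?_)
  have hq0 : f ⟨q, self_mem_minOpen q⟩ = 0 := hf' _ fun h => hq ((mem_minOpen_onePt n q).1 h)
  obtain ⟨T, hT, hqT, h⟩ := (IsLocallyConstant.iff_exists_open f).1 hf ⟨q, self_mem_minOpen q⟩
  have hT' : IsOpen (Subtype.val '' T) := (minOpen q).isOpen.isOpenMap_subtype_val T hT
  -- The only open neighbourhood of `q` in `U_q` is `U_q`.
  obtain ⟨y, hyT, hyx⟩ := (minOpen_le_iff q ⟨_, hT'⟩).2 ⟨_, hqT, rfl⟩ x.2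
  have : y = x := Subtype.ext hyx
  exact (h x (this ▸ hyT)).trans hq0

lemma isZero_localDiagram_canonicalSheaf (p : AffF1.{u} n) (s : Finset {i // i ∉ pointSet p})
    (hs : s ≠ Finset.univ) : IsZero (((localDiagram k p).obj (canonicalSheaf k n)).obj s) := by
  have hq : setPoint ((unionFunctor (pointSet p)).obj s) ≠ onePt n := by
    intro h
    refine hs (Finset.eq_univ_of_forall fun i => ?_)
    have h' : (unionFunctor (pointSet p)).obj s = Finset.univ := congrArg pointSet h
    have hi : i.1 ∈ (unionFunctor (pointSet p)).obj s := h' ▸ Finset.mem_univ _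
    rcases Finset.mem_union.1 hi with hi | hi
    · exact (i.2 hi).elim
    · exact (Finset.mem_map' _).1 hi
  have : Subsingleton (extByZeroSections k (minOpen (onePt.{u} n))
      (minOpen (setPoint ((unionFunctor (pointSet p)).obj s)))) :=
    ⟨fun f g => (extByZeroSections_eq_zero k _ hq f).trans
      (extByZeroSections_eq_zero k _ hq g).symm⟩
  exact ModuleCat.isZero_of_subsingleton
    (ModuleCat.of k (extByZeroSections k (minOpen (onePt.{u} n))
      (minOpen (setPoint ((unionFunctor (pointSet p)).obj s)))))

/-- The sections on `{𝟏}` are the constant functions. -/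
def extByZeroSectionsEquiv (q : AffF1.{u} n) (hq : q = onePt n) :
    extByZeroSections k (minOpen (onePt n)) (minOpen q) ≃ₗ[k] k where
  toFun f := f.1 ⟨q, self_mem_minOpen q⟩
  map_add' _ _ := rfl
  map_smul' _ _ := rfl
  invFun c := ⟨fun _ => c, IsLocallyConstant.const c, fun x hx => (hx (hq ▸ x.2)).elim⟩
  left_inv f := by
    subst hq
    refine Subtype.ext (funext fun x => congrArg f.1 (Subtype.ext ?_))
    exact ((mem_minOpen_onePt n x.1).1 x.2).symm
  right_inv _ := rfl

/-- The value of the canonical sheaf at the generic point. -/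
def localDiagramCanonicalSheafUniv (p : AffF1.{u} n) :
    ((localDiagram k p).obj (canonicalSheaf k n)).obj Finset.univ ≅ ModuleCat.of k k :=
  (extByZeroSectionsEquiv k (setPoint ((unionFunctor (pointSet p)).obj Finset.univ))
    (Finset.eq_univ_of_forall fun i => by
      by_cases hi : i ∈ pointSet p
      · exact Finset.mem_union_left _ hi
      · exact Finset.mem_union_right _ (Finset.mem_map.2 ⟨⟨i, hi⟩, Finset.mem_univ _, rfl⟩))).toModuleIso

end

/-! ### The dimension of `U_p` -/

section

open TopologicalSpace Topology

/-- In a finite space, an irreducible closed subset is the closure of one of its points. -/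
lemma exists_closure_eq_of_finite {T : Type*} [TopologicalSpace T] [Finite T] {S : Set T}
    (hS : IsIrreducible S) (hS' : IsClosed S) : ∃ x, closure {x} = S := by
  obtain ⟨z, hz, hSz⟩ := isIrreducible_iff_sUnion_isClosed.1 hS
    (Set.toFinite ((fun x : T => closure {x}) '' S)).toFinset (by simp)
    (fun x hx => ⟨closure {x}, by simpa using ⟨x, hx, rfl⟩, subset_closure rfl⟩)
  obtain ⟨x, hx, rfl⟩ : ∃ x ∈ S, closure {x} = z := by simpa using hz
  exact ⟨x, Set.Subset.antisymm (hS'.closure_subset_iff.2 (Set.singleton_subset_iff.2 hx)) hSz⟩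

lemma krullDim_finset (κ : Type*) [Fintype κ] :
    Order.krullDim (Finset κ) = Fintype.card κ := by
  classical
  refine le_antisymm (iSup_le fun s => ?_) ?_
  · let f : Finset κ → Fin (Fintype.card κ + 1) := fun t => ⟨t.card, Nat.lt_succ_of_le t.card_le_univ⟩
    have h := (s.map f fun t t' h => Fin.mk_lt_mk.2 (Finset.card_lt_card h)).length_lt_card
    rw [Fintype.card_fin] at h
    exact_mod_cast Nat.le_of_lt_succ h
  · let c : Fin (Fintype.card κ + 1) → Finset κ := fun m =>
      Finset.univ.filter fun i => (Fintype.equivFin κ i).1 < m.1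
    have hc : StrictMono c := fun m m' h => by
      refine Finset.ssubset_iff_subset_ne.2 ⟨fun i hi => ?_, fun e => ?_⟩
      · simp only [c, Finset.mem_filter, Finset.mem_univ, true_and] at hi ⊢
        exact hi.trans h
      · have hm : m.1 < Fintype.card κ := lt_of_lt_of_le h (Nat.le_of_lt_succ m'.2)
        have := Finset.ext_iff.1 e ((Fintype.equivFin κ).symm ⟨m.1, hm⟩)
        simp [c] at this
        exact absurd h (not_lt.2 this)
    exact Order.LTSeries.length_le_krullDim (LTSeries.mk (Fintype.card κ) c hc)

variable {n : ℕ} (p : AffF1.{u} n)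

/-- The point `p ∪ s` of `U_p`. -/
def unionPoint (s : Finset {i // i ∉ pointSet p}) : minOpen p :=
  ⟨setPoint ((unionFunctor (pointSet p)).obj s), Finset.subset_union_left⟩

lemma closure_unionPoint_subset_iff (s t : Finset {i // i ∉ pointSet p}) :
    closure {unionPoint p s} ⊆ closure {unionPoint p t} ↔ s ⊆ t := by
  rw [← specializes_iff_closure_subset, subtype_specializes_iff]
  refine Topology.WithUpperSet.toUpperSet_specializes_toUpperSet.trans ?_
  exact ⟨subset_of_unionFunctor_subset (pointSet p), fun h => leOfHom
    ((unionFunctor (pointSet p)).map (homOfLE h))⟩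

/-- The irreducible closed subsets of `U_p` are the closures of its points. -/
def irreducibleClosedsIso :
    Finset {i // i ∉ pointSet p} ≃o IrreducibleCloseds (minOpen p) :=
  have hf {s t : Finset {i // i ∉ pointSet p}} :
      (⟨closure {unionPoint p s}, isIrreducible_singleton.closure, isClosed_closure⟩ :
        IrreducibleCloseds (minOpen p)) ≤
      ⟨closure {unionPoint p t}, isIrreducible_singleton.closure, isClosed_closure⟩ ↔ s ≤ t :=
    closure_unionPoint_subset_iff p s t
  RelIso.ofSurjective (OrderEmbedding.ofMapLEIff (fun s => (⟨closure {unionPoint p s},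
    isIrreducible_singleton.closure, isClosed_closure⟩ : IrreducibleCloseds (minOpen p)))
    fun _ _ => hf) fun S => by
      have : Finite (minOpen p) :=
        inferInstanceAs (Finite {q : Finset (ULift.{u} (Fin n)) // pointSet p ⊆ q})
      obtain ⟨x, hx⟩ := exists_closure_eq_of_finite S.isIrreducible S.isClosed
      refine ⟨(pointSet x.1).subtype (· ∉ pointSet p), IrreducibleCloseds.ext ?_⟩
      have e : unionPoint p ((pointSet x.1).subtype (· ∉ pointSet p)) = x :=
        Subtype.ext (unionFunctor_subtype (pointSet p) (pointSet x.1) x.2)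
      exact (congrArg (fun y => closure {y}) e).trans hx

lemma dimMinOpen_eq : dimMinOpen p = Fintype.card {i // i ∉ pointSet p} := by
  have h : topologicalKrullDim (minOpen p) = Fintype.card {i // i ∉ pointSet p} :=
    (Order.krullDim_eq_of_orderIso (irreducibleClosedsIso p)).symm.trans (krullDim_finset _)
  rw [dimMinOpen, h]
  rfl

end

/-! ### Local cohomology and duality on the affine space -/

section

open Opposite TopologicalSpace Topology

variable (k : Type u) [CommRing k] {n : ℕ} (p : AffF1.{u} n) (l : List {i // i ∉ pointSet p})

/-- Every complex of sheaves is quasi-isomorphic to a complex whose terms are acyclic for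
`Γ_p(U_p, -)`. -/
lemma exists_iterFlasque_resolution_sheaf (K : CochainComplex (Shv k (AffF1.{u} n)) ℤ) :
    ∃ (R : CochainComplex (Shv k (AffF1.{u} n)) ℤ) (s : K ⟶ R), QuasiIso s ∧
      ∀ m, IterFlasque (insertPullback k) (insertUnit k) l ((localDiagram k p).obj (R.X m)) := by
  let E := (toDiagram.{u} k n).asEquivalence
  have hE : E.functor.Additive := inferInstanceAs (toDiagram.{u} k n).Additive
  obtain ⟨R, f, hf, hR⟩ := exists_iterFlasque_resolution k (pointSet p) l
    (((toDiagram.{u} k n).mapHomologicalComplex _).obj K)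
  let s₁ : K ⟶ (E.inverse.mapHomologicalComplex _).obj
      (((toDiagram.{u} k n).mapHomologicalComplex _).obj K) :=
    { f m := E.unit.app (K.X m)
      comm' m m' _ := (E.unit.naturality (K.d m m')).symm }
  have (m : ℤ) : IsIso (s₁.f m) := inferInstanceAs (IsIso (E.unit.app (K.X m)))
  have : IsIso s₁ := HomologicalComplex.Hom.isIso_of_components _
  refine ⟨_, s₁ ≫ (E.inverse.mapHomologicalComplex _).map f, inferInstance, fun m => ?_⟩
  exact IterFlasque.of_iso _ _ l ((unionPullback k (pointSet p)).mapIso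
    (E.counitIso.app (R.X m)).symm) (hR m)

/-- The comparison of the sections supported at `p` with the iterated cocone construction. -/
def localKernelToCocone :
    (localDiagram k p ⋙ iterKernel (insertPullback k) (insertUnit k) l ⋙
      evalAt k ∅).mapHomologicalComplex (ComplexShape.up ℤ) ⟶
    (localDiagram k p).mapHomologicalComplex (ComplexShape.up ℤ) ⋙ localCx k l where
  app K := ((evalAt k ∅).mapHomologicalComplex (ComplexShape.up ℤ)).map
    (iterKernelToCocone (insertPullback k) (insertUnit k) l
      (((localDiagram k p).mapHomologicalComplex _).obj K))
  naturality K L f := by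
    have h := congrArg ((evalAt k ∅).mapHomologicalComplex (ComplexShape.up ℤ)).map
      (iterKernelToCocone_naturality (insertPullback k) (insertUnit k) l
        (((localDiagram k p).mapHomologicalComplex (ComplexShape.up ℤ)).map f))
    exact (Functor.map_comp _ _ _).symm.trans (h.trans (Functor.map_comp _ _ _))

variable [HasDerivedCategory.{w₁} (Shv k (AffF1.{u} n))]
  [HasDerivedCategory.{w₂} (ModuleCat.{u} k)]

/-- The local cohomology at `p` is computed by the iterated cocone construction. -/
lemma hasRΓ_minOpen (hl : ∀ i, i ∈ l) :
    ∃ _ : HasRΓ.{u, w₂} k (minOpen p) {p},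
      Nonempty (DerivedCategory.Q ⋙ RΓ k (minOpen p) {p} ≅
        ((localDiagram k p).mapHomologicalComplex (ComplexShape.up ℤ) ⋙ localCx k l) ⋙
          DerivedCategory.Q) := by
  obtain ⟨e⟩ := nonempty_supportedSections_iso k p l hl
  let Θ := (localDiagram k p).mapHomologicalComplex (ComplexShape.up ℤ)
  let α : supportedSectionsCx.{u, w₂} k (minOpen p) {p} ⟶ (Θ ⋙ localCx k l) ⋙ DerivedCategory.Q :=
    Functor.whiskerRight ((NatIso.mapHomologicalComplex e (ComplexShape.up ℤ)).hom ≫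
      localKernelToCocone k p l) DerivedCategory.Q
  refine hasRightDerivedFunctor_of_resolutions α (fun K L f hf => ?_) fun K => ?_
  · have : QuasiIso f := hf
    have h₁ : QuasiIso (Θ.map f) := inferInstance
    have h₂ : QuasiIso ((iterCocone (insertPullback k) (insertUnit k) l).map (Θ.map f)) :=
      inferInstance
    have h₃ : QuasiIso (((evalAt k ∅).mapHomologicalComplex (ComplexShape.up ℤ)).map
      ((iterCocone (insertPullback k) (insertUnit k) l).map (Θ.map f))) := inferInstance
    exact (DerivedCategory.isIso_Q_map_iff_quasiIso _ _).2 h₃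
  · obtain ⟨R, s, hs, hR⟩ := exists_iterFlasque_resolution_sheaf k p l K
    refine ⟨R, s, hs, ?_⟩
    have h₁ : QuasiIso (iterKernelToCocone (insertPullback k) (insertUnit k) l (Θ.obj R)) :=
      iterKernelToCocone_quasiIso _ _ l (Θ.obj R) hR
    have h₂ : QuasiIso (((evalAt k ∅).mapHomologicalComplex (ComplexShape.up ℤ)).map
      (iterKernelToCocone (insertPullback k) (insertUnit k) l (Θ.obj R))) := inferInstance
    have h₃ := (DerivedCategory.isIso_Q_map_iff_quasiIso _ _).2 h₂
    have h₄ : IsIso ((NatIso.mapHomologicalComplex e (ComplexShape.up ℤ)).hom.app R) :=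
      inferInstance
    refine (congrArg IsIso (DerivedCategory.Q.map_comp _ _)).mpr ?_
    exact IsIso.comp_isIso' (Functor.map_isIso _ _) h₃

end

/-! ### The duality isomorphisms -/

section

/-- The dual of a derived functor which is induced by a functor `L` on complexes. -/
def derivedDualIso (k : Type u) [CommRing k] [HasDerivedCategory.{w₂} (ModuleCat.{u} k)]
    {A : Type*} [Category A] [Abelian A] [HasDerivedCategory.{w₁} A]
    {L : CochainComplex A ℤ ⥤ CochainComplex (ModuleCat.{u} k) ℤ}
    {RG : DerivedCategory A ⥤ DerivedCategory (ModuleCat.{u} k)}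
    (e : DerivedCategory.Q ⋙ RG ≅ L ⋙ DerivedCategory.Q)
    (S : DerivedCategory (ModuleCat.{u} k) ⥤ DerivedCategory (ModuleCat.{u} k)) :
    (DerivedCategory.Q : CochainComplex A ℤ ⥤ _).op ⋙ RG.op ⋙ derivedDual k ⋙ S ≅
      L.op ⋙ homCxFunctor k (injRes (ModuleCat.of k k)) ⋙ DerivedCategory.Q ⋙ S :=
  Functor.isoWhiskerRight (NatIso.op e.symm) (derivedDual k ⋙ S) ≪≫
    Functor.isoWhiskerLeft L.op (Functor.isoWhiskerRight (Localization.fac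
      (homCxFunctor k (injRes (ModuleCat.of k k)) ⋙ DerivedCategory.Q)
      (isInvertedBy_of_quasiIso _ fun _ _ f _ =>
        homCxFunctor_map_quasiIso k (injRes (ModuleCat.of k k)) f) DerivedCategory.Q.op) S)

/-- `ℝHom(-, G)` on the classes of complexes. -/
def RHomFac {C : Type*} [Category.{u} C] [Abelian C] (k : Type u) [CommRing k] [Linear k C]
    [EnoughInjectives C] [HasDerivedCategory.{w₁} C] [HasDerivedCategory.{w₂} (ModuleCat.{u} k)]
    (G : C) : DerivedCategory.Q.op ⋙ RHom k G ≅ homCxFunctor k (injRes G) ⋙ DerivedCategory.Q :=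
  Localization.fac _ _ _

lemma isKInjective_map_of_isEquivalence {C D : Type*} [Category.{u} C] [Abelian C]
    [Category.{u} D] [Abelian D] (Ψ : C ⥤ D) [Ψ.Additive] [Ψ.IsEquivalence]
    (I : CochainComplex C ℤ) [I.IsStrictlyGE 0] [∀ m, Injective (I.X m)] :
    CochainComplex.IsKInjective ((Ψ.mapHomologicalComplex (ComplexShape.up ℤ)).obj I) := by
  have (m : ℤ) : Injective (((Ψ.mapHomologicalComplex (ComplexShape.up ℤ)).obj I).X m) :=
    Ψ.asEquivalence.map_injective_iff (I.X m) |>.2 inferInstance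
  have : CochainComplex.IsStrictlyGE ((Ψ.mapHomologicalComplex (ComplexShape.up ℤ)).obj I) 0 := inferInstance
  exact isKInjective_of_injective _ 0

end

lemma injective_resOpen (k : Type u) [CommRing k] {X : TopCat.{u}}
    (U : TopologicalSpace.Opens X) (I : Shv k X) [Injective I] :
    Injective ((resOpen k U).obj I) := inferInstance

section

open Opposite TopologicalSpace Topology

variable (k : Type u) [CommRing k] {n : ℕ} (p : AffF1.{u} n) (l : List {i // i ∉ pointSet p})
  (hl : l.Nodup) (hl' : ∀ i, i ∈ l) [HasDerivedCategory.{w₂} (ModuleCat.{u} k)]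

/-- The canonical sheaf, as a complex of diagrams on `U_p`. -/
abbrev canonicalDiagramCx : CochainComplex (PosetMod k {i // i ∉ pointSet p}) ℤ :=
  ((localDiagram k p).mapHomologicalComplex _).obj (injRes (canonicalSheaf k n))

include hl hl' in
/-- Duality for diagrams, applied to the diagram of the canonical sheaf, which is `k` supported at
the largest subset. -/
lemma nonempty_homCx_canonicalDiagram [(canonicalDiagramCx k p).IsKInjective] :
    Nonempty (homCxFunctor k (canonicalDiagramCx k p) ⋙ DerivedCategory.Q ≅
      (localCx k l).op ⋙ homCxFunctor k (injRes (ModuleCat.of k k)) ⋙ DerivedCategory.Q ⋙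
        CategoryTheory.shiftFunctor _ (-(l.length : ℤ))) := by
  let _ := HasDerivedCategory.standard (PosetMod k {i // i ∉ pointSet p})
  let _ := HasDerivedCategory.standard (Shv k (AffF1.{u} n))
  refine nonempty_homCx_iso_localCx k l hl hl' ((localDiagram k p).obj (canonicalSheaf k n))
    (isZero_localDiagram_canonicalSheaf k p) (localDiagramCanonicalSheafUniv k p) _ ?_
  exact ((localDiagram k p).mapDerivedCategoryFactors.app _).symm ≪≫
    (localDiagram k p).mapDerivedCategory.mapIso (injResIso (canonicalSheaf k n)).symm ≪≫
    ((localDiagram k p).mapDerivedCategorySingleFunctor 0).app _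

omit [HasDerivedCategory.{w₂} (ModuleCat.{u} k)] in
lemma isKInjective_toDiagramOver (I : CochainComplex (Shv k (AffF1.{u} n)) ℤ)
    [I.IsStrictlyGE 0] [∀ m, Injective (I.X m)] :
    CochainComplex.IsKInjective (((toDiagramOver k p).mapHomologicalComplex
      (ComplexShape.up ℤ)).obj ((resCx k (minOpen p)).obj I)) := by
  have (m : ℤ) : Injective (((resCx k (minOpen p)).obj I).X m) :=
    injective_resOpen k (minOpen p) (I.X m)
  have : CochainComplex.IsStrictlyGE ((resCx k (minOpen p)).obj I) 0 := inferInstance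
  exact isKInjective_map_of_isEquivalence (toDiagramOver k p) ((resCx k (minOpen p)).obj I)

/-- The stalk at `p` of `𝓗om(K, I)` is the complex `Hom(K|U_p, I|U_p)`. -/
def sheafHomCxStalkIso (I : CochainComplex (Shv k (AffF1.{u} n)) ℤ) :
    sheafHomCxFunctor I ⋙ (stalkAt k p).mapHomologicalComplex (ComplexShape.up ℤ) ≅
      (resCx k (minOpen p)).op ⋙ homCxFunctor k ((resCx k (minOpen p)).obj I) :=
  Functor.isoWhiskerLeft _ (NatIso.mapHomologicalComplex (sectionsIsoStalk k p).symm _) ≪≫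
    NatIso.ofComponents (fun _ => HomologicalComplex.Hom.isoOfComponents (fun _ => Iso.refl _)
      fun _ _ _ => (Category.id_comp _).trans (Category.comp_id _).symm)
      fun _ => HomologicalComplex.hom_ext _ _ fun _ =>
        (Category.comp_id _).trans (Category.id_comp _).symm

variable [HasDerivedCategory.{w₁} (Shv k (AffF1.{u} n))]

include hl hl' in
/-- The stalk of `ℝ𝓗om(F, ω)` at `p`, with the length of `l` in place of the dimension of `U_p`. -/
lemma nonempty_RSheafHom_iso :
    ∃ _ : HasRΓ.{u, w₂} k (minOpen p) {p},
      Nonempty (RSheafHom k (canonicalSheaf k n) ⋙ derivedStalk k p ≅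
        (RΓ k (minOpen p) {p}).op ⋙ derivedDual k ⋙
          CategoryTheory.shiftFunctor _ (-(l.length : ℤ))) := by
  obtain ⟨h, ⟨e⟩⟩ := hasRΓ_minOpen.{u, w₁, w₂} k p l hl'
  let I := injRes (canonicalSheaf k n)
  have : (canonicalDiagramCx k p).IsKInjective :=
    isKInjective_toDiagramOver k p I
  obtain ⟨e₁⟩ := nonempty_homCx_canonicalDiagram k p l hl hl'
  let e₂ : (DerivedCategory.Q : CochainComplex (Shv k (AffF1.{u} n)) ℤ ⥤ _).op ⋙
      RSheafHom k (canonicalSheaf k n) ≅ sheafHomCxFunctor I ⋙ DerivedCategory.Q :=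
    Localization.fac _ _ _
  let e₃ : (resCx k (minOpen p)).op ⋙ homCxFunctor k ((resCx k (minOpen p)).obj I) ≅
      ((localDiagram k p).mapHomologicalComplex (ComplexShape.up ℤ)).op ⋙
        homCxFunctor k (canonicalDiagramCx k p) :=
    Functor.isoWhiskerLeft (resCx k (minOpen p)).op (homCxFullyFaithful k (toDiagramOver k p) _)
  exact ⟨h, ⟨liftQOpIso (Functor.isoWhiskerRight e₂ (derivedStalk k p) ≪≫
    Functor.isoWhiskerLeft (sheafHomCxFunctor I) (stalkAt k p).mapDerivedCategoryFactors ≪≫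
    Functor.isoWhiskerRight (sheafHomCxStalkIso k p I ≪≫ e₃) DerivedCategory.Q ≪≫
    Functor.isoWhiskerLeft ((localDiagram k p).mapHomologicalComplex (ComplexShape.up ℤ)).op e₁ ≪≫
    (derivedDualIso k e (CategoryTheory.shiftFunctor _ (-(l.length : ℤ)))).symm)⟩⟩

omit p l hl hl' in
/-- The global duality isomorphism: all sheaves on the affine space are sheaves on `U_𝟎`, so that
no restriction is needed. -/
lemma nonempty_RHom_iso (l : List {i // i ∉ pointSet (zeroPt.{u} n)}) (hl : l.Nodup)
    (hl' : ∀ i, i ∈ l) :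
    ∃ _ : HasRΓ.{u, w₂} k (minOpen (zeroPt.{u} n)) {zeroPt n},
      Nonempty (RHom k (canonicalSheaf k n) ≅
        (RΓ k (minOpen (zeroPt.{u} n)) {zeroPt n}).op ⋙ derivedDual k ⋙
          CategoryTheory.shiftFunctor _ (-(l.length : ℤ))) := by
  obtain ⟨h, ⟨e⟩⟩ := hasRΓ_minOpen.{u, w₁, w₂} k (zeroPt n) l hl'
  have := isEquivalence_localDiagram_zeroPt.{u} k (n := n)
  have : (canonicalDiagramCx k (zeroPt.{u} n)).IsKInjective :=
    isKInjective_map_of_isEquivalence (localDiagram k (zeroPt n)) (injRes (canonicalSheaf k n))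
  obtain ⟨e₁⟩ := nonempty_homCx_canonicalDiagram k (zeroPt n) l hl hl'
  exact ⟨h, ⟨liftQOpIso (RHomFac k (canonicalSheaf k n) ≪≫
    Functor.isoWhiskerRight (homCxFullyFaithful k (localDiagram k (zeroPt n)) _)
      DerivedCategory.Q ≪≫
    Functor.isoWhiskerLeft
      ((localDiagram k (zeroPt n)).mapHomologicalComplex (ComplexShape.up ℤ)).op e₁ ≪≫
    (derivedDualIso k e (CategoryTheory.shiftFunctor _ (-(l.length : ℤ)))).symm)⟩⟩

end

/-! ### Duality over a field -/

section

open Opposite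

variable (k : Type u) [CommRing k]

instance : (linearDual k).Additive where

variable (hk : IsField k)

include hk

/-- Over a field, every module is injective. -/
lemma injective_of_isField (M : ModuleCat.{u} k) : Injective M := by
  let _ := hk.toField
  have : Module.Injective k M := Module.injective_of_isSemisimpleRing k M
  exact Module.injective_object_of_injective_module k M

/-- The dual is exact over a field, because `k` is an injective module. -/
lemma linearDual_preservesHomology : (linearDual k).PreservesHomology := by
  have hI := injective_of_isField k hk (ModuleCat.of k k)
  refine ((linearDual k).exact_tfae.out 1 2).1 fun S hS => ?_
  rw [ShortComplex.moduleCat_exact_iff]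
  intro x hx
  have hS' : S.unop.Exact := hS.unop
  have hx' : S.unop.f ≫ ModuleCat.ofHom x = 0 := ModuleCat.hom_ext hx
  exact ⟨(hS'.descToInjective (ModuleCat.ofHom x) hx').hom,
    congrArg ModuleCat.Hom.hom (hS'.comp_descToInjective (ModuleCat.ofHom x) hx')⟩

omit hk in
/-- The cochains with values in `k`, placed in degree `0`. -/
def cochainSingleEquiv (K : CochainComplex (ModuleCat.{u} k) ℤ) (m j : ℤ) (h : j + m = 0) :
    Cochain K ((singleFunctor (ModuleCat.{u} k) 0).obj (ModuleCat.of k k)) m ≃ₗ[k]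
      Module.Dual k (K.X j) :=
  { (Cochain.toSingleEquiv h).trans ModuleCat.homAddEquiv with
    map_smul' c z := by
      refine LinearMap.ext fun x => ?_
      rfl }

omit hk in
lemma cochainSingleEquiv_δ (K : CochainComplex (ModuleCat.{u} k) ℤ) (m m' j j' : ℤ)
    (h : j + m = 0) (h' : j' + m' = 0)
    (z : Cochain K ((singleFunctor (ModuleCat.{u} k) 0).obj (ModuleCat.of k k)) m) :
    cochainSingleEquiv k K m' j' h' (δ m m' z) =
      m'.negOnePow • (cochainSingleEquiv k K m j h z).comp (K.d j' j).hom := by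
  obtain ⟨f, rfl⟩ := (Cochain.toSingleEquiv h).symm.surjective z
  have e₁ : δ m m' ((Cochain.toSingleEquiv h).symm f) =
      m'.negOnePow • Cochain.toSingleMk (K.d j' j ≫ f) h' := Cochain.δ_toSingleMk f h m' j' h'
  have e₂ : cochainSingleEquiv k K m' j' h' (Cochain.toSingleMk (K.d j' j ≫ f) h') =
      (K.d j' j ≫ f).hom :=
    congrArg ModuleCat.Hom.hom (Cochain.toSingleEquiv_toSingleMk (K.d j' j ≫ f) h')
  have e₃ : cochainSingleEquiv k K m j h ((Cochain.toSingleEquiv h).symm f) = f.hom :=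
    congrArg ModuleCat.Hom.hom (Cochain.toSingleEquiv_toSingleMk f h)
  rw [e₁, e₃, Units.smul_def, Units.smul_def, map_zsmul, e₂]
  rfl

omit hk in
lemma cochainSingleEquiv_precomp {K K' : CochainComplex (ModuleCat.{u} k) ℤ} (g : K' ⟶ K)
    (m j : ℤ) (h : j + m = 0)
    (z : Cochain K ((singleFunctor (ModuleCat.{u} k) 0).obj (ModuleCat.of k k)) m) :
    cochainSingleEquiv k K' m j h ((Cochain.ofHom g).comp z (zero_add m)) =
      (cochainSingleEquiv k K m j h z).comp (g.f j).hom := by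
  obtain ⟨f, rfl⟩ := (Cochain.toSingleEquiv h).symm.surjective z
  have e₁ : (Cochain.ofHom g).comp ((Cochain.toSingleEquiv h).symm f) (zero_add m) =
    Cochain.toSingleMk (g.f j ≫ f) h := (Cochain.toSingleMk_precomp f h g).symm
  have e₂ : cochainSingleEquiv k K' m j h (Cochain.toSingleMk (g.f j ≫ f) h) =
      (g.f j ≫ f).hom :=
    congrArg ModuleCat.Hom.hom (Cochain.toSingleEquiv_toSingleMk (g.f j ≫ f) h)
  have e₃ : cochainSingleEquiv k K m j h ((Cochain.toSingleEquiv h).symm f) = f.hom :=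
    congrArg ModuleCat.Hom.hom (Cochain.toSingleEquiv_toSingleMk f h)
  rw [e₁, e₂, e₃]
  rfl

/-- The complex of cochains with values in `k`, around the degree `m`, is the dual of the
complex `K`, around the degree `-m`. The signs on the outer terms compensate those in the
differential of cochains. -/
def homCxSingleSc (m : ℤ) :
    homCxFunctor k ((singleFunctor (ModuleCat.{u} k) 0).obj (ModuleCat.of k k)) ⋙
        HomologicalComplex.shortComplexFunctor' _ (ComplexShape.up ℤ) (m - 1) m (m + 1) ≅
      (HomologicalComplex.shortComplexFunctor' (ModuleCat.{u} k) (ComplexShape.up ℤ)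
        (-m - 1) (-m) (-m + 1)).op ⋙ ShortComplex.opFunctor _ ⋙ (linearDual k).mapShortComplex :=
  NatIso.ofComponents (fun K => ShortComplex.isoMk
    (m.negOnePow • (cochainSingleEquiv k K.unop (m - 1) (-m + 1) (by lia)).toModuleIso)
    (cochainSingleEquiv k K.unop m (-m) (by lia)).toModuleIso
    ((m + 1).negOnePow • (cochainSingleEquiv k K.unop (m + 1) (-m - 1) (by lia)).toModuleIso)
    (by
      refine ModuleCat.hom_ext (LinearMap.ext fun z => ?_)
      exact (cochainSingleEquiv_δ k K.unop (m - 1) m (-m + 1) (-m) (by lia) (by lia) z).symm)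
    (by
      refine ModuleCat.hom_ext (LinearMap.ext fun z => ?_)
      have e := congrArg (fun t => (m + 1).negOnePow • t)
        (cochainSingleEquiv_δ k K.unop m (m + 1) (-m) (-m - 1) (by lia) (by lia) z)
      refine Eq.trans ?_ e.symm
      exact ((smul_smul _ _ _).trans ((congrArg (fun t => t • _) (Int.units_mul_self _)).trans
        (one_smul ℤˣ _))).symm))
    (fun {K K'} g => by
      refine ShortComplex.hom_ext _ _ ?_ ?_ ?_
      · refine ModuleCat.hom_ext (LinearMap.ext fun z => ?_)
        exact congrArg (fun t => m.negOnePow • t)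
          (cochainSingleEquiv_precomp k g.unop (m - 1) (-m + 1) (by lia) z)
      · refine ModuleCat.hom_ext (LinearMap.ext fun z => ?_)
        exact cochainSingleEquiv_precomp k g.unop m (-m) (by lia) z
      · refine ModuleCat.hom_ext (LinearMap.ext fun z => ?_)
        exact congrArg (fun t => (m + 1).negOnePow • t)
          (cochainSingleEquiv_precomp k g.unop (m + 1) (-m - 1) (by lia) z))

variable [HasDerivedCategory.{w₂} (ModuleCat.{u} k)]

omit [HasDerivedCategory.{w₂} (ModuleCat.{u} k)] in
lemma isKInjective_single_of_isField : CochainComplex.IsKInjective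
    ((singleFunctor (ModuleCat.{u} k) 0).obj (ModuleCat.of k k)) := by
  have (m : ℤ) : Injective (((singleFunctor (ModuleCat.{u} k) 0).obj (ModuleCat.of k k)).X m) :=
    injective_of_isField k hk _
  exact isKInjective_of_injective _ 0

/-- Over a field, `k` in degree `0` is its own injective resolution, so that the derived dual is the
term-by-term dual, which commutes with homology. -/
lemma nonempty_derivedDual_homology_iso (m m' : ℤ) (h : m' + m = 0) :
    Nonempty (derivedDual k ⋙ DerivedCategory.homologyFunctor _ m ≅
      (DerivedCategory.homologyFunctor _ m').op ⋙ linearDual k) := by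
  obtain rfl : m' = -m := by lia
  have := linearDual_preservesHomology k hk
  have := isKInjective_single_of_isField k hk
  obtain ⟨e⟩ := nonempty_homCxFunctor_iso k (L := injRes (ModuleCat.of k k))
    (L' := (singleFunctor (ModuleCat.{u} k) 0).obj (ModuleCat.of k k))
    ((injResIso (ModuleCat.of k k)).symm ≪≫ (DerivedCategory.singleFunctorIsoCompQ _ 0).app _)
  let e₁ : HomologicalComplex.homologyFunctor (ModuleCat.{u} k) (ComplexShape.up ℤ) m ≅ _ :=
    HomologicalComplex.homologyFunctorIso' (ModuleCat.{u} k) (ComplexShape.up ℤ) (m - 1) m (m + 1)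
      (by simp) (by simp)
  let e₂ : HomologicalComplex.homologyFunctor (ModuleCat.{u} k) (ComplexShape.up ℤ) (-m) ≅ _ :=
    HomologicalComplex.homologyFunctorIso' (ModuleCat.{u} k) (ComplexShape.up ℤ) (-m - 1) (-m)
      (-m + 1) (by simp) (by simp)
  let F := HomologicalComplex.shortComplexFunctor' (ModuleCat.{u} k) (ComplexShape.up ℤ)
    (-m - 1) (-m) (-m + 1)
  exact ⟨liftQOpIso (Functor.isoWhiskerRight (RHomFac k (ModuleCat.of k k) ≪≫ e)
      (DerivedCategory.homologyFunctor _ m) ≪≫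
    Functor.isoWhiskerLeft (homCxFunctor k _)
      (DerivedCategory.homologyFunctorFactors _ m ≪≫ e₁) ≪≫
    Functor.isoWhiskerRight (homCxSingleSc k m) (ShortComplex.homologyFunctor _) ≪≫
    Functor.isoWhiskerLeft (F.op ⋙ ShortComplex.opFunctor _)
      (ShortComplex.homologyFunctorIso (linearDual k)) ≪≫
    Functor.isoWhiskerRight (Functor.isoWhiskerLeft F.op
      (ShortComplex.homologyFunctorOpNatIso (ModuleCat.{u} k)).symm) (linearDual k) ≪≫
    Functor.isoWhiskerRight (NatIso.op (DerivedCategory.homologyFunctorFactors _ (-m) ≪≫ e₂))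
      (linearDual k))⟩

lemma nonempty_shift_derivedDual_homology_iso (d i j : ℤ) (h : i + j = d) :
    Nonempty (derivedDual k ⋙ CategoryTheory.shiftFunctor _ (-d) ⋙
        DerivedCategory.homologyFunctor _ i ≅
      (DerivedCategory.homologyFunctor _ j).op ⋙ linearDual k) := by
  obtain ⟨e⟩ := nonempty_derivedDual_homology_iso k hk (i - d) j (by lia)
  exact ⟨Functor.isoWhiskerLeft (derivedDual k)
    ((DerivedCategory.homologyFunctor (ModuleCat.{u} k) 0).shiftIso (-d) i (i - d) (by lia)) ≪≫ e⟩

end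
end
end PosetDuality

theorem mainTheorem9 (k : Type u) [CommRing k] (n : ℕ)
    [HasDerivedCategory.{w₁} (Shv k (AffF1.{u} n))] [HasDerivedCategory.{w₂} (ModuleCat.{u} k)] :
    (∃ _ : HasRΓ.{u, w₂} k (⊤ : TopologicalSpace.Opens (AffF1.{u} n)) {zeroPt n},
      Nonempty (RHom k (canonicalSheaf k n) ≅
        (RΓ k ⊤ {zeroPt n}).op ⋙ derivedDual k ⋙ shiftFunctor _ (-(n : ℤ))) ∧
      (IsField k → ∀ i : ℤ, Nonempty (
        (DerivedCategory.singleFunctor (Shv k (AffF1.{u} n)) 0).op ⋙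
            RHom k (canonicalSheaf k n) ⋙ DerivedCategory.homologyFunctor _ i ≅
          (DerivedCategory.singleFunctor (Shv k (AffF1.{u} n)) 0 ⋙ RΓ k ⊤ {zeroPt n} ⋙
            DerivedCategory.homologyFunctor _ ((n : ℤ) - i)).op ⋙ linearDual k))) ∧
    (∀ p : AffF1.{u} n, ∃ _ : HasRΓ.{u, w₂} k (minOpen p) {p},
      Nonempty (RSheafHom k (canonicalSheaf k n) ⋙ derivedStalk k p ≅
        (RΓ k (minOpen p) {p}).op ⋙ derivedDual k ⋙ shiftFunctor _ (-(dimMinOpen p : ℤ))) ∧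
      (IsField k → ∀ i : ℤ, Nonempty (
        (DerivedCategory.singleFunctor (Shv k (AffF1.{u} n)) 0).op ⋙
            RSheafHom k (canonicalSheaf k n) ⋙ DerivedCategory.homologyFunctor _ i ⋙ stalkAt k p ≅
          (DerivedCategory.singleFunctor (Shv k (AffF1.{u} n)) 0 ⋙ RΓ k (minOpen p) {p} ⋙
            DerivedCategory.homologyFunctor _ ((dimMinOpen p : ℤ) - i)).op ⋙ linearDual k))) := by
  constructor
  · obtain ⟨h, ⟨e⟩⟩ := nonempty_RHom_iso.{u, w₁, w₂} k
      (Finset.univ : Finset {i // i ∉ pointSet (zeroPt.{u} n)}).toList (Finset.nodup_toList _)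
      (fun i => Finset.mem_toList.2 (Finset.mem_univ i))
    have hn : (Finset.univ : Finset {i // i ∉ pointSet (zeroPt.{u} n)}).toList.length = n := by
      rw [Finset.length_toList, Finset.card_univ]
      refine (Fintype.card_congr (Equiv.subtypeUnivEquiv fun i => Finset.notMem_empty i)).trans ?_
      rw [Fintype.card_ulift, Fintype.card_fin]
    rw [hn] at e
    rw [← minOpen_zeroPt]
    refine ⟨h, ⟨e⟩, fun hk i => ?_⟩
    obtain ⟨e'⟩ := nonempty_shift_derivedDual_homology_iso k hk n i (n - i) (by lia)
    exact ⟨Functor.isoWhiskerLeft (DerivedCategory.singleFunctor _ 0).op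
      (Functor.isoWhiskerRight e (DerivedCategory.homologyFunctor _ i) ≪≫
        Functor.isoWhiskerLeft (RΓ k _ _).op e')⟩
  · intro p
    obtain ⟨h, ⟨e⟩⟩ := nonempty_RSheafHom_iso.{u, w₁, w₂} k p
      (Finset.univ : Finset {i // i ∉ pointSet p}).toList (Finset.nodup_toList _)
      (fun i => Finset.mem_toList.2 (Finset.mem_univ i))
    rw [Finset.length_toList, Finset.card_univ, ← dimMinOpen_eq] at e
    refine ⟨h, ⟨e⟩, fun hk i => ?_⟩
    obtain ⟨e'⟩ := nonempty_shift_derivedDual_homology_iso k hk (dimMinOpen p) i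
      (dimMinOpen p - i) (by lia)
    exact ⟨Functor.isoWhiskerLeft (DerivedCategory.singleFunctor _ 0).op
      (Functor.isoWhiskerLeft (RSheafHom k (canonicalSheaf k n))
        (mapDerivedCategoryHomologyIso (stalkAt k p) i).symm ≪≫
        Functor.isoWhiskerRight e (DerivedCategory.homologyFunctor _ i) ≪≫
        Functor.isoWhiskerLeft (RΓ k (minOpen p) {p}).op e')⟩
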